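/- Write $\mathbb{R}_+=(0,\infty)$, let $(\cdot,\cdot)$ be the inner product of $L^2(\mathbb{R}_+)$ (linear in the first argument), and let $(\mathsf{L}f)(\lambda)=\int_0^\infty e^{-t\lambda}f(t)\,dt$, $\lambda>0$, be the Laplace transform on $L^2(\mathbb{R}_+)$. Let $\sigma_0\colon\mathbb{R}\to\mathbb{R}$ satisfy (Assumption Hfree): $\sigma_0\ge 0$, $\operatorname{supp}\sigma_0\subset[0,\infty)$, $\sigma_0\in L^\infty_{\mathrm{loc}}(\mathbb{R}_+)$, $\sigma_0(\lambda)=O(\lambda^{-l_+})$ as $\lambda\to 0+$ for some $l_+<1$, and $\sigma_0(\lambda)=O(\lambda^{l_-})$ as $\lambda\to\infty$ for some $l_-\in\mathbb{R}$ (all conditions up to null sets). The Hankel operator $H_0\geq 0$ with sigma-function $\sigma_0$ (formally, with kernel $h_0(t)=\int_0^\infty e^{-t\lambda}\sigma_0(\lambda)\,d\lambda$) is the one given by the form $$h_0[f,g]=\int_0^\infty(\mathsf{L}f)(\lambda)\,\overline{(\mathsf{L}g)(\lambda)}\,\sigma_0(\lambda)\,d\lambda,\qquad f,g\in\mathcal{D}[h_0]=\Big\{f\in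 L^2(\mathbb{R}_+):\int_0^\infty|(\mathsf{L}f)(\lambda)|^2\sigma_0(\lambda)\,d\lambda<\infty\Big\}.$$ Let $V$ be the bounded Hankel operator $(Vf)(t)=\int_0^\infty v(t+s)f(s)\,ds$ on $L^2(\mathbb{R}_+)$ with kernel $$v(t)=v_0(t+\rho)^k e^{-\beta t},\qquad v_0\in\mathbb{R},\ \beta>0,\ \rho\ge 0,\ k>0,\ k\notin\mathbb{Z},$$ and let $h[f,g]=h_0[f,g]+(Vf,g)$ on $\mathcal{D}[h]=\mathcal{D}[h_0]$. Then there is a (unique) self-adjoint operator $H=H_0+V$ corresponding to the form $h$, i.e. $f\in\mathcal{D}(H)$ and $Hf=u$ if and only if $f\in\mathcal{D}[h]$ and $h[f,g]=(u,g)$ for all $g\in\mathcal{D}[h]$. Let $N_-(H)\in\{0,1,2,\dots\}\cup\{\infty\}$ denote the total number of negative eigenvalues of $H$ counted with multiplicities; it equals the maximal dimension of linear subspaces of $\mathcal{D}[h]$ on which $h[f,f]<0$ for all $f\neq 0$. With $[k]$ the integer part of $k$: 1. If $v_0>0$ and $[k]$ is odd, then $N_-(H)=([k]+1)/2$. 2.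 If $v_0<0$ and $[k]$ is even, then $N_-(H)=[k]/2+1$. 3. If $v_0>0$ and $[k]$ is even, or $v_0<0$ and $[k]$ is odd, then $N_-(H)=\infty$. -/

import Mathlib

open MeasureTheory Set Filter Topology Asymptotics

namespace HankelPerturbation

/-- The Hilbert space `L²(ℝ₊)` of complex-valued functions, `ℝ₊ = (0, ∞)`. -/
abbrev L2Pos : Type := Lp ℂ 2 (volume.restrict (Ioi (0 : ℝ)))

/-- The Laplace transform `(Lf)(x) = ∫₀^∞ e^{-tx} f(t) dt`
(absolutely convergent for `f ∈ L²(ℝ₊)` and `x > 0`). -/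
noncomputable def laplace (f : ℝ → ℂ) (x : ℝ) : ℂ :=
  ∫ t in Ioi (0 : ℝ), ((Real.exp (-(t * x)) : ℝ) : ℂ) * f t

/-- The conditions on the sigma-function `σ₀` of the unperturbed operator: it is nonnegative,
supported in `[0, ∞)`, locally bounded on the open half-line, `O(x^{-l₊})` at zero with some
`l₊ < 1` and `O(x^{l₋})` at infinity with some `l₋`.  Everything is understood up to sets of
Lebesgue measure zero. -/
structure IsFreeSigma (σ₀ : ℝ → ℝ) : Prop where
  nonneg : ∀ᵐ x ∂(volume : Measure ℝ), 0 ≤ σ₀ x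
  support : ∀ᵐ x ∂(volume : Measure ℝ), x < 0 → σ₀ x = 0
  locBounded : ∀ a b : ℝ, 0 < a → MemLp σ₀ ⊤ (volume.restrict (Icc a b))
  atZero : ∃ lp : ℝ, lp < 1 ∧
    σ₀ =O[𝓝[>] (0 : ℝ) ⊓ ae (volume : Measure ℝ)] fun x : ℝ => x ^ (-lp)
  atInfty : ∃ lm : ℝ,
    σ₀ =O[atTop ⊓ ae (volume : Measure ℝ)] fun x : ℝ => x ^ lm

/-- The measure `dM₀(x) = σ₀(x) dx` on `(0, ∞)`. -/
noncomputable def sigmaMeasure (σ₀ : ℝ → ℝ) : Measure ℝ :=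
  (volume.restrict (Ioi (0 : ℝ))).withDensity fun x => ENNReal.ofReal (σ₀ x)

theorem laplace_integrable (f : L2Pos) {x : ℝ} (hx : 0 < x) :
    Integrable (fun t : ℝ => ((Real.exp (-(t * x)) : ℝ) : ℂ) * f t)
      (volume.restrict (Ioi (0 : ℝ))) := by
  have h1 : MemLp (fun t : ℝ => ((Real.exp (-(t * x)) : ℝ) : ℂ)) 2
      (volume.restrict (Ioi (0 : ℝ))) := by
    have hm : AEStronglyMeasurable (fun t : ℝ => ((Real.exp (-(t * x)) : ℝ) : ℂ))
        (volume.restrict (Ioi (0 : ℝ))) := by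
      apply Continuous.aestronglyMeasurable
      fun_prop
    rw [memLp_two_iff_integrable_sq_norm hm]
    have h2 : IntegrableOn (fun t : ℝ => Real.exp (-(2 * x) * t)) (Ioi (0 : ℝ)) :=
      integrableOn_exp_mul_Ioi (by linarith) 0
    refine Integrable.congr h2 (Eventually.of_forall fun t => ?_)
    simp only [Complex.norm_real, Real.norm_eq_abs, Real.abs_exp]
    rw [← Real.exp_nat_mul]
    congr 1
    push_cast
    ring
  exact h1.integrable_mul (Lp.memLp f)

theorem laplace_congr {f g : ℝ → ℂ} (h : f =ᵐ[volume.restrict (Ioi (0 : ℝ))] g) (x : ℝ) :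
    laplace f x = laplace g x := by
  refine integral_congr_ae ?_
  filter_upwards [h] with t ht
  rw [ht]

theorem sigmaMeasure_pos (σ₀ : ℝ → ℝ) : ∀ᵐ x ∂(sigmaMeasure σ₀), 0 < x := by
  have h : sigmaMeasure σ₀ ≪ volume.restrict (Ioi (0 : ℝ)) :=
    withDensity_absolutelyContinuous _ _
  exact h.ae_le (ae_restrict_mem measurableSet_Ioi)

/-- The form domain `D[h₀] = {f ∈ L²(ℝ₊) : ∫₀^∞ |(Lf)(x)|² σ₀(x) dx < ∞}`. -/
noncomputable def formDomain (σ₀ : ℝ → ℝ) : Submodule ℂ L2Pos where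
  carrier := {f | MemLp (laplace f) 2 (sigmaMeasure σ₀)}
  zero_mem' := by
    have h : laplace (0 : L2Pos) = fun _ => 0 := by
      funext x
      rw [laplace_congr (Lp.coeFn_zero ℂ 2 _) x]
      simp [laplace]
    change MemLp (laplace (0 : L2Pos)) 2 _
    rw [h]
    exact MemLp.zero
  add_mem' := by
    intro f g hf hg
    have hf' : MemLp (laplace f) 2 (sigmaMeasure σ₀) := hf
    have hg' : MemLp (laplace g) 2 (sigmaMeasure σ₀) := hg
    refine MemLp.ae_eq ?_ (hf'.add hg')
    filter_upwards [sigmaMeasure_pos σ₀] with x hx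
    rw [laplace_congr (Lp.coeFn_add f g) x]
    simp only [laplace, Pi.add_apply, mul_add]
    exact (integral_add (laplace_integrable f hx) (laplace_integrable g hx)).symm
  smul_mem' := by
    intro c f hf
    have hf' : MemLp (laplace f) 2 (sigmaMeasure σ₀) := hf
    have h : laplace (c • f : L2Pos) = c • laplace f := by
      funext x
      rw [laplace_congr (Lp.coeFn_smul c f) x]
      simp only [laplace, Pi.smul_apply, smul_eq_mul]
      rw [← integral_const_mul]
      congr 1
      funext t
      ring
    change MemLp (laplace (c • f : L2Pos)) 2 _
    rw [h]
    exact hf'.const_smul c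

/-- The form `h₀[f, g] = ∫₀^∞ (Lf)(x) conj((Lg)(x)) σ₀(x) dx` of the unperturbed operator. -/
noncomputable def freeForm (σ₀ : ℝ → ℝ) (f g : L2Pos) : ℂ :=
  ∫ x, laplace f x * (starRingEnd ℂ) (laplace g x) ∂(sigmaMeasure σ₀)

/-- The kernel `v(t) = v₀ (t + ρ)^k e^{-βt}`. -/
noncomputable def quasiCarlemanKernel (v₀ β ρ k : ℝ) (t : ℝ) : ℝ :=
  v₀ * (t + ρ) ^ k * Real.exp (-(β * t))

/-- The action `(Vf)(t) = ∫₀^∞ v(t + s) f(s) ds` of the Hankel operator with kernel `v`. -/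
noncomputable def hankel (v : ℝ → ℝ) (f : ℝ → ℂ) (t : ℝ) : ℂ :=
  ∫ s in Ioi (0 : ℝ), (v (t + s) : ℂ) * f s

/-- The form `h[f, g] = h₀[f, g] + (Vf, g)` of the operator `H = H₀ + V`; it is linear in `f`,
antilinear in `g`, and is considered on `formDomain σ₀`. -/
noncomputable def perturbedForm (σ₀ v : ℝ → ℝ) (f g : L2Pos) : ℂ :=
  freeForm σ₀ f g + ∫ t in Ioi (0 : ℝ), hankel v f t * (starRingEnd ℂ) (g t)

section General

/-- `T` is the operator corresponding to the sesquilinear form `q` (linear in the first argument)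
with domain `D`: its graph consists of the pairs `(f, u)` such that `f ∈ D` and
`q[f, g] = (u, g)` for all `g ∈ D`.  In particular `T` is determined by `D` and `q`. -/
def IsOperatorOfForm {E : Type*} [NormedAddCommGroup E] [InnerProductSpace ℂ E]
    (D : Submodule ℂ E) (q : E → E → ℂ) (T : E →ₗ.[ℂ] E) : Prop :=
  ∀ f u : E, (f, u) ∈ T.graph ↔ f ∈ D ∧ ∀ g ∈ D, q f g = inner ℂ g u

/-- The number `N₋(q; D)`: the maximal dimension (possibly `∞`) of linear subspaces `K` of `D`
such that `q[f, f] < 0` for all nonzero `f ∈ K`. -/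
noncomputable def negIndex {E : Type*} [AddCommGroup E] [Module ℂ E]
    (D : Submodule ℂ E) (q : E → E → ℂ) : ℕ∞ :=
  ⨆ K : {K : Submodule ℂ E // K ≤ D ∧ ∀ f ∈ K, f ≠ 0 → (q f f).re < 0},
    Cardinal.toENat (Module.rank ℂ K.1)

/-- The total number of negative eigenvalues of `T`, counted with multiplicities: the dimension of
the linear span of all eigenvectors of `T` with negative eigenvalues. -/
noncomputable def negEigenvalueCount {E : Type*} [AddCommGroup E] [Module ℂ E]
    (T : E →ₗ.[ℂ] E) : ℕ∞ :=
  Cardinal.toENat (Module.rank ℂ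
    (Submodule.span ℂ {f : E | ∃ μ : ℝ, μ < 0 ∧ (f, (μ : ℂ) • f) ∈ T.graph}))

/-- `N₋ = n` for the operator `T` given by the form `q` on `D`: both the total multiplicity of the
negative eigenvalues of `T` and the maximal dimension of negative subspaces of `q` equal `n`. -/
def NegNumberEq {E : Type*} [NormedAddCommGroup E] [InnerProductSpace ℂ E]
    (D : Submodule ℂ E) (q : E → E → ℂ) (T : E →ₗ.[ℂ] E) (n : ℕ∞) : Prop :=
  negEigenvalueCount T = n ∧ negIndex D q = n

end General

end HankelPerturbation

/-!
The operator. The Laplace transform is a closed operator from the form domain to `L²(σ₀ dx)`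
(`hasClosedGraph_laplaceLp`), the form domain is dense (`dense_formDomain`), and `V` is compact and
symmetric (`exists_hankel_operator`). The form of `H` is thus `‖S f‖² + ⟪f, K f⟫` with `S` closed
and densely defined and `K` compact and symmetric, and it corresponds to a self-adjoint operator
(`isSelfAdjoint_formOperator`). Since `K` is compact, a form of this kind attains its minimum on the
unit sphere of a closed subspace whenever the infimum is negative (`exists_minimizer`). Hence it is
nonnegative on the orthogonal complement of the eigenvectors with negative eigenvalues, if these are
finitely many, and the number of such eigenvalues is the maximal dimension of a negative subspace
(`negEigenvalueCount_formOperator`). It remains to find this dimension.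

The sigma-function of the perturbation. Put `n = [k]`. The Taylor remainder of `e^{-x}` of order `n`
has the sign `(-1) ^ (n + 1)`, and scaling shows that
`x ^ k = c ∫ μ ^ (-k - 1) (e^{-xμ} - ∑_{j ≤ n} (-xμ) ^ j / j!) dμ`, where `c` has this sign.
Inserted into the form of `V`, this gives `(Vf, f) = τ ∫ μ ^ (-k - 1) (D(μ) - Q(μ)) dμ`, where
`D(μ) = e^{-ρμ} |(Lf)(β + μ)|²`, `Q` is the Taylor polynomial of `D` of degree `n` at zero, and `τ`
has the sign of `v₀ (-1) ^ (n + 1)` (`hankel_form_eq`).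

Positive `τ`. If `Lf` has a zero of order `n / 2 + 1` at `β`, which amounts to `n / 2 + 1` linear
conditions on `f`, then `Q = 0` and the form is nonnegative; so the index is at most `n / 2 + 1`
(`negIndex_le_of_sigmaCoeff_pos`). For the converse choose `f` such that `D = |p|² φ²`, where `p` is
a polynomial of degree at most `n / 2`, and `0 ≤ φ ≤ 1` equals `1` up to `O(μ ^ (n + 1))` at zero.
Then `Q = |p|²`, and `(Vf, f) = -τ ∫ μ ^ (-k - 1) |p|² (1 - φ²) dμ` is negative. A high power of the
function `bump` in `φ` concentrates `Lf` at the point `β`, which makes the contribution of `σ₀`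
negligible, but does not make the regularized integral smaller (`le_negIndex_of_sigmaCoeff_pos`).

Negative `τ`. If `Lf` has a zero of high order at `β`, then the form of `V` has the density
`τ μ ^ (-k - 1) e^{-ρμ}`, which is more negative than `σ₀`, bounded near `β`, is positive on a small
interval to the right of `β`. Functions of the form `p(x - β) (x - β) ^ m bump(x) ^ N`, with `bump`
centred in this interval and `N` large, are concentrated there, and `p` runs through a space of
arbitrary finite dimension (`negIndex_eq_top_of_sigmaCoeff_neg`).
-/

namespace HankelPerturbation

/-! ### Operators given by closed forms -/

section AbstractForm

variable {E F : Type*} [NormedAddCommGroup E] [InnerProductSpace ℂ E]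
  [NormedAddCommGroup F] [InnerProductSpace ℂ F]

/-- Closedness of the (unbounded) operator `S` with domain `D`, in terms of sequences. -/
def HasClosedGraph (D : Submodule ℂ E) (S : D →ₗ[ℂ] F) : Prop :=
  ∀ (x : ℕ → D) (a : E) (b : F), Tendsto (fun n => (x n : E)) atTop (𝓝 a) →
    Tendsto (fun n => S (x n)) atTop (𝓝 b) → ∃ h : a ∈ D, S ⟨a, h⟩ = b

/-- The sesquilinear form `⟪S g, S f⟫ + ⟪g, K f⟫` of the formal sum `S* S + K`; it is linear
in the second argument. -/
noncomputable def sumForm (D : Submodule ℂ E) (S : D →ₗ[ℂ] F) (K : E →L[ℂ] E) (g f : D) : ℂ :=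
  inner ℂ (S g) (S f) + inner ℂ (g : E) (K f)

theorem sumForm_add_right (D : Submodule ℂ E) (S : D →ₗ[ℂ] F) (K : E →L[ℂ] E) (g f f' : D) :
    sumForm D S K g (f + f') = sumForm D S K g f + sumForm D S K g f' := by
  simp only [sumForm, Submodule.coe_add, map_add, inner_add_right]
  ring

theorem sumForm_smul_right (D : Submodule ℂ E) (S : D →ₗ[ℂ] F) (K : E →L[ℂ] E) (c : ℂ) (g f : D) :
    sumForm D S K g (c • f) = c * sumForm D S K g f := by
  simp only [sumForm, Submodule.coe_smul, map_smul, inner_smul_right]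
  ring

/-- The graph of the operator corresponding to the form `sumForm D S K`. -/
noncomputable def formGraph (D : Submodule ℂ E) (S : D →ₗ[ℂ] F) (K : E →L[ℂ] E) :
    Submodule ℂ (E × E) where
  carrier := {p | ∃ f : D, (f : E) = p.1 ∧ ∀ g : D, sumForm D S K g f = inner ℂ (g : E) p.2}
  zero_mem' := ⟨0, rfl, fun g => by simp [sumForm]⟩
  add_mem' := by
    rintro p p' ⟨f, hf, h⟩ ⟨f', hf', h'⟩
    refine ⟨f + f', by simp [hf, hf'], fun g => ?_⟩
    rw [sumForm_add_right, h, h', Prod.snd_add, inner_add_right]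
  smul_mem' := by
    rintro c p ⟨f, hf, h⟩
    refine ⟨c • f, by simp [hf], fun g => ?_⟩
    rw [sumForm_smul_right, h, Prod.smul_snd, inner_smul_right]

variable {D : Submodule ℂ E} {S : D →ₗ[ℂ] F} {K : E →L[ℂ] E}

theorem sumForm_conj (hK : ∀ x y : E, inner ℂ (K x) y = inner ℂ x (K y)) (f g : D) :
    (starRingEnd ℂ) (sumForm D S K g f) = sumForm D S K f g := by
  simp only [sumForm, map_add, inner_conj_symm, hK]

theorem snd_eq_zero_of_mem_formGraph (hD : Dense (D : Set E)) {p : E × E}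
    (hp : p ∈ formGraph D S K) (h0 : p.1 = 0) : p.2 = 0 := by
  obtain ⟨f, hf, h⟩ := hp
  have hf0 : f = 0 := Subtype.ext (hf.trans h0)
  refine hD.eq_zero_of_inner_right ℂ fun g hg => ?_
  simpa [sumForm, hf0] using (h ⟨g, hg⟩).symm

/-- The form of `S* S + 1` represents every bounded functional: the solution is the first component
of the orthogonal projection of `(u, 0)` onto the graph of `S`. -/
theorem exists_resolvent [CompleteSpace E] [CompleteSpace F] (hS : HasClosedGraph D S) (u : E) :
    ∃ f : D, ∀ g : D, inner ℂ (S g) (S f) + inner ℂ (g : E) (f : E) = inner ℂ (g : E) u := by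
  let J : D →ₗ[ℂ] WithLp 2 (E × F) :=
    (WithLp.linearEquiv 2 ℂ (E × F)).symm.toLinearMap ∘ₗ (D.subtype.prod S)
  let G : Submodule ℂ (WithLp 2 (E × F)) := LinearMap.range J
  have hG : IsClosed (G : Set (WithLp 2 (E × F))) := by
    refine IsSeqClosed.isClosed fun x p hx hp => ?_
    choose y hy using hx
    have h1 : Tendsto (fun n => WithLp.ofLp (x n)) atTop (𝓝 (WithLp.ofLp p)) :=
      ((WithLp.prod_continuous_ofLp 2 E F).tendsto p).comp hp
    have h2 := (continuous_fst.tendsto _).comp h1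
    have h3 := (continuous_snd.tendsto _).comp h1
    obtain ⟨ha, hb⟩ := hS y (WithLp.ofLp p).1 (WithLp.ofLp p).2
      (h2.congr fun n => by simp [← hy n, J]) (h3.congr fun n => by simp [← hy n, J])
    refine ⟨⟨_, ha⟩, ?_⟩
    apply (WithLp.ofLp_injective 2)
    exact Prod.ext rfl hb
  have : CompleteSpace G := hG.completeSpace_coe
  obtain ⟨f, hf⟩ := (G.starProjection_apply_mem (WithLp.toLp 2 (u, (0 : F))) :)
  refine ⟨f, fun g => ?_⟩
  have h1 := G.starProjection_inner_eq_zero (WithLp.toLp 2 (u, (0 : F))) (J g) ⟨g, rfl⟩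
  rw [← hf, ← inner_conj_symm, map_eq_zero, inner_sub_right, sub_eq_zero] at h1
  simp only [WithLp.prod_inner_apply, J, LinearMap.comp_apply, LinearEquiv.coe_coe,
    WithLp.linearEquiv_symm_apply, LinearMap.prod_apply, Function.prod,
    inner_zero_right, add_zero] at h1
  rw [add_comm]
  exact h1.symm

/-- The operator `S* S + K` corresponding to `sumForm D S K`. -/
noncomputable def formOperator (D : Submodule ℂ E) (S : D →ₗ[ℂ] F) (K : E →L[ℂ] E) :
    E →ₗ.[ℂ] E :=
  (formGraph D S K).toLinearPMap

theorem formOperator_graph (hD : Dense (D : Set E)) :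
    (formOperator D S K).graph = formGraph D S K :=
  Submodule.toLinearPMap_graph_eq _ fun _ hp h0 => snd_eq_zero_of_mem_formGraph hD hp h0

/-- Solvability of `(S* S + 1) f = w`, written in terms of `S* S + K`. -/
theorem exists_mem_formGraph [CompleteSpace E] [CompleteSpace F] (hS : HasClosedGraph D S)
    (w : E) : ∃ f : D, ((f : E), w - f + K f) ∈ formGraph D S K ∧
      ∀ g : D, inner ℂ (S g) (S f) + inner ℂ (g : E) (f : E) = inner ℂ (g : E) w := by
  obtain ⟨f, hf⟩ := exists_resolvent hS w
  refine ⟨f, ⟨f, rfl, fun g => ?_⟩, hf⟩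
  simp only [sumForm, inner_add_right, inner_sub_right, ← hf g]
  ring

theorem dense_formOperator_domain [CompleteSpace E] [CompleteSpace F] (hD : Dense (D : Set E))
    (hS : HasClosedGraph D S) : Dense ((formOperator D S K).domain : Set E) := by
  rw [Submodule.dense_iff_topologicalClosure_eq_top, Submodule.topologicalClosure_eq_top_iff,
    Submodule.eq_bot_iff]
  intro u hu
  obtain ⟨f, hf, hf'⟩ := exists_mem_formGraph (K := K) hS u
  rw [← formOperator_graph hD] at hf
  have h1 := (Submodule.mem_orthogonal _ u).1 hu f (LinearPMap.mem_domain_of_mem_graph hf)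
  have h2 := hf' f
  rw [h1, inner_self_eq_norm_sq_to_K, inner_self_eq_norm_sq_to_K] at h2
  have h3 : ‖S f‖ ^ 2 + ‖(f : E)‖ ^ 2 = 0 :=
    (RCLike.ofReal_eq_zero (K := ℂ)).1 (by exact_mod_cast h2)
  have h4 : f = 0 := by
    have : ‖(f : E)‖ ^ 2 = 0 := by nlinarith [sq_nonneg ‖S f‖, sq_nonneg ‖(f : E)‖]
    simpa using this
  refine hD.eq_zero_of_inner_right ℂ fun g hg => ?_
  simpa [h4] using (hf' ⟨g, hg⟩).symm

theorem isSelfAdjoint_formOperator [CompleteSpace E] [CompleteSpace F] (hD : Dense (D : Set E))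
    (hS : HasClosedGraph D S) (hK : ∀ x y : E, inner ℂ (K x) y = inner ℂ x (K y)) :
    IsSelfAdjoint (formOperator D S K) := by
  rw [LinearPMap.isSelfAdjoint_def]
  apply LinearPMap.eq_of_eq_graph
  rw [LinearPMap.adjoint_graph_eq_graph_adjoint (dense_formOperator_domain hD hS),
    formOperator_graph hD]
  ext ⟨x, y⟩
  rw [Submodule.mem_adjoint_iff]
  constructor
  · intro h
    obtain ⟨f, hf, hf'⟩ := exists_mem_formGraph (K := K) hS (y - K x + x)
    have hxf : (f : E) = x := by
      refine ext_inner_left ℂ fun w => ?_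
      obtain ⟨a, ha, ha'⟩ := exists_mem_formGraph (K := K) hS w
      have h1 := sub_eq_zero.1 (h _ _ ha)
      have h2 := hf' a
      have h3 : inner ℂ (S a) (S f) + inner ℂ (a : E) (f : E) = inner ℂ w (f : E) := by
        rw [← inner_conj_symm w, ← ha' f]
        simp only [map_add, inner_conj_symm]
      simp only [inner_add_left, inner_sub_left, inner_add_right, inner_sub_right, hK] at h1 h2
      rw [h3] at h2
      linear_combination h2 - h1
    rw [hxf] at hf
    convert hf using 2
    abel
  · rintro ⟨f, hf, hf'⟩ a b ⟨f', hf2, hf2'⟩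
    have h1 := hf' f'
    have h2 := hf2' f
    simp only at hf hf2 h1 h2
    rw [sub_eq_zero, ← hf, ← hf2, ← h1, ← inner_conj_symm, ← h2, sumForm_conj hK]

end AbstractForm

/-! ### Minimizers of perturbed forms -/

section AbstractIndex

variable {E F : Type*} [NormedAddCommGroup E] [InnerProductSpace ℂ E]
  [NormedAddCommGroup F] [InnerProductSpace ℂ F]
  {D : Submodule ℂ E} {S : D →ₗ[ℂ] F} {K : E →L[ℂ] E}

/-- The quadratic form `‖S f‖² + re ⟪f, K f⟫ - μ ‖f‖²`. -/
noncomputable def shiftedQuad (D : Submodule ℂ E) (S : D →ₗ[ℂ] F) (K : E →L[ℂ] E) (μ : ℝ)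
    (f : D) : ℝ :=
  ‖S f‖ ^ 2 + (inner ℂ (f : E) (K f)).re - μ * ‖(f : E)‖ ^ 2

theorem shiftedQuad_eq_re (μ : ℝ) (f : D) :
    shiftedQuad D S K μ f = (sumForm D S K f f).re - μ * ‖(f : E)‖ ^ 2 := by
  rw [shiftedQuad, sumForm, inner_self_eq_norm_sq_to_K, Complex.add_re]
  norm_cast

theorem shiftedQuad_smul (μ : ℝ) (c : ℂ) (f : D) :
    shiftedQuad D S K μ (c • f) = ‖c‖ ^ 2 * shiftedQuad D S K μ f := by
  have h : inner ℂ ((c • f : D) : E) (K (c • f : D)) = ((‖c‖ ^ 2 : ℝ) : ℂ) *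
      inner ℂ (f : E) (K f) := by
    rw [Submodule.coe_smul, map_smul, inner_smul_left, inner_smul_right, ← mul_assoc,
      ← Complex.normSq_eq_norm_sq, Complex.normSq_eq_conj_mul_self]
  rw [shiftedQuad, h, Complex.re_ofReal_mul, map_smul, Submodule.coe_smul, norm_smul, norm_smul,
    shiftedQuad]
  ring

theorem shiftedQuad_add (hK : ∀ x y : E, inner ℂ (K x) y = inner ℂ x (K y)) (μ : ℝ) (f g : D) :
    shiftedQuad D S K μ (f + g) = shiftedQuad D S K μ f + shiftedQuad D S K μ g +
      2 * (sumForm D S K g f - μ * inner ℂ (g : E) (f : E)).re := by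
  have h1 : (inner ℂ (f : E) (K g)).re = (inner ℂ (g : E) (K f)).re := by
    rw [← hK, ← inner_conj_symm, Complex.conj_re]
  have h2 := norm_add_sq (𝕜 := ℂ) (S f) (S g)
  have h3 := norm_add_sq (𝕜 := ℂ) (f : E) (g : E)
  have h4 : RCLike.re (inner ℂ (S f) (S g)) = (inner ℂ (S g) (S f)).re := by
    rw [← inner_conj_symm]; exact Complex.conj_re _
  have h5 : RCLike.re (inner ℂ (f : E) (g : E)) = (inner ℂ (g : E) (f : E)).re := by
    rw [← inner_conj_symm]; exact Complex.conj_re _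
  rw [h4] at h2
  rw [h5] at h3
  simp only [shiftedQuad, sumForm, map_add, Submodule.coe_add, inner_add_left, inner_add_right,
    Complex.add_re, Complex.sub_re, Complex.re_ofReal_mul, h2, h3, h1]
  ring

/-- A consequence of the parallelogram identity. -/
theorem shiftedQuad_sub_le (hK : ∀ x y : E, inner ℂ (K x) y = inner ℂ x (K y)) (μ : ℝ) (f g : D)
    (h : 0 ≤ shiftedQuad D S K μ (f + g)) :
    shiftedQuad D S K μ (f - g) ≤ 2 * shiftedQuad D S K μ f + 2 * shiftedQuad D S K μ g := by
  have h1 := shiftedQuad_add (S := S) hK μ f g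
  have h2 := shiftedQuad_add (S := S) hK μ f ((-1 : ℂ) • g)
  rw [shiftedQuad_smul] at h2
  have h3 : f + (-1 : ℂ) • g = f - g := by simp [sub_eq_add_neg]
  have h4 : (sumForm D S K ((-1 : ℂ) • g) f - μ * inner ℂ (((-1 : ℂ) • g : D) : E) (f : E)) =
      -(sumForm D S K g f - μ * inner ℂ (g : E) (f : E)) := by
    simp [sumForm]
    ring
  rw [h3, h4, Complex.neg_re] at h2
  simp only [norm_neg, norm_one, one_pow, one_mul] at h2
  linarith

/-- A nonnegative quadratic form that vanishes at `f` has `f` in its kernel. -/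
theorem sumForm_eq_of_shiftedQuad_eq_zero
    (hK : ∀ x y : E, inner ℂ (K x) y = inner ℂ x (K y)) {μ : ℝ} {Z : Submodule ℂ E}
    (hpos : ∀ g : D, (g : E) ∈ Z → 0 ≤ shiftedQuad D S K μ g) {f : D} (hf : (f : E) ∈ Z)
    (h0 : shiftedQuad D S K μ f = 0) {g : D} (hg : (g : E) ∈ Z) :
    sumForm D S K g f = μ * inner ℂ (g : E) (f : E) := by
  set c : ℂ := sumForm D S K g f - μ * inner ℂ (g : E) (f : E) with hc
  suffices c = 0 from sub_eq_zero.1 this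
  have hQ := hpos g hg
  set Q := shiftedQuad D S K μ g with hQd
  -- expand the form at `f - ε c g` and keep the terms of first and second order in `ε`
  have key : ∀ ε : ℝ, 0 < ε → 2 * ‖c‖ ^ 2 * ε ≤ ε ^ 2 * ‖c‖ ^ 2 * Q := by
    intro ε hε
    set z : ℂ := -(ε : ℂ) * c with hz
    have h1 := shiftedQuad_add (S := S) hK μ f (z • g)
    have h2 : sumForm D S K (z • g) f - μ * inner ℂ ((z • g : D) : E) (f : E) =
        ((-(ε * ‖c‖ ^ 2) : ℝ) : ℂ) := by
      have : sumForm D S K (z • g) f - μ * inner ℂ ((z • g : D) : E) (f : E) =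
          (starRingEnd ℂ) z * c := by
        rw [hc]
        simp only [sumForm, map_smul, Submodule.coe_smul, inner_smul_left]
        ring
      rw [this, hz, map_mul, map_neg, Complex.conj_ofReal, mul_assoc,
        ← Complex.normSq_eq_conj_mul_self, Complex.normSq_eq_norm_sq]
      push_cast
      ring
    have h3 := hpos (f + z • g) (Z.add_mem hf (Z.smul_mem z hg))
    rw [h1, h2, shiftedQuad_smul, h0, Complex.ofReal_re, hz, norm_mul, norm_neg,
      Complex.norm_real, Real.norm_of_nonneg hε.le, ← hQd] at h3
    nlinarith
  have h1 := key (1 / (1 + Q)) (by positivity)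
  have h2 : (1 / (1 + Q)) ^ 2 * ‖c‖ ^ 2 * Q ≤ ‖c‖ ^ 2 * (1 / (1 + Q)) := by
    have : (1 / (1 + Q)) * Q ≤ 1 := by
      rw [one_div, inv_mul_le_iff₀ (by positivity)]; linarith
    calc (1 / (1 + Q)) ^ 2 * ‖c‖ ^ 2 * Q = ‖c‖ ^ 2 * (1 / (1 + Q)) * ((1 / (1 + Q)) * Q) := by ring
      _ ≤ ‖c‖ ^ 2 * (1 / (1 + Q)) * 1 := by gcongr
      _ = _ := by ring
  have h3 : ‖c‖ ^ 2 * (1 / (1 + Q)) ≤ 0 := by linarith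
  have h4 : ‖c‖ ^ 2 ≤ 0 := by
    by_contra h
    push Not at h
    have : 0 < ‖c‖ ^ 2 * (1 / (1 + Q)) := by positivity
    linarith
  have h5 : ‖c‖ = 0 := by nlinarith [norm_nonneg c]
  simpa using h5

theorem neg_norm_mul_le_shiftedQuad_zero (f : D) :
    -‖K‖ * ‖(f : E)‖ ^ 2 ≤ shiftedQuad D S K 0 f := by
  have h1 : |(inner ℂ (f : E) (K f)).re| ≤ ‖K‖ * ‖(f : E)‖ ^ 2 :=
    calc |(inner ℂ (f : E) (K f)).re| ≤ ‖inner ℂ (f : E) (K f)‖ := Complex.abs_re_le_norm _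
      _ ≤ ‖(f : E)‖ * ‖K f‖ := norm_inner_le_norm _ _
      _ ≤ ‖(f : E)‖ * (‖K‖ * ‖(f : E)‖) := by gcongr; exact K.le_opNorm _
      _ = _ := by ring
  have h2 := (abs_le.1 h1).1
  rw [shiftedQuad]
  nlinarith [sq_nonneg ‖S f‖]

/-- The bottom of the form on a closed subspace `Z`, if negative, is attained: compactness of `K`
makes a minimizing sequence Cauchy in the graph norm of `S`. The minimizer satisfies the
eigenvalue equation tested against `Z`. -/
theorem exists_minimizer [CompleteSpace E] [CompleteSpace F] (hS : HasClosedGraph D S)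
    (hK : ∀ x y : E, inner ℂ (K x) y = inner ℂ x (K y)) (hKc : IsCompactOperator K)
    {Z : Submodule ℂ E} (hZ : IsClosed (Z : Set E))
    (hneg : ∃ f : D, (f : E) ∈ Z ∧ (sumForm D S K f f).re < 0) :
    ∃ μ : ℝ, μ < 0 ∧ ∃ f : D, (f : E) ∈ Z ∧ (f : E) ≠ 0 ∧ ∀ g : D, (g : E) ∈ Z →
      sumForm D S K g f = μ * inner ℂ (g : E) (f : E) := by
  set R : Set ℝ := shiftedQuad D S K 0 '' {f : D | (f : E) ∈ Z ∧ ‖(f : E)‖ = 1} with hR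
  have hnorm : ∀ f : D, f ≠ 0 → (f : E) ∈ Z →
      shiftedQuad D S K 0 f / ‖(f : E)‖ ^ 2 ∈ R := by
    intro f hf hfZ
    have hf' : ‖(f : E)‖ ≠ 0 := by simpa using hf
    refine ⟨((‖(f : E)‖⁻¹ : ℝ) : ℂ) • f, ⟨Z.smul_mem _ hfZ, ?_⟩, ?_⟩
    · rw [Submodule.coe_smul, norm_smul, Complex.norm_real, norm_inv, norm_norm,
        inv_mul_cancel₀ hf']
    · rw [shiftedQuad_smul, Complex.norm_real, norm_inv, norm_norm]
      field_simp
  have hbdd : BddBelow R := by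
    refine ⟨-‖K‖, ?_⟩
    rintro _ ⟨f, ⟨-, hf⟩, rfl⟩
    simpa [hf] using neg_norm_mul_le_shiftedQuad_zero (S := S) (K := K) f
  obtain ⟨f₀, hf₀Z, hf₀⟩ := hneg
  have hf₀' : shiftedQuad D S K 0 f₀ < 0 := by rw [shiftedQuad_eq_re]; linarith
  have hf₀0 : f₀ ≠ 0 := by
    rintro rfl
    simp [shiftedQuad] at hf₀'
  have hne : R.Nonempty := ⟨_, hnorm f₀ hf₀0 hf₀Z⟩
  set μ := sInf R with hμ
  have hμ0 : μ < 0 := (csInf_le hbdd (hnorm f₀ hf₀0 hf₀Z)).trans_lt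
    (div_neg_of_neg_of_pos hf₀' (by
      have : ‖(f₀ : E)‖ ≠ 0 := by simpa using hf₀0
      positivity))
  have hshift : ∀ f : D, shiftedQuad D S K μ f = shiftedQuad D S K 0 f - μ * ‖(f : E)‖ ^ 2 := by
    intro f; simp [shiftedQuad]
  have hpos : ∀ f : D, (f : E) ∈ Z → 0 ≤ shiftedQuad D S K μ f := by
    intro f hfZ
    by_cases hf : f = 0
    · simp [hf, shiftedQuad]
    · have hf' : 0 < ‖(f : E)‖ := by simpa using hf
      have h1 := csInf_le hbdd (hnorm f hf hfZ)
      rw [le_div_iff₀ (by positivity)] at h1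
      rw [hshift]
      linarith
  -- a minimizing sequence of normalized vectors
  obtain ⟨r, -, hr, hrR⟩ := exists_seq_tendsto_sInf hne hbdd
  choose x hx hxr using hrR
  -- a subsequence along which the images under the compact operator converge
  obtain ⟨y, -, φ, hφ, hy⟩ : ∃ y ∈ closure (K '' Metric.closedBall 0 1), ∃ φ : ℕ → ℕ,
      StrictMono φ ∧ Tendsto (fun n => K (x (φ n))) atTop (𝓝 y) := by
    have hc := hKc.isCompact_closure_image_closedBall (f := (K : E →ₗ[ℂ] E)) 1
    obtain ⟨y, hy, φ, hφ, h⟩ := hc.tendsto_subseq (x := fun n => K (x n))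
      fun n => subset_closure ⟨x n, by simp [(hx n).2], rfl⟩
    exact ⟨y, hy, φ, hφ, h⟩
  set u : ℕ → D := fun n => x (φ n) with hu
  have hu1 : ∀ n, ‖(u n : E)‖ = 1 := fun n => (hx _).2
  have huZ : ∀ n, (u n : E) ∈ Z := fun n => (hx _).1
  have hP : Tendsto (fun n => shiftedQuad D S K μ (u n)) atTop (𝓝 0) := by
    have : Tendsto (fun n => r (φ n) - μ) atTop (𝓝 (μ - μ)) :=
      (hr.comp hφ.tendsto_atTop).sub_const μ
    rw [sub_self] at this
    refine this.congr fun n => ?_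
    rw [hshift, hu1, ← hxr]
    ring
  set B : ℕ × ℕ → ℝ := fun p => 2 * shiftedQuad D S K μ (u p.1) +
    2 * shiftedQuad D S K μ (u p.2) + 2 * dist (K (u p.1)) (K (u p.2)) with hB
  have hBlim : Tendsto B atTop (𝓝 0) := by
    have h1 : Tendsto (fun p : ℕ × ℕ => shiftedQuad D S K μ (u p.1)) atTop (𝓝 0) :=
      hP.comp (by rw [← prod_atTop_atTop_eq]; exact tendsto_fst)
    have h2 : Tendsto (fun p : ℕ × ℕ => shiftedQuad D S K μ (u p.2)) atTop (𝓝 0) :=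
      hP.comp (by rw [← prod_atTop_atTop_eq]; exact tendsto_snd)
    have h3 := cauchySeq_iff_tendsto_dist_atTop_0.1 hy.cauchySeq
    simpa using ((h1.const_mul 2).add (h2.const_mul 2)).add (h3.const_mul 2)
  have hmain : ∀ p : ℕ × ℕ, ‖S (u p.1) - S (u p.2)‖ ^ 2 +
      (-μ) * ‖(u p.1 : E) - (u p.2 : E)‖ ^ 2 ≤ B p := by
    intro p
    have h1 := shiftedQuad_sub_le hK μ (u p.1) (u p.2)
      (hpos _ (Z.add_mem (huZ p.1) (huZ p.2)))
    have h2 : |(inner ℂ ((u p.1 - u p.2 : D) : E) (K (u p.1 - u p.2 : D))).re| ≤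
        2 * dist (K (u p.1)) (K (u p.2)) := by
      calc _ ≤ ‖inner ℂ ((u p.1 - u p.2 : D) : E) (K (u p.1 - u p.2 : D))‖ :=
            Complex.abs_re_le_norm _
        _ ≤ ‖((u p.1 - u p.2 : D) : E)‖ * ‖K (u p.1 - u p.2 : D)‖ := norm_inner_le_norm _ _
        _ ≤ 2 * ‖K (u p.1 - u p.2 : D)‖ := by
            gcongr
            rw [Submodule.coe_sub]
            refine (norm_sub_le _ _).trans ?_
            rw [hu1, hu1]
            norm_num
        _ = _ := by rw [Submodule.coe_sub, map_sub, dist_eq_norm]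
    have h3 := (abs_le.1 h2).1
    rw [shiftedQuad] at h1
    simp only [map_sub, Submodule.coe_sub] at h1 h3
    simp only [hB]
    linarith
  have hBsqrt : Tendsto (fun p => √(B p)) atTop (𝓝 0) := by
    simpa [Function.comp_def] using (Real.continuous_sqrt.tendsto 0).comp hBlim
  have hBsqrt' : Tendsto (fun p => √(B p / (-μ))) atTop (𝓝 0) := by
    simpa [Function.comp_def] using
      (Real.continuous_sqrt.tendsto (0 / (-μ))).comp (hBlim.div_const (-μ))
  -- by `hmain` the sequence is Cauchy in the graph norm
  have hCS : CauchySeq fun n => S (u n) := by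
    rw [cauchySeq_iff_tendsto_dist_atTop_0]
    refine squeeze_zero (fun p => dist_nonneg) (fun p => ?_) hBsqrt
    rw [dist_eq_norm]
    apply Real.le_sqrt_of_sq_le
    nlinarith [hmain p, sq_nonneg ‖(u p.1 : E) - (u p.2 : E)‖]
  have hCu : CauchySeq fun n => (u n : E) := by
    rw [cauchySeq_iff_tendsto_dist_atTop_0]
    refine squeeze_zero (fun p => dist_nonneg) (fun p => ?_) hBsqrt'
    rw [dist_eq_norm]
    apply Real.le_sqrt_of_sq_le
    rw [le_div_iff₀ (by linarith)]
    nlinarith [hmain p, sq_nonneg ‖S (u p.1) - S (u p.2)‖]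
  obtain ⟨a, ha⟩ := cauchySeq_tendsto_of_complete hCu
  obtain ⟨b, hb⟩ := cauchySeq_tendsto_of_complete hCS
  obtain ⟨haD, hab⟩ := hS u a b ha hb
  have haZ : a ∈ Z := hZ.mem_of_tendsto ha (Eventually.of_forall huZ)
  have ha1 : ‖a‖ = 1 := tendsto_nhds_unique ha.norm (by simp [hu1])
  have hPa : shiftedQuad D S K μ ⟨a, haD⟩ = 0 := by
    refine tendsto_nhds_unique ?_ hP
    simp only [shiftedQuad, hab]
    refine ((hb.norm.pow 2).add ?_).sub ((ha.norm.pow 2).const_mul μ)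
    exact (Complex.continuous_re.tendsto _).comp (ha.inner ((K.continuous.tendsto a).comp ha))
  refine ⟨μ, hμ0, ⟨a, haD⟩, haZ, ?_, fun g hg => ?_⟩
  · rintro rfl
    simp at ha1
  · exact sumForm_eq_of_shiftedQuad_eq_zero hK hpos haZ hPa hg

end AbstractIndex

/-! ### Negative eigenvalues and negative subspaces -/

section AbstractCount

variable {E F : Type*} [NormedAddCommGroup E] [InnerProductSpace ℂ E]
  [NormedAddCommGroup F] [InnerProductSpace ℂ F]
  {D : Submodule ℂ E} {S : D →ₗ[ℂ] F} {K : E →L[ℂ] E}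

/-- The solutions of `(S* S + K) f = μ f`. -/
noncomputable def formEigenspace (D : Submodule ℂ E) (S : D →ₗ[ℂ] F) (K : E →L[ℂ] E) (μ : ℝ) :
    Submodule ℂ E :=
  (formGraph D S K).comap (LinearMap.id.prod ((μ : ℂ) • LinearMap.id))

/-- The span of the eigenvectors with negative eigenvalues. -/
noncomputable def negSpan (D : Submodule ℂ E) (S : D →ₗ[ℂ] F) (K : E →L[ℂ] E) : Submodule ℂ E :=
  Submodule.span ℂ {f : E | ∃ μ : ℝ, μ < 0 ∧ (f, (μ : ℂ) • f) ∈ formGraph D S K}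

theorem sumForm_of_mem_formEigenspace {μ : ℝ} {f : D} (hf : (f : E) ∈ formEigenspace D S K μ)
    (g : D) : sumForm D S K g f = μ * inner ℂ (g : E) (f : E) := by
  obtain ⟨f', hf', h⟩ := hf
  have : f' = f := Subtype.ext hf'
  rw [← this, h, this]
  exact inner_smul_right _ _ _

/-- Eigenvectors for different eigenvalues are orthogonal for the form, so the form is
diagonal, with negative entries, on the span of eigenvectors with negative eigenvalues. -/
theorem sumForm_neg_of_mem_negSpan (hK : ∀ x y : E, inner ℂ (K x) y = inner ℂ x (K y))
    {f : E} (hf : f ∈ negSpan D S K) :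
    ∃ h : f ∈ D, f ≠ 0 → (sumForm D S K ⟨f, h⟩ ⟨f, h⟩).re < 0 := by
  have hle : negSpan D S K ≤ ⨆ μ : {μ : ℝ // μ < 0}, formEigenspace D S K μ := by
    refine Submodule.span_le.2 ?_
    rintro v ⟨μ, hμ, hv⟩
    exact Submodule.mem_iSup_of_mem (p := fun μ : {μ : ℝ // μ < 0} => formEigenspace D S K μ)
      ⟨μ, hμ⟩ hv
  obtain ⟨v, hv, rfl⟩ := (Submodule.mem_iSup_iff_exists_finsupp _ _).1 (hle hf)
  have hvD : ∀ μ, v μ ∈ D := fun μ => by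
    obtain ⟨w, hw, -⟩ := hv μ
    have : (w : E) = v μ := hw
    exact this ▸ w.2
  have hsum : v.sum (fun _ x => x) = ((∑ μ ∈ v.support, ⟨v μ, hvD μ⟩ : D) : E) := by
    simp [Finsupp.sum]
  refine ⟨hsum ▸ Submodule.coe_mem _, fun hne => ?_⟩
  have hDeq : (⟨v.sum (fun _ x => x), hsum ▸ Submodule.coe_mem _⟩ : D) =
      ∑ μ ∈ v.support, ⟨v μ, hvD μ⟩ := Subtype.ext hsum
  have hoff : ∀ μ ν : {μ : ℝ // μ < 0}, sumForm D S K ⟨v ν, hvD ν⟩ ⟨v μ, hvD μ⟩ =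
      if ν = μ then ((μ : ℝ) : ℂ) * ((‖v μ‖ ^ 2 : ℝ) : ℂ) else 0 := by
    intro μ ν
    have h1 := sumForm_of_mem_formEigenspace (f := ⟨v μ, hvD μ⟩) (hv μ) ⟨v ν, hvD ν⟩
    split_ifs with h
    · subst h
      rw [h1, inner_self_eq_norm_sq_to_K]
      push_cast
      rfl
    · have h2 := sumForm_of_mem_formEigenspace (f := ⟨v ν, hvD ν⟩) (hv ν) ⟨v μ, hvD μ⟩
      rw [← sumForm_conj hK, h1, map_mul, Complex.conj_ofReal, inner_conj_symm] at h2
      have h3 : (((μ : ℝ) : ℂ) - ((ν : ℝ) : ℂ)) * inner ℂ (v μ) (v ν) = 0 := by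
        rw [sub_mul, sub_eq_zero]; exact h2
      have h4 : ((μ : ℝ) : ℂ) - ((ν : ℝ) : ℂ) ≠ 0 := by
        rw [sub_ne_zero]
        intro h5
        exact h (Subtype.ext (by exact_mod_cast h5.symm))
      have h5 : inner ℂ (v ν) (v μ) = 0 :=
        inner_eq_zero_symm.1 ((mul_eq_zero.1 h3).resolve_left h4)
      rw [h1, h5, mul_zero]
  have hexp : sumForm D S K (∑ μ ∈ v.support, ⟨v μ, hvD μ⟩) (∑ μ ∈ v.support, ⟨v μ, hvD μ⟩) =
      ∑ μ ∈ v.support, ∑ ν ∈ v.support, sumForm D S K ⟨v ν, hvD ν⟩ ⟨v μ, hvD μ⟩ := by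
    simp only [sumForm, map_sum, sum_inner, inner_sum, AddSubmonoidClass.coe_finsetSum,
      Finset.sum_add_distrib]
  rw [hDeq, hexp]
  simp only [hoff, Finset.sum_ite_eq']
  rw [Finset.sum_congr rfl fun μ hμ => if_pos hμ, Complex.re_sum]
  have hne' : v.support.Nonempty := by
    rw [Finset.nonempty_iff_ne_empty]
    rintro h
    apply hne
    simp [Finsupp.sum, h]
  refine Finset.sum_neg (fun μ hμ => ?_) hne'
  rw [← Complex.ofReal_mul, Complex.ofReal_re]
  have : v μ ≠ 0 := Finsupp.mem_support_iff.1 hμ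
  exact mul_neg_of_neg_of_pos μ.2 (by positivity)

/-- Orthogonality to `negSpan` in `E` implies orthogonality to it for the form. -/
theorem sumForm_eq_zero_of_mem_negSpan {a : E} (ha : a ∈ negSpan D S K) :
    ∃ h : a ∈ D, ∀ f : D, (f : E) ∈ (negSpan D S K)ᗮ → sumForm D S K f ⟨a, h⟩ = 0 := by
  induction ha using Submodule.span_induction with
  | mem v hv =>
    obtain ⟨μ, hμ, hv'⟩ := hv
    have hvD : v ∈ D := by
      obtain ⟨w, hw, -⟩ := hv'
      have : (w : E) = v := hw
      exact this ▸ w.2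
    refine ⟨hvD, fun f hf => ?_⟩
    rw [sumForm_of_mem_formEigenspace (μ := μ) (f := ⟨v, hvD⟩) hv' f,
      (Submodule.mem_orthogonal' _ _).1 hf v (Submodule.subset_span ⟨μ, hμ, hv'⟩), mul_zero]
  | zero =>
    refine ⟨D.zero_mem, fun f _ => ?_⟩
    have : (⟨0, D.zero_mem⟩ : D) = 0 := rfl
    simp [this, sumForm]
  | add x y _ _ hx hy =>
    obtain ⟨hx, hx'⟩ := hx
    obtain ⟨hy, hy'⟩ := hy
    refine ⟨D.add_mem hx hy, fun f hf => ?_⟩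
    have := sumForm_add_right D S K f ⟨x, hx⟩ ⟨y, hy⟩
    rw [hx' f hf, hy' f hf, add_zero] at this
    exact this
  | smul c x _ hx =>
    obtain ⟨hx, hx'⟩ := hx
    refine ⟨D.smul_mem c hx, fun f hf => ?_⟩
    have := sumForm_smul_right D S K c f ⟨x, hx⟩
    rw [hx' f hf, mul_zero] at this
    exact this

/-- If there are finitely many negative eigenvalues, the form is nonnegative on the orthogonal
complement of their eigenvectors: otherwise its minimizer there would be one more eigenvector. -/
theorem sumForm_nonneg_of_mem_orthogonal [CompleteSpace E] [CompleteSpace F]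
    (hS : HasClosedGraph D S)
    (hK : ∀ x y : E, inner ℂ (K x) y = inner ℂ x (K y)) (hKc : IsCompactOperator K)
    [FiniteDimensional ℂ (negSpan D S K)] {f : D} (hf : (f : E) ∈ (negSpan D S K)ᗮ) :
    0 ≤ (sumForm D S K f f).re := by
  by_contra hlt
  push Not at hlt
  set N := negSpan D S K with hN
  obtain ⟨μ, hμ, w, hwN, hw0, hw⟩ := exists_minimizer hS hK hKc (N.isClosed_orthogonal)
    ⟨f, hf, hlt⟩
  have hgraph : ((w : E), (μ : ℂ) • (w : E)) ∈ formGraph D S K := by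
    refine ⟨w, rfl, fun g => ?_⟩
    -- split `g` along `N`: both sides vanish on the component in `N`
    have hPN : N.starProjection (g : E) ∈ N := N.starProjection_apply_mem _
    obtain ⟨hPD, hP⟩ := sumForm_eq_zero_of_mem_negSpan hPN
    have hdecomp : g = (g - ⟨_, hPD⟩) + ⟨_, hPD⟩ := by abel
    have hgo : ((g - ⟨_, hPD⟩ : D) : E) ∈ Nᗮ := N.sub_starProjection_mem_orthogonal (g : E)
    have h1 := hw _ hgo
    have h2 : sumForm D S K (⟨_, hPD⟩ : D) w = 0 := by
      rw [← sumForm_conj hK, hP w hwN, map_zero]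
    have h3 : inner ℂ (N.starProjection (g : E)) (w : E) = 0 :=
      (Submodule.mem_orthogonal _ _).1 hwN _ hPN
    have h4 : sumForm D S K g w = sumForm D S K (g - ⟨_, hPD⟩) w +
        sumForm D S K (⟨_, hPD⟩ : D) w := by
      simp only [sumForm, map_sub, Submodule.coe_sub, inner_sub_left]
      ring
    rw [h4, h1, h2, Submodule.coe_sub, inner_sub_left, h3, inner_smul_right]
    simp
  have hwmem : (w : E) ∈ N := Submodule.subset_span ⟨μ, hμ, hgraph⟩
  exact hw0 (inner_self_eq_zero.1 ((Submodule.mem_orthogonal _ _).1 hwN _ hwmem))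

/-- For a compact perturbation of a nonnegative closed form the two ways of counting, by
eigenvectors and by negative subspaces, agree. -/
theorem negEigenvalueCount_formOperator [CompleteSpace E] [CompleteSpace F]
    (hD : Dense (D : Set E)) (hS : HasClosedGraph D S)
    (hK : ∀ x y : E, inner ℂ (K x) y = inner ℂ x (K y)) (hKc : IsCompactOperator K)
    {q : E → E → ℂ} (hq : ∀ f g : D, q f g = sumForm D S K g f) :
    negEigenvalueCount (formOperator D S K) = negIndex D q := by
  have hcount : negEigenvalueCount (formOperator D S K) =
      Cardinal.toENat (Module.rank ℂ (negSpan D S K)) := by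
    rw [negEigenvalueCount, formOperator_graph hD, negSpan]
  rw [hcount]
  apply le_antisymm
  · refine le_iSup (fun L : {L : Submodule ℂ E // L ≤ D ∧ ∀ f ∈ L, f ≠ 0 → (q f f).re < 0} =>
      Cardinal.toENat (Module.rank ℂ L.1)) ⟨negSpan D S K, fun f hf => ?_, fun f hf hf0 => ?_⟩
    · exact (sumForm_neg_of_mem_negSpan hK hf).1
    · obtain ⟨hfD, h⟩ := sumForm_neg_of_mem_negSpan hK hf
      rw [hq ⟨f, hfD⟩ ⟨f, hfD⟩]
      exact h hf0
  · -- a negative subspace meets the orthogonal complement of `negSpan` only at zero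
    refine iSup_le ?_
    rintro ⟨L, hLD, hL⟩
    by_cases hfin : FiniteDimensional ℂ (negSpan D S K)
    · refine OrderHomClass.mono Cardinal.toENat ?_
      refine LinearMap.rank_le_of_injective
        ((negSpan D S K).orthogonalProjectionOnto.toLinearMap ∘ₗ L.subtype) ?_
      rw [← LinearMap.ker_eq_bot, LinearMap.ker_eq_bot']
      intro f hf
      by_contra hf0
      have h1 : (f : E) ∈ (negSpan D S K)ᗮ := by
        rw [← Submodule.ker_orthogonalProjectionOnto]
        exact hf
      have h2 := sumForm_nonneg_of_mem_orthogonal hS hK hKc (f := ⟨f, hLD f.2⟩) h1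
      rw [← hq] at h2
      exact absurd (hL f f.2 (by simpa using hf0)) (not_lt.2 h2)
    · have : Cardinal.toENat (Module.rank ℂ (negSpan D S K)) = ⊤ := by
        rw [Cardinal.toENat_eq_top]
        by_contra h
        exact hfin (Module.rank_lt_aleph0_iff.1 (not_le.1 h))
      rw [this]
      exact le_top

theorem isOperatorOfForm_formOperator (hD : Dense (D : Set E))
    {q : E → E → ℂ} (hq : ∀ f g : D, q f g = sumForm D S K g f) :
    IsOperatorOfForm D q (formOperator D S K) := by
  intro f u
  rw [formOperator_graph hD]
  constructor
  · rintro ⟨f', hf', h⟩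
    have hf : (f' : E) = f := hf'
    subst hf
    exact ⟨f'.2, fun g hg => (hq f' ⟨g, hg⟩).trans (h ⟨g, hg⟩)⟩
  · rintro ⟨hf, h⟩
    exact ⟨⟨f, hf⟩, rfl, fun g => (hq ⟨f, hf⟩ g).symm.trans (h g g.2)⟩

theorem le_negIndex_of_linearMap {E : Type*} [AddCommGroup E] [Module ℂ E]
    {D : Submodule ℂ E} {q : E → E → ℂ} {W : Type*} [AddCommGroup W] [Module ℂ W]
    [Module.Finite ℂ W] (φ : W →ₗ[ℂ] E) (hφ : ∀ w, φ w ∈ D)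
    (hneg : ∀ w, w ≠ 0 → (q (φ w) (φ w)).re < 0) (h0 : (q 0 0).re = 0) :
    (Module.finrank ℂ W : ℕ∞) ≤ negIndex D q := by
  have hinj : Function.Injective φ := by
    rw [← LinearMap.ker_eq_bot, LinearMap.ker_eq_bot']
    intro w hw
    by_contra hw0
    have := hneg w hw0
    rw [hw, h0] at this
    exact lt_irrefl _ this
  have h1 : Cardinal.toENat (Module.rank ℂ (LinearMap.range φ)) = Module.finrank ℂ W := by
    rw [← LinearMap.finrank_range_of_inj hinj, ← Module.finrank_eq_rank, Cardinal.toENat_nat]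
  rw [← h1]
  refine le_iSup (fun L : {L : Submodule ℂ E // L ≤ D ∧ ∀ f ∈ L, f ≠ 0 → (q f f).re < 0} =>
      Cardinal.toENat (Module.rank ℂ L.1)) ⟨LinearMap.range φ, ?_, ?_⟩
  · rintro _ ⟨w, rfl⟩
    exact hφ w
  · rintro _ ⟨w, rfl⟩ hw
    exact hneg w fun h => hw (by rw [h, map_zero])

/-- A form that is nonnegative on the common kernel of `m` functionals has index at most `m`. -/
theorem negIndex_le_of_linearMap {E : Type*} [AddCommGroup E] [Module ℂ E]
    {D : Submodule ℂ E} {q : E → E → ℂ} {m : ℕ} (l : E →ₗ[ℂ] (Fin m → ℂ))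
    (hnonneg : ∀ f ∈ D, l f = 0 → 0 ≤ (q f f).re) : negIndex D q ≤ m := by
  refine iSup_le ?_
  rintro ⟨L, hLD, hL⟩
  have hinj : Function.Injective (l ∘ₗ L.subtype) := by
    rw [← LinearMap.ker_eq_bot, LinearMap.ker_eq_bot']
    intro f hf
    by_contra hf0
    exact absurd (hL f f.2 (by simpa using hf0)) (not_lt.2 (hnonneg f (hLD f.2) hf))
  have hfin : FiniteDimensional ℂ L := Module.Finite.of_injective _ hinj
  have h1 := LinearMap.finrank_le_finrank_of_injective hinj
  rw [Module.finrank_fin_fun] at h1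
  change Cardinal.toENat (Module.rank ℂ L) ≤ m
  rw [← Module.finrank_eq_rank, Cardinal.toENat_nat]
  exact_mod_cast h1

end AbstractCount

/-! ### Compactness of Hankel operators -/

section HankelOperator

/-- An operator `f ↦ (t ↦ κ t f)` whose kernel `κ` is a square-integrable family of bounded
functionals is compact: simple families give operators of finite rank. -/
theorem isCompactOperator_compLp {E : Type*} [NormedAddCommGroup E] [NormedSpace ℂ E]
    {α : Type*} [MeasurableSpace α] (μ : Measure α) (κ : Lp (E →L[ℂ] ℂ) 2 μ) :
    IsCompactOperator
      (((ContinuousLinearMap.apply ℂ ℂ : E →L[ℂ] (E →L[ℂ] ℂ) →L[ℂ] ℂ).compLpL₂ 2 μ).flip κ) := by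
  set Φ := ((ContinuousLinearMap.apply ℂ ℂ : E →L[ℂ] (E →L[ℂ] ℂ) →L[ℂ] ℂ).compLpL₂ 2 μ).flip
    with hΦ
  refine Lp.induction (p := 2) (by norm_num) (motive := fun κ => IsCompactOperator (Φ κ))
    ?_ ?_ ?_ κ
  · intro c s hs hμs
    rw [Lp.simpleFunc.coe_indicatorConst]
    have : (Φ (indicatorConstLp 2 hs hμs.ne c) : E → Lp ℂ 2 μ) =
        (ContinuousLinearMap.smulRight c (indicatorConstLp 2 hs hμs.ne (1 : ℂ))) := by
      funext f
      have h1 : Φ (indicatorConstLp 2 hs hμs.ne c) f =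
          ((ContinuousLinearMap.apply ℂ ℂ) f : (E →L[ℂ] ℂ) →L[ℂ] ℂ).compLp
            (indicatorConstLp 2 hs hμs.ne c) := rfl
      rw [h1, ContinuousLinearMap.smulRight_apply]
      apply Lp.ext
      filter_upwards [ContinuousLinearMap.coeFn_compLp
        ((ContinuousLinearMap.apply ℂ ℂ) f : (E →L[ℂ] ℂ) →L[ℂ] ℂ)
          (indicatorConstLp 2 hs hμs.ne c), Lp.coeFn_smul (c f)
          (indicatorConstLp 2 hs hμs.ne (1 : ℂ)), indicatorConstLp_coeFn (p := 2) (hs := hs)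
          (hμs := hμs.ne) (c := c), indicatorConstLp_coeFn (p := 2) (hs := hs)
          (hμs := hμs.ne) (c := (1 : ℂ))] with x h2 h3 h4 h5
      rw [h2, h3, Pi.smul_apply, h4, h5]
      by_cases hx : x ∈ s <;> simp [indicator, hx]
    rw [this]
    have hc : IsCompactOperator (c : E → ℂ) :=
      isCompactOperator_of_locallyCompactSpace_dom (T := c)
    exact hc.continuous_comp (g := fun z : ℂ => z • indicatorConstLp 2 hs hμs.ne (1 : ℂ))
      (by fun_prop)
  · intro f g hf hg _ h1 h2
    rw [map_add]
    exact h1.add h2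
  · exact isClosed_setOfPred_isCompactOperator.preimage Φ.continuous

variable {v : ℝ → ℝ} {C γ : ℝ}

theorem integrableOn_exp_neg {γ : ℝ} (hγ : 0 < γ) :
    IntegrableOn (fun t : ℝ => Real.exp (-(γ * t))) (Ioi (0 : ℝ)) := by
  have := integrableOn_exp_mul_Ioi (a := -γ) (by linarith) 0
  simpa using this

theorem memLp_exp_neg {γ : ℝ} (hγ : 0 < γ) :
    MemLp (fun t : ℝ => Real.exp (-(γ * t))) 2 (volume.restrict (Ioi (0 : ℝ))) := by
  have hm : AEStronglyMeasurable (fun t : ℝ => Real.exp (-(γ * t)))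
      (volume.restrict (Ioi (0 : ℝ))) := by
    apply Continuous.aestronglyMeasurable
    fun_prop
  rw [memLp_two_iff_integrable_sq hm]
  refine (integrableOn_exp_neg (γ := 2 * γ) (by linarith)).congr
    (Eventually.of_forall fun t => ?_)
  simp only
  rw [← Real.exp_nat_mul]
  congr 1
  push_cast
  ring

theorem memLp_translate (hv : ContinuousOn v (Ioi 0)) (hγ : 0 < γ)
    (hC : ∀ x, 0 < x → |v x| ≤ C * Real.exp (-(γ * x))) {t : ℝ} (ht : 0 ≤ t) :
    MemLp (fun s : ℝ => ((v (t + s) : ℝ) : ℂ)) 2 (volume.restrict (Ioi (0 : ℝ))) := by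
  have hm : AEStronglyMeasurable (fun s : ℝ => ((v (t + s) : ℝ) : ℂ))
      (volume.restrict (Ioi (0 : ℝ))) := by
    refine ContinuousOn.aestronglyMeasurable ?_ measurableSet_Ioi
    refine Complex.continuous_ofReal.comp_continuousOn (hv.comp (by fun_prop) fun s hs => ?_)
    exact add_pos_of_nonneg_of_pos ht hs
  refine ((memLp_exp_neg hγ).const_mul C).mono hm ?_
  filter_upwards [ae_restrict_mem measurableSet_Ioi] with s hs
  have hs' : 0 < s := hs
  rw [Complex.norm_real, Real.norm_eq_abs]
  refine (hC _ (by linarith)).trans ((?_ : _ ≤ _).trans (le_abs_self _))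
  have hC0 : 0 ≤ C := by
    have := (abs_nonneg _).trans (hC 1 one_pos)
    exact nonneg_of_mul_nonneg_left this (Real.exp_pos _)
  gcongr
  linarith

/-- The translates `s ↦ v (|t| + s)` as elements of `L²(ℝ₊)`; the absolute value makes the family
defined for all `t`. -/
noncomputable def translateLp (hv : ContinuousOn v (Ioi 0)) (hγ : 0 < γ)
    (hC : ∀ x, 0 < x → |v x| ≤ C * Real.exp (-(γ * x))) (t : ℝ) : L2Pos :=
  (memLp_translate hv hγ hC (abs_nonneg t)).toLp _

theorem norm_sq_eq_integral (f : L2Pos) :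
    ‖f‖ ^ 2 = ∫ t in Ioi (0 : ℝ), ‖f t‖ ^ 2 := by
  have h1 := L2.inner_def (𝕜 := ℂ) f f
  rw [inner_self_eq_norm_sq_to_K] at h1
  have h2 : ∀ a, inner ℂ (f a) (f a) = ((‖f a‖ ^ 2 : ℝ) : ℂ) := fun a => by
    rw [inner_self_eq_norm_sq_to_K]
    push_cast
    rfl
  simp only [h2] at h1
  rw [integral_complex_ofReal] at h1
  have h3 : ((‖f‖ ^ 2 : ℝ) : ℂ) = ((∫ t in Ioi (0 : ℝ), ‖f t‖ ^ 2 : ℝ) : ℂ) := by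
    rw [← h1]
    push_cast
    rfl
  exact_mod_cast h3

theorem continuous_translateLp (hv : ContinuousOn v (Ioi 0)) (hγ : 0 < γ)
    (hC : ∀ x, 0 < x → |v x| ≤ C * Real.exp (-(γ * x))) :
    Continuous (translateLp hv hγ hC) := by
  have hC0 : 0 ≤ C := by
    have := (abs_nonneg _).trans (hC 1 one_pos)
    exact nonneg_of_mul_nonneg_left this (Real.exp_pos _)
  rw [continuous_iff_continuousAt]
  intro t₀
  rw [ContinuousAt, tendsto_iff_norm_sub_tendsto_zero]
  have hsq : ∀ t, ‖translateLp hv hγ hC t - translateLp hv hγ hC t₀‖ ^ 2 =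
      ∫ s in Ioi (0 : ℝ), (v (|t| + s) - v (|t₀| + s)) ^ 2 := by
    intro t
    rw [norm_sq_eq_integral]
    refine integral_congr_ae ?_
    filter_upwards [Lp.coeFn_sub (translateLp hv hγ hC t) (translateLp hv hγ hC t₀),
      (memLp_translate hv hγ hC (abs_nonneg t)).coeFn_toLp,
      (memLp_translate hv hγ hC (abs_nonneg t₀)).coeFn_toLp] with s h1 h2 h3
    rw [h1, Pi.sub_apply, translateLp, translateLp, h2, h3, ← Complex.ofReal_sub,
      Complex.norm_real, Real.norm_eq_abs, sq_abs]
  have hlim : Tendsto (fun t => ∫ s in Ioi (0 : ℝ), (v (|t| + s) - v (|t₀| + s)) ^ 2) (𝓝 t₀)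
      (𝓝 (∫ s in Ioi (0 : ℝ), (0 : ℝ))) := by
    refine tendsto_integral_filter_of_dominated_convergence
      (fun s => (2 * C) ^ 2 * Real.exp (-(2 * γ * s))) (Eventually.of_forall fun t => ?_)
      (Eventually.of_forall fun t => ?_)
      ((integrableOn_exp_neg (γ := 2 * γ) (by linarith)).const_mul _) ?_
    · refine ContinuousOn.aestronglyMeasurable ?_ measurableSet_Ioi
      refine ((hv.comp (by fun_prop) fun s hs => ?_).sub
        (hv.comp (by fun_prop) fun s hs => ?_)).pow 2 <;>
      exact add_pos_of_nonneg_of_pos (abs_nonneg _) (mem_Ioi.1 hs)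
    · filter_upwards [ae_restrict_mem measurableSet_Ioi] with s hs
      have hs' : 0 < s := hs
      have hb : ∀ r, |v (|r| + s)| ≤ C * Real.exp (-(γ * s)) := fun r => by
        refine (hC _ (by positivity)).trans ?_
        gcongr
        have := abs_nonneg r
        linarith
      have h1 : |v (|t| + s) - v (|t₀| + s)| ≤ 2 * C * Real.exp (-(γ * s)) := by
        refine (abs_sub _ _).trans ?_
        linarith [hb t, hb t₀]
      rw [Real.norm_eq_abs, abs_pow]
      calc |v (|t| + s) - v (|t₀| + s)| ^ 2 ≤ (2 * C * Real.exp (-(γ * s))) ^ 2 := by gcongr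
        _ = _ := by
          rw [mul_pow, ← Real.exp_nat_mul]
          congr 2
          push_cast
          ring
    · filter_upwards [ae_restrict_mem measurableSet_Ioi] with s hs
      have h1 : ContinuousAt (fun t : ℝ => v (|t| + s)) t₀ := by
        have h2 : ContinuousAt v (|t₀| + s) :=
          hv.continuousAt (Ioi_mem_nhds (add_pos_of_nonneg_of_pos (abs_nonneg _) hs))
        exact ContinuousAt.comp (f := fun t : ℝ => |t| + s) h2 (by fun_prop)
      have h3 : Tendsto (fun t => (v (|t| + s) - v (|t₀| + s)) ^ 2) (𝓝 t₀)
          (𝓝 ((v (|t₀| + s) - v (|t₀| + s)) ^ 2)) := (h1.tendsto.sub_const _).pow 2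
      simpa using h3
  rw [integral_zero] at hlim
  have h4 := (Real.continuous_sqrt.tendsto 0).comp hlim
  rw [Real.sqrt_zero] at h4
  refine h4.congr fun t => ?_
  rw [Function.comp_apply, ← hsq, Real.sqrt_sq (norm_nonneg _)]

theorem norm_translateLp_le (hv : ContinuousOn v (Ioi 0)) (hγ : 0 < γ)
    (hC : ∀ x, 0 < x → |v x| ≤ C * Real.exp (-(γ * x))) :
    ∃ B : ℝ, ∀ t, 0 ≤ t → ‖translateLp hv hγ hC t‖ ≤ B * Real.exp (-(γ * t)) := by
  have hC0 : 0 ≤ C := by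
    have := (abs_nonneg _).trans (hC 1 one_pos)
    exact nonneg_of_mul_nonneg_left this (Real.exp_pos _)
  refine ⟨√(∫ s in Ioi (0 : ℝ), (C * Real.exp (-(γ * s))) ^ 2), fun t ht => ?_⟩
  rw [← Real.sqrt_sq (Real.exp_pos (-(γ * t))).le, ← Real.sqrt_mul (integral_nonneg fun s => by
    positivity)]
  apply Real.le_sqrt_of_sq_le
  rw [norm_sq_eq_integral, ← integral_mul_const]
  refine integral_mono_of_nonneg (Eventually.of_forall fun s => by positivity) ?_ ?_
  · have := (integrableOn_exp_neg (γ := 2 * γ) (by linarith)).const_mul (C ^ 2)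
    refine (this.congr (Eventually.of_forall fun s => ?_)).mul_const _
    simp only
    rw [mul_pow, ← Real.exp_nat_mul]
    congr 2
    push_cast
    ring
  · filter_upwards [ae_restrict_mem measurableSet_Ioi,
      (memLp_translate hv hγ hC (abs_nonneg t)).coeFn_toLp] with s hs h1
    have hs' : 0 < s := hs
    rw [translateLp, h1, Complex.norm_real, Real.norm_eq_abs, ← mul_pow, abs_of_nonneg ht]
    gcongr
    refine (hC _ (by linarith)).trans (le_of_eq ?_)
    rw [mul_assoc, ← Real.exp_add]
    ring_nf

theorem integrable_exp_neg_mul (f : L2Pos) {γ : ℝ} (hγ : 0 < γ) :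
    Integrable (fun t : ℝ => ((Real.exp (-(γ * t)) : ℝ) : ℂ) * f t)
      (volume.restrict (Ioi (0 : ℝ))) := by
  have := laplace_integrable f hγ
  simpa only [mul_comm γ] using this

theorem integrable_hankel_prod (hv : ContinuousOn v (Ioi 0)) (hγ : 0 < γ)
    (hC : ∀ x, 0 < x → |v x| ≤ C * Real.exp (-(γ * x))) (f g : L2Pos) :
    Integrable (fun p : ℝ × ℝ => (v (p.1 + p.2) : ℂ) * f p.2 * (starRingEnd ℂ) (g p.1))
      ((volume.restrict (Ioi (0 : ℝ))).prod (volume.restrict (Ioi (0 : ℝ)))) := by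
  have h1 := (integrable_exp_neg_mul g hγ).mul_prod (integrable_exp_neg_mul f hγ)
  have hpos : ∀ᵐ p ∂((volume.restrict (Ioi (0 : ℝ))).prod (volume.restrict (Ioi (0 : ℝ)))),
      p ∈ Ioi (0 : ℝ) ×ˢ Ioi (0 : ℝ) := by
    rw [Measure.prod_restrict]
    exact ae_restrict_mem (measurableSet_Ioi.prod measurableSet_Ioi)
  refine (h1.const_mul (C : ℂ)).mono ?_ ?_
  · have hm1 : AEStronglyMeasurable (fun p : ℝ × ℝ => (v (p.1 + p.2) : ℂ))
        ((volume.restrict (Ioi (0 : ℝ))).prod (volume.restrict (Ioi (0 : ℝ)))) := by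
      rw [Measure.prod_restrict]
      refine ContinuousOn.aestronglyMeasurable ?_ (measurableSet_Ioi.prod measurableSet_Ioi)
      refine Complex.continuous_ofReal.comp_continuousOn (hv.comp (by fun_prop) fun p hp => ?_)
      exact add_pos (mem_Ioi.1 hp.1) (mem_Ioi.1 hp.2)
    have hm2 := (Lp.aestronglyMeasurable f).comp_snd (μ := volume.restrict (Ioi (0 : ℝ)))
    have hm3 := (Lp.aestronglyMeasurable g).comp_fst (ν := volume.restrict (Ioi (0 : ℝ)))
    exact (hm1.mul hm2).mul (Complex.continuous_conj.comp_aestronglyMeasurable hm3)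
  · filter_upwards [hpos] with p hp
    have hp1 : 0 < p.1 := hp.1
    have hp2 : 0 < p.2 := hp.2
    have hb := hC (p.1 + p.2) (by linarith)
    rw [norm_mul, norm_mul, RCLike.norm_conj, Complex.norm_real, Real.norm_eq_abs]
    calc |v (p.1 + p.2)| * ‖f p.2‖ * ‖g p.1‖
        ≤ (C * Real.exp (-(γ * (p.1 + p.2)))) * ‖f p.2‖ * ‖g p.1‖ := by gcongr
      _ = C * (Real.exp (-(γ * p.1)) * ‖g p.1‖ * (Real.exp (-(γ * p.2)) * ‖f p.2‖)) := by
          rw [mul_add, neg_add, Real.exp_add]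
          ring
      _ ≤ |C| * (Real.exp (-(γ * p.1)) * ‖g p.1‖ * (Real.exp (-(γ * p.2)) * ‖f p.2‖)) := by
          gcongr
          exact le_abs_self C
      _ = _ := by
          simp only [norm_mul, Complex.norm_real, Real.norm_eq_abs, Real.abs_exp]

/-- A Hankel operator with a continuous, exponentially decaying kernel is a compact self-adjoint
operator on `L²(ℝ₊)`. -/
theorem exists_hankel_operator (hv : ContinuousOn v (Ioi 0)) (hγ : 0 < γ)
    (hC : ∀ x, 0 < x → |v x| ≤ C * Real.exp (-(γ * x))) :
    ∃ K : L2Pos →L[ℂ] L2Pos, IsCompactOperator K ∧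
      (∀ f g : L2Pos, inner ℂ (K f) g = inner ℂ f (K g)) ∧
      ∀ f g : L2Pos, ∫ t in Ioi (0 : ℝ), hankel v f t * (starRingEnd ℂ) (g t) =
        inner ℂ g (K f) := by
  obtain ⟨B, hB⟩ := norm_translateLp_le hv hγ hC
  have hκm : MemLp (fun t => innerSL ℂ (translateLp hv hγ hC t)) 2
      (volume.restrict (Ioi (0 : ℝ))) := by
    refine ((memLp_exp_neg hγ).const_mul B).mono ?_ ?_
    · exact ((innerSL ℂ).continuous.comp (continuous_translateLp hv hγ hC)).aestronglyMeasurable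
    · filter_upwards [ae_restrict_mem measurableSet_Ioi] with t ht
      rw [innerSL_apply_norm]
      exact (hB t (le_of_lt ht)).trans (le_abs_self _)
  set K : L2Pos →L[ℂ] L2Pos := ((ContinuousLinearMap.apply ℂ ℂ :
    L2Pos →L[ℂ] (L2Pos →L[ℂ] ℂ) →L[ℂ] ℂ).compLpL₂ 2 (volume.restrict (Ioi (0 : ℝ)))).flip
      (hκm.toLp _) with hK
  have hKf : ∀ f : L2Pos, K f =ᵐ[volume.restrict (Ioi (0 : ℝ))] hankel v f := by
    intro f
    have h1 : K f = ((ContinuousLinearMap.apply ℂ ℂ) f : (L2Pos →L[ℂ] ℂ) →L[ℂ] ℂ).compLp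
      (hκm.toLp _) := rfl
    rw [h1]
    filter_upwards [ContinuousLinearMap.coeFn_compLp
      ((ContinuousLinearMap.apply ℂ ℂ) f : (L2Pos →L[ℂ] ℂ) →L[ℂ] ℂ) (hκm.toLp _),
      hκm.coeFn_toLp, ae_restrict_mem measurableSet_Ioi] with t h2 h3 ht
    rw [h2, h3, ContinuousLinearMap.apply_apply, innerSL_apply_apply, L2.inner_def, hankel]
    refine integral_congr_ae ?_
    filter_upwards [(memLp_translate hv hγ hC (abs_nonneg t)).coeFn_toLp] with s h4
    rw [translateLp, h4, RCLike.inner_apply, Complex.conj_ofReal, abs_of_pos ht, mul_comm]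
  have hform : ∀ f g : L2Pos, ∫ t in Ioi (0 : ℝ), hankel v f t * (starRingEnd ℂ) (g t) =
        inner ℂ g (K f) := by
    intro f g
    rw [L2.inner_def]
    refine integral_congr_ae ?_
    filter_upwards [hKf f] with t ht
    rw [ht, RCLike.inner_apply]
  refine ⟨K, isCompactOperator_compLp _ _, fun f g => ?_, hform⟩
  have hdouble : ∀ f g : L2Pos, inner ℂ g (K f) = ∫ t in Ioi (0 : ℝ), ∫ s in Ioi (0 : ℝ),
      (v (t + s) : ℂ) * f s * (starRingEnd ℂ) (g t) := by
    intro f g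
    rw [← hform]
    simp only [hankel, integral_mul_const]
  rw [← inner_conj_symm, hdouble f g, hdouble g f, ← integral_conj]
  simp only [← integral_conj, map_mul, Complex.conj_conj, Complex.conj_ofReal]
  rw [integral_integral_swap]
  · refine integral_congr_ae (Eventually.of_forall fun s => ?_)
    refine integral_congr_ae (Eventually.of_forall fun t => ?_)
    simp only
    rw [add_comm]
    ring
  · have h := integrable_hankel_prod hv hγ hC g f
    refine h.swap.congr (Eventually.of_forall fun p => ?_)
    simp only [Function.comp_apply, Function.uncurry, Prod.fst_swap, Prod.snd_swap]
    rw [add_comm]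
    ring

end HankelOperator

/-! ### The Laplace transform and the form domain -/

section LaplaceTransform

theorem memLp_exp_neg_complex {x : ℝ} (hx : 0 < x) :
    MemLp (fun t : ℝ => ((Real.exp (-(t * x)) : ℝ) : ℂ)) 2 (volume.restrict (Ioi (0 : ℝ))) := by
  have := (memLp_exp_neg hx).ofReal (K := ℂ)
  simp only [mul_comm x] at this
  exact this

/-- The value of the Laplace transform at `x > 0`, as a bounded functional on `L²(ℝ₊)`. -/
theorem laplace_eq_inner {x : ℝ} (hx : 0 < x) (f : L2Pos) :
    laplace f x = inner ℂ ((memLp_exp_neg_complex hx).toLp _ : L2Pos) f := by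
  rw [L2.inner_def, laplace]
  refine integral_congr_ae ?_
  filter_upwards [(memLp_exp_neg_complex hx).coeFn_toLp] with t ht
  rw [ht, RCLike.inner_apply, Complex.conj_ofReal, mul_comm]

theorem laplace_add {x : ℝ} (hx : 0 < x) (f g : L2Pos) :
    laplace (f + g : L2Pos) x = laplace f x + laplace g x := by
  simp only [laplace_eq_inner hx, inner_add_right]

theorem laplace_smul {x : ℝ} (hx : 0 < x) (c : ℂ) (f : L2Pos) :
    laplace (c • f : L2Pos) x = c * laplace f x := by
  simp only [laplace_eq_inner hx, inner_smul_right]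

theorem laplace_tendsto {x : ℝ} (hx : 0 < x) {u : ℕ → L2Pos} {f : L2Pos}
    (h : Tendsto u atTop (𝓝 f)) : Tendsto (fun n => laplace (u n) x) atTop (𝓝 (laplace f x)) := by
  simp only [laplace_eq_inner hx]
  exact Tendsto.inner tendsto_const_nhds h

theorem mem_formDomain {σ₀ : ℝ → ℝ} {f : L2Pos} :
    f ∈ formDomain σ₀ ↔ MemLp (laplace f) 2 (sigmaMeasure σ₀) := Iff.rfl

/-- The Laplace transform as an operator from `formDomain σ₀` to `L²(σ₀ dx)`. -/
noncomputable def laplaceLp (σ₀ : ℝ → ℝ) : formDomain σ₀ →ₗ[ℂ] Lp ℂ 2 (sigmaMeasure σ₀) where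
  toFun f := (mem_formDomain.1 f.2).toLp _
  map_add' f g := by
    rw [← MemLp.toLp_add]
    refine MemLp.toLp_congr _ _ ?_
    filter_upwards [sigmaMeasure_pos σ₀] with x hx
    exact laplace_add hx _ _
  map_smul' c f := by
    rw [RingHom.id_apply, ← MemLp.toLp_const_smul]
    refine MemLp.toLp_congr _ _ ?_
    filter_upwards [sigmaMeasure_pos σ₀] with x hx
    exact laplace_smul hx _ _

theorem coeFn_laplaceLp (σ₀ : ℝ → ℝ) (f : formDomain σ₀) :
    laplaceLp σ₀ f =ᵐ[sigmaMeasure σ₀] laplace (f : L2Pos) :=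
  MemLp.coeFn_toLp (mem_formDomain.1 f.2)

theorem inner_laplaceLp (σ₀ : ℝ → ℝ) (f g : formDomain σ₀) :
    inner ℂ (laplaceLp σ₀ g) (laplaceLp σ₀ f) = freeForm σ₀ f g := by
  rw [L2.inner_def, freeForm]
  refine integral_congr_ae ?_
  filter_upwards [coeFn_laplaceLp σ₀ f, coeFn_laplaceLp σ₀ g] with x h1 h2
  rw [h1, h2, RCLike.inner_apply]

theorem hasClosedGraph_laplaceLp (σ₀ : ℝ → ℝ) :
    HasClosedGraph (formDomain σ₀) (laplaceLp σ₀) := by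
  intro u a b ha hb
  obtain ⟨ns, hns, h1⟩ := (tendstoInMeasure_of_tendsto_Lp hb).exists_seq_tendsto_ae
  have h2 : ∀ᵐ x ∂(sigmaMeasure σ₀), ∀ n,
      laplaceLp σ₀ (u (ns n)) x = laplace (u (ns n) : L2Pos) x :=
    ae_all_iff.2 fun n => coeFn_laplaceLp σ₀ _
  have h3 : b =ᵐ[sigmaMeasure σ₀] laplace a := by
    filter_upwards [h1, h2, sigmaMeasure_pos σ₀] with x hx1 hx2 hx
    refine tendsto_nhds_unique hx1 ?_
    simp only [hx2]
    exact laplace_tendsto hx (ha.comp hns.tendsto_atTop)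
  have hmem : MemLp (laplace a) 2 (sigmaMeasure σ₀) := (memLp_congr_ae h3).1 (Lp.memLp b)
  refine ⟨hmem, Lp.ext ?_⟩
  exact (coeFn_laplaceLp σ₀ ⟨a, hmem⟩).trans h3.symm

/-- The conditions on `σ₀` combined into one bound: an integrable singularity at zero and
polynomial growth at infinity. -/
theorem IsFreeSigma.exists_bound {σ₀ : ℝ → ℝ} (h : IsFreeSigma σ₀) :
    ∃ (C p : ℝ) (L : ℕ), 0 ≤ C ∧ 0 ≤ p ∧ p < 1 ∧
      ∀ᵐ x ∂(volume.restrict (Ioi (0 : ℝ))), σ₀ x ≤ C * x ^ (-p) * (1 + x) ^ L := by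
  obtain ⟨p₀, hp₀, h0⟩ := h.atZero
  obtain ⟨l, hl⟩ := h.atInfty
  obtain ⟨C₀, hC₀, h0'⟩ := h0.exists_pos
  obtain ⟨C₁, hC₁, hl'⟩ := hl.exists_pos
  rw [IsBigOWith, eventually_inf] at h0' hl'
  obtain ⟨s, hs, t, ht, h0'⟩ := h0'
  obtain ⟨s', hs', t', ht', hl'⟩ := hl'
  obtain ⟨ε, hε, hεs⟩ := mem_nhdsGT_iff_exists_Ioo_subset.1 hs
  obtain ⟨X₀, hX₀⟩ := mem_atTop_sets.1 hs'
  set X := max X₀ 1 with hXdef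
  have hε' : 0 < ε := hε
  obtain ⟨C₂, hC₂⟩ : ∃ C₂ : ℝ, ∀ᵐ x ∂(volume.restrict (Icc ε X)), |σ₀ x| ≤ C₂ := by
    have hm := h.locBounded ε X hε'
    refine ⟨(eLpNormEssSup σ₀ (volume.restrict (Icc ε X))).toReal, ?_⟩
    have hfin : eLpNormEssSup σ₀ (volume.restrict (Icc ε X)) ≠ ⊤ := by
      rw [← eLpNorm_exponent_top]
      exact hm.2.ne
    filter_upwards [enorm_ae_le_eLpNormEssSup σ₀ (volume.restrict (Icc ε X))] with x hx
    have := (ENNReal.toReal_le_toReal (by simp) hfin).2 hx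
    simpa using this
  set p := max p₀ 0 with hp
  have hp0 : 0 ≤ p := le_max_right _ _
  obtain ⟨L, hL⟩ := exists_nat_ge (max (l + p) (max (p - p₀) p))
  have hLl : l + p ≤ L := (le_max_left _ _).trans hL
  have hLp : p - p₀ ≤ L := ((le_max_left _ _).trans (le_max_right _ _)).trans hL
  have hLp' : p ≤ L := ((le_max_right _ _).trans (le_max_right _ _)).trans hL
  refine ⟨C₀ + C₁ + |C₂|, p, L, by positivity, hp0, max_lt hp₀ one_pos, ?_⟩
  rw [ae_restrict_iff' measurableSet_Icc] at hC₂
  rw [ae_restrict_iff' measurableSet_Ioi]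
  filter_upwards [hC₂, ht, ht'] with x h1 h2 h3 hx
  have hx0 : 0 < x := hx
  have hxp : 0 < x ^ (-p) := Real.rpow_pos_of_pos hx0 _
  -- each of the three bounds is dominated by `x ^ (-p) * (1 + x) ^ L`
  have hbase : ∀ r : ℝ, 0 ≤ r → r ≤ L → x ^ (r - p) ≤ x ^ (-p) * (1 + x) ^ L := by
    intro r hr hrL
    rw [sub_eq_neg_add, Real.rpow_add hx0]
    gcongr
    calc x ^ r ≤ (1 + x) ^ r := Real.rpow_le_rpow hx0.le (by linarith) hr
      _ ≤ (1 + x) ^ (L : ℝ) := Real.rpow_le_rpow_of_exponent_le (by linarith) hrL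
      _ = (1 + x) ^ L := Real.rpow_natCast _ _
  have hW0 : 0 ≤ x ^ (-p) * (1 + x) ^ L := by positivity
  suffices hsuff : |σ₀ x| ≤ (C₀ + C₁ + |C₂|) * (x ^ (-p) * (1 + x) ^ L) by
    rw [mul_assoc]
    exact (le_abs_self _).trans hsuff
  rcases lt_or_ge x ε with hxε | hxε
  · have h4 : ‖σ₀ x‖ ≤ C₀ * ‖x ^ (-p₀)‖ := h0' x ⟨hεs ⟨hx0, hxε⟩, h2⟩
    have h5 := hbase (p - p₀) (sub_nonneg.2 (le_max_left _ _)) hLp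
    rw [sub_sub_cancel_left] at h5
    rw [Real.norm_eq_abs, Real.norm_of_nonneg (Real.rpow_nonneg hx0.le _)] at h4
    refine h4.trans ?_
    gcongr
    linarith [abs_nonneg C₂]
  · rcases le_or_gt x X with hxX | hxX
    · have hone := hbase p hp0 hLp'
      rw [sub_self, Real.rpow_zero] at hone
      calc |σ₀ x| ≤ |C₂| * 1 := by rw [mul_one]; exact (h1 ⟨hxε, hxX⟩).trans (le_abs_self _)
        _ ≤ (C₀ + C₁ + |C₂|) * (x ^ (-p) * (1 + x) ^ L) := by
          gcongr
          linarith
    · have hx1 : 1 ≤ x := (le_max_right _ _).trans hxX.le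
      have h4 : ‖σ₀ x‖ ≤ C₁ * ‖x ^ l‖ := hl' x ⟨hX₀ x ((le_max_left _ _).trans hxX.le), h3⟩
      have h5 := hbase (max (l + p) 0) (le_max_right _ _) (max_le hLl (Nat.cast_nonneg _))
      have h6 : x ^ l ≤ x ^ (max (l + p) 0 - p) :=
        Real.rpow_le_rpow_of_exponent_le hx1 (by linarith [le_max_left (l + p) 0])
      rw [Real.norm_eq_abs, Real.norm_of_nonneg (Real.rpow_nonneg hx0.le _)] at h4
      calc |σ₀ x| ≤ C₁ * (x ^ (-p) * (1 + x) ^ L) := by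
            refine h4.trans ?_
            gcongr
            exact h6.trans h5
        _ ≤ _ := by
            gcongr
            linarith [abs_nonneg C₂]

theorem integrableOn_Ioi_of_rpow_bounds {f : ℝ → ℝ} {a b A B : ℝ}
    (hf : AEStronglyMeasurable f (volume.restrict (Ioi (0 : ℝ)))) (ha : -1 < a) (hb : b < -1)
    (h0 : ∀ x, 0 < x → x ≤ 1 → |f x| ≤ A * x ^ a) (h1 : ∀ x, 1 < x → |f x| ≤ B * x ^ b) :
    IntegrableOn f (Ioi 0) := by
  rw [← Ioc_union_Ioi_eq_Ioi zero_le_one]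
  refine IntegrableOn.union ?_ ?_
  · have h2 : IntegrableOn (fun x : ℝ => A * x ^ a) (Ioc 0 1) := by
      have := intervalIntegral.intervalIntegrable_rpow' (a := 0) (b := 1) ha
      rw [intervalIntegrable_iff_integrableOn_Ioc_of_le zero_le_one] at this
      exact this.const_mul A
    refine Integrable.mono' h2 (hf.mono_set Ioc_subset_Ioi_self) ?_
    filter_upwards [ae_restrict_mem measurableSet_Ioc] with x hx
    exact h0 x hx.1 hx.2
  · have h2 : IntegrableOn (fun x : ℝ => B * x ^ b) (Ioi 1) :=
      (integrableOn_Ioi_rpow_of_lt hb one_pos).const_mul B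
    refine Integrable.mono' h2 (hf.mono_set (Ioi_subset_Ioi zero_le_one)) ?_
    filter_upwards [ae_restrict_mem measurableSet_Ioi] with x hx
    exact h1 x hx

theorem IsFreeSigma.exists_integrable {σ₀ : ℝ → ℝ} (h : IsFreeSigma σ₀) :
    ∃ L : ℕ, Integrable (fun x : ℝ => ((1 + x) ^ L)⁻¹) (sigmaMeasure σ₀) := by
  obtain ⟨C, p, L, hC, hp0, hp1, hb⟩ := h.exists_bound
  refine ⟨L + 2, ?_⟩
  have hle : sigmaMeasure σ₀ ≤ (volume.restrict (Ioi (0 : ℝ))).withDensity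
      fun x => ENNReal.ofReal (C * x ^ (-p) * (1 + x) ^ L) :=
    withDensity_mono (hb.mono fun x hx => ENNReal.ofReal_le_ofReal hx)
  refine Integrable.mono_measure ?_ hle
  rw [integrable_withDensity_iff (by fun_prop) (Eventually.of_forall fun x => by simp)]
  have hg : IntegrableOn (fun x : ℝ => C * x ^ (-p) * ((1 + x) ^ 2)⁻¹) (Ioi 0) := by
    refine integrableOn_Ioi_of_rpow_bounds (a := -p) (b := -2) (A := C) (B := C)
      (by fun_prop) (by linarith) (by norm_num) (fun x hx _ => ?_) (fun x hx => ?_)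
    · rw [abs_of_nonneg (by positivity)]
      refine mul_le_of_le_one_right (by positivity) (inv_le_one_of_one_le₀ ?_)
      nlinarith
    · have hx0 : 0 < x := by linarith
      rw [abs_of_nonneg (by positivity), mul_assoc]
      gcongr
      have h1 : x ^ (-p) ≤ 1 := Real.rpow_le_one_of_one_le_of_nonpos hx.le (by linarith)
      have h2 : ((1 + x) ^ 2)⁻¹ ≤ x ^ (-2 : ℝ) := by
        rw [Real.rpow_neg hx0.le, Real.rpow_ofNat]
        gcongr
        linarith
      calc x ^ (-p) * ((1 + x) ^ 2)⁻¹ ≤ 1 * x ^ (-2 : ℝ) := by gcongr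
        _ = _ := one_mul _
  refine hg.congr ?_
  filter_upwards [ae_restrict_mem measurableSet_Ioi] with x hx
  have hx0 : 0 < x := hx
  rw [ENNReal.toReal_ofReal (by positivity), pow_add]
  field_simp

theorem stronglyMeasurable_laplace (f : L2Pos) : StronglyMeasurable (laplace f) := by
  have h : StronglyMeasurable (Function.uncurry fun x t : ℝ =>
      ((Real.exp (-(t * x)) : ℝ) : ℂ) * f t) := by
    refine StronglyMeasurable.mul ?_ ((Lp.stronglyMeasurable f).comp_measurable measurable_snd)
    apply Continuous.stronglyMeasurable
    fun_prop
  exact h.integral_prod_right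

theorem mem_formDomain_of_integrable {σ₀ : ℝ → ℝ} {f : L2Pos} {G : ℝ → ℝ}
    (hG : Integrable G (sigmaMeasure σ₀)) (hf : ∀ x, 0 < x → ‖laplace f x‖ ^ 2 ≤ G x) :
    f ∈ formDomain σ₀ := by
  rw [mem_formDomain, memLp_two_iff_integrable_sq_norm
    (stronglyMeasurable_laplace f).aestronglyMeasurable]
  refine hG.mono' (((stronglyMeasurable_laplace f).norm.pow 2).aestronglyMeasurable) ?_
  filter_upwards [sigmaMeasure_pos σ₀] with x hx
  rw [Real.norm_of_nonneg (by positivity)]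
  exact hf x hx

theorem exists_add_pow_le_exp {a γ : ℝ} (ha : 0 < a) (hγ : 0 < γ) (N : ℕ) :
    ∃ C : ℝ, 0 ≤ C ∧ ∀ t, 0 ≤ t → (a + t) ^ N ≤ C * Real.exp (γ * t) := by
  refine ⟨Real.exp (γ * a) * N.factorial / γ ^ N, by positivity, fun t ht => ?_⟩
  have h := Real.pow_div_factorial_le_exp (γ * (a + t)) (by positivity) N
  rw [div_le_iff₀ (by positivity), mul_pow, mul_add γ, Real.exp_add] at h
  rw [div_mul_eq_mul_div, le_div_iff₀ (by positivity)]
  linarith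

/-- Functions supported in a compact subset of `(0, ∞)` have exponentially decaying Laplace
transforms, so they lie in the form domain and make it dense. -/
theorem dense_formDomain {σ₀ : ℝ → ℝ} (h : IsFreeSigma σ₀) :
    Dense (formDomain σ₀ : Set L2Pos) := by
  rw [Submodule.dense_iff_topologicalClosure_eq_top, Submodule.topologicalClosure_eq_top_iff,
    Submodule.eq_bot_iff]
  intro u hu
  obtain ⟨L, hL⟩ := h.exists_integrable
  set I : ℕ → Set ℝ := fun n => Icc (1 / ((n : ℝ) + 1)) n with hI
  -- `u` vanishes on each `I n`, being orthogonal to its own restriction to `I n`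
  have hzero : ∀ n, ∀ᵐ t ∂(volume.restrict (Ioi (0 : ℝ))), t ∈ I n → u t = 0 := by
    intro n
    have hIm : MeasurableSet (I n) := measurableSet_Icc
    have hfm := (Lp.memLp u).indicator hIm
    set δ : ℝ := 1 / ((n : ℝ) + 1) with hδ
    have hδ0 : 0 < δ := by positivity
    set f : L2Pos := hfm.toLp _ with hf
    have hmem : f ∈ formDomain σ₀ := by
      obtain ⟨B, hB⟩ : ∃ B : ℝ, ∀ x : ℝ, 0 < x →
          Real.exp (-(δ * x)) ^ 2 ≤ B * ((1 + x) ^ L)⁻¹ := by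
        obtain ⟨B, -, hB⟩ := exists_add_pow_le_exp one_pos (show 0 < 2 * δ by positivity) L
        refine ⟨B, fun x hx => ?_⟩
        have h1 : Real.exp (-(δ * x)) ^ 2 * Real.exp (2 * δ * x) = 1 := by
          rw [← Real.exp_nat_mul, ← Real.exp_add, Real.exp_eq_one_iff]
          push_cast
          ring
        rw [← div_eq_mul_inv, le_div_iff₀ (by positivity)]
        calc Real.exp (-(δ * x)) ^ 2 * (1 + x) ^ L
            ≤ Real.exp (-(δ * x)) ^ 2 * (B * Real.exp (2 * δ * x)) := by
              gcongr
              exact hB x hx.le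
          _ = B := by rw [mul_left_comm, h1, mul_one]
      set A : ℝ := ∫ t in Ioi (0 : ℝ), ‖(I n).indicator u t‖ with hA
      have hint : Integrable (fun t => ‖(I n).indicator u t‖) (volume.restrict (Ioi (0 : ℝ))) := by
        refine Integrable.norm ?_
        rw [integrable_indicator_iff hIm]
        have : IsFiniteMeasure ((volume.restrict (Ioi (0 : ℝ))).restrict (I n)) :=
          isFiniteMeasure_restrict.2
            ((Measure.restrict_apply_le _ _).trans_lt measure_Icc_lt_top).ne
        exact MemLp.integrable (q := 2) (by norm_num) ((Lp.memLp u).restrict _)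
      refine mem_formDomain_of_integrable (hL.const_mul (A ^ 2 * B)) fun x hx => ?_
      have hnorm : ‖laplace f x‖ ≤ A * Real.exp (-(δ * x)) := by
        rw [laplace_congr hfm.coeFn_toLp, hA, ← integral_mul_const]
        refine norm_integral_le_of_norm_le (hint.mul_const _) (Eventually.of_forall fun t => ?_)
        rw [norm_mul, Complex.norm_real, Real.norm_eq_abs, Real.abs_exp, mul_comm]
        by_cases ht : t ∈ I n
        · gcongr
          exact ht.1
        · simp [indicator_of_notMem ht]
      calc ‖laplace f x‖ ^ 2 ≤ (A * Real.exp (-(δ * x))) ^ 2 := by gcongr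
        _ = A ^ 2 * Real.exp (-(δ * x)) ^ 2 := by ring
        _ ≤ A ^ 2 * (B * ((1 + x) ^ L)⁻¹) := by gcongr; exact hB x hx
        _ = _ := by ring
    have h1 := (Submodule.mem_orthogonal _ _).1 hu f hmem
    rw [L2.inner_def] at h1
    have h2 : ∫ t in Ioi (0 : ℝ), (I n).indicator (fun t => ‖u t‖ ^ 2) t = 0 := by
      have h3 : ∫ t in Ioi (0 : ℝ), (((I n).indicator (fun t => ‖u t‖ ^ 2) t : ℝ) : ℂ) = 0 := by
        rw [← h1]
        refine integral_congr_ae ?_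
        filter_upwards [hfm.coeFn_toLp] with t ht
        rw [hf, ht, RCLike.inner_apply]
        by_cases htI : t ∈ I n
        · rw [indicator_of_mem htI, indicator_of_mem htI, Complex.mul_conj,
            Complex.normSq_eq_norm_sq]
        · rw [indicator_of_notMem htI, indicator_of_notMem htI]
          simp
      rw [integral_complex_ofReal] at h3
      exact_mod_cast h3
    have hsq := (memLp_two_iff_integrable_sq_norm (Lp.aestronglyMeasurable u)).1 (Lp.memLp u)
    rw [integral_eq_zero_iff_of_nonneg (fun t => indicator_nonneg (fun t _ => by positivity) t)
      (hsq.indicator hIm)] at h2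
    filter_upwards [h2] with t ht htI
    rw [indicator_of_mem htI] at ht
    simpa using ht
  rw [Lp.eq_zero_iff_ae_eq_zero]
  filter_upwards [ae_all_iff.2 hzero, ae_restrict_mem measurableSet_Ioi] with t ht ht0
  have ht0' : 0 < t := ht0
  obtain ⟨n, hn⟩ := exists_nat_ge (max t (1 / t))
  refine ht n ⟨?_, (le_max_left _ _).trans hn⟩
  have h3 : 1 / t ≤ n := (le_max_right _ _).trans hn
  rw [div_le_iff₀ ht0'] at h3
  rw [div_le_iff₀ (by positivity)]
  nlinarith

end LaplaceTransform

/-! ### Taylor remainders of the exponential -/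

section ExponentialRemainder

/-- The remainder of order `n` in the Taylor expansion of `exp (-x)` at zero, with the sign that
makes it positive for `x > 0`. -/
noncomputable def expRem (n : ℕ) (x : ℝ) : ℝ :=
  (-1) ^ (n + 1) * (Real.exp (-x) - ∑ j ∈ Finset.range (n + 1), (-x) ^ j / j.factorial)

theorem expRem_zero_left (x : ℝ) : expRem 0 x = 1 - Real.exp (-x) := by
  simp [expRem]

theorem expRem_succ (n : ℕ) (x : ℝ) :
    expRem (n + 1) x = x ^ (n + 1) / (n + 1).factorial - expRem n x := by
  rw [expRem, Finset.sum_range_succ, expRem, neg_pow x (n + 1)]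
  have h : ((-1 : ℝ) ^ (n + 1)) * (-1) ^ (n + 1) = 1 := by
    rw [← mul_pow]; norm_num
  rw [pow_succ (-1 : ℝ) (n + 1)]
  linear_combination (x ^ (n + 1) / (n + 1).factorial) * h

theorem continuous_expRem (n : ℕ) : Continuous (expRem n) := by
  unfold expRem
  fun_prop

theorem hasDerivAt_expRem_zero (x : ℝ) : HasDerivAt (expRem 0) (Real.exp (-x)) x := by
  rw [show expRem 0 = fun x => 1 - Real.exp (-x) from funext expRem_zero_left]
  exact ((hasDerivAt_neg x).exp.const_sub 1).congr_deriv (by simp)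

theorem hasDerivAt_expRem_succ (n : ℕ) (x : ℝ) :
    HasDerivAt (expRem (n + 1)) (expRem n x) x := by
  have hpow : ∀ n : ℕ, HasDerivAt (fun x : ℝ => x ^ (n + 1) / (n + 1).factorial)
      (x ^ n / n.factorial) x := fun n => by
    refine ((hasDerivAt_pow (n + 1) x).div_const ((n + 1).factorial : ℝ)).congr_deriv ?_
    rw [Nat.factorial_succ]
    push_cast
    have : (n.factorial : ℝ) ≠ 0 := by positivity
    field_simp
  induction n with
  | zero =>
    rw [show expRem (0 + 1) = fun x => x ^ (0 + 1) / (0 + 1).factorial - expRem 0 x from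
      funext (expRem_succ 0)]
    exact ((hpow 0).sub (hasDerivAt_expRem_zero x)).congr_deriv (by simp [expRem_zero_left])
  | succ n ih =>
    rw [show expRem (n + 1 + 1) = fun x => x ^ (n + 1 + 1) / (n + 1 + 1).factorial -
      expRem (n + 1) x from funext (expRem_succ (n + 1))]
    exact ((hpow (n + 1)).sub ih).congr_deriv (expRem_succ n x).symm

theorem expRem_apply_zero (n : ℕ) : expRem n 0 = 0 := by
  induction n with
  | zero => simp [expRem_zero_left]
  | succ n ih => rw [expRem_succ, ih]; simp

theorem expRem_pos (n : ℕ) {x : ℝ} (hx : 0 < x) : 0 < expRem n x := by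
  induction n generalizing x with
  | zero =>
    rw [expRem_zero_left]
    have : Real.exp (-x) < 1 := Real.exp_lt_one_iff.2 (by linarith)
    linarith
  | succ n ih =>
    have hmono : StrictMonoOn (expRem (n + 1)) (Ici 0) := by
      refine strictMonoOn_of_deriv_pos (convex_Ici 0) (continuous_expRem _).continuousOn ?_
      intro y hy
      rw [interior_Ici] at hy
      rw [(hasDerivAt_expRem_succ n y).deriv]
      exact ih hy
    have := hmono self_mem_Ici hx.le hx
    rwa [expRem_apply_zero] at this

theorem expRem_nonneg (n : ℕ) {x : ℝ} (hx : 0 ≤ x) : 0 ≤ expRem n x := by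
  rcases hx.eq_or_lt with rfl | h
  · rw [expRem_apply_zero]
  · exact (expRem_pos n h).le

theorem expRem_le_pow_succ (n : ℕ) {x : ℝ} (hx : 0 ≤ x) :
    expRem n x ≤ x ^ (n + 1) / (n + 1).factorial := by
  have := expRem_nonneg (n + 1) hx
  rw [expRem_succ] at this
  linarith

theorem expRem_le_pow (n : ℕ) {x : ℝ} (hx : 0 ≤ x) : expRem n x ≤ x ^ n / n.factorial := by
  cases n with
  | zero =>
    rw [expRem_zero_left]
    simp [Real.exp_nonneg]
  | succ n =>
    rw [expRem_succ]
    linarith [expRem_nonneg n hx]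

variable {n : ℕ} {k : ℝ}

theorem integrableOn_rpow_mul_expRem (h1 : (n : ℝ) < k) (h2 : k < n + 1) :
    IntegrableOn (fun μ : ℝ => μ ^ (-k - 1) * expRem n μ) (Ioi 0) := by
  refine integrableOn_Ioi_of_rpow_bounds (a := n - k) (b := n - k - 1)
    (A := 1) (B := 1) ?_ (by linarith) (by linarith) (fun x hx _ => ?_) (fun x hx => ?_)
  · exact ((measurable_id.pow_const _).mul (continuous_expRem n).measurable).aestronglyMeasurable
  · rw [abs_of_nonneg (mul_nonneg (by positivity) (expRem_nonneg n hx.le)), one_mul]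
    have h3 : expRem n x ≤ x ^ (n + 1) := (expRem_le_pow_succ n hx.le).trans
      (div_le_self (by positivity) (by exact_mod_cast Nat.factorial_pos _))
    calc x ^ (-k - 1) * expRem n x ≤ x ^ (-k - 1) * x ^ (n + 1) := by gcongr
      _ = x ^ (n - k) := by
        rw [← Real.rpow_natCast, ← Real.rpow_add hx]
        congr 1
        push_cast
        ring
  · have hx0 : 0 < x := by linarith
    rw [abs_of_nonneg (mul_nonneg (by positivity) (expRem_nonneg n hx0.le)), one_mul]
    have h3 : expRem n x ≤ x ^ n := (expRem_le_pow n hx0.le).trans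
      (div_le_self (by positivity) (by exact_mod_cast Nat.factorial_pos _))
    calc x ^ (-k - 1) * expRem n x ≤ x ^ (-k - 1) * x ^ n := by gcongr
      _ = x ^ (n - k - 1) := by
        rw [← Real.rpow_natCast, ← Real.rpow_add hx0]
        congr 1
        ring

/-- The constant in the representation of `x ^ k` as a regularized Laplace integral; up to sign it
is `Γ(-k)`. -/
noncomputable def remConst (n : ℕ) (k : ℝ) : ℝ := ∫ μ in Ioi (0 : ℝ), μ ^ (-k - 1) * expRem n μ

theorem remConst_pos (h1 : (n : ℝ) < k) (h2 : k < n + 1) : 0 < remConst n k := by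
  rw [remConst, setIntegral_pos_iff_support_of_nonneg_ae]
  · have : Function.support (fun μ : ℝ => μ ^ (-k - 1) * expRem n μ) ∩ Ioi 0 = Ioi 0 := by
      refine inter_eq_right.2 fun μ hμ => ?_
      exact (mul_pos (Real.rpow_pos_of_pos hμ _) (expRem_pos n hμ)).ne'
    rw [this]
    simp
  · filter_upwards [ae_restrict_mem measurableSet_Ioi] with μ hμ
    exact (mul_pos (Real.rpow_pos_of_pos hμ _) (expRem_pos n hμ)).le
  · exact integrableOn_rpow_mul_expRem h1 h2

theorem rpow_mul_expRem_scale {x μ : ℝ} (hx : 0 < x) (hμ : 0 < μ) :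
    μ ^ (-k - 1) * expRem n (x * μ) =
      x ^ (k + 1) * ((x * μ) ^ (-k - 1) * expRem n (x * μ)) := by
  rw [Real.mul_rpow hx.le hμ.le, ← mul_assoc, ← mul_assoc, ← Real.rpow_add hx]
  rw [show k + 1 + (-k - 1) = 0 by ring, Real.rpow_zero, one_mul]

theorem integrableOn_rpow_mul_expRem_scale (h1 : (n : ℝ) < k) (h2 : k < n + 1) {x : ℝ}
    (hx : 0 < x) : IntegrableOn (fun μ : ℝ => μ ^ (-k - 1) * expRem n (x * μ)) (Ioi 0) := by
  have h := (integrableOn_Ioi_comp_mul_left_iff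
    (fun μ : ℝ => μ ^ (-k - 1) * expRem n μ) 0 hx).2 (by
      rw [mul_zero]; exact integrableOn_rpow_mul_expRem h1 h2)
  refine (h.const_mul (x ^ (k + 1))).congr ?_
  filter_upwards [ae_restrict_mem measurableSet_Ioi] with μ hμ
  exact (rpow_mul_expRem_scale hx hμ).symm

theorem integral_rpow_mul_expRem_scale {x : ℝ} (hx : 0 < x) :
    ∫ μ in Ioi (0 : ℝ), μ ^ (-k - 1) * expRem n (x * μ) = x ^ k * remConst n k := by
  have h : ∫ μ in Ioi (0 : ℝ), μ ^ (-k - 1) * expRem n (x * μ) =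
      ∫ μ in Ioi (0 : ℝ), x ^ (k + 1) * ((x * μ) ^ (-k - 1) * expRem n (x * μ)) :=
    setIntegral_congr_fun measurableSet_Ioi fun μ hμ => rpow_mul_expRem_scale hx hμ
  rw [h, integral_const_mul,
    integral_comp_mul_left_Ioi (fun μ : ℝ => μ ^ (-k - 1) * expRem n μ) 0 hx, mul_zero,
    smul_eq_mul, ← mul_assoc, Real.rpow_add_one hx.ne', mul_assoc (x ^ k),
    mul_inv_cancel₀ hx.ne', mul_one, remConst]

end ExponentialRemainder

/-! ### Polynomials vanishing to a high order -/

section Polynomials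

open Polynomial

/-- A polynomial of degree less than `N` that is `O(x ^ N)` at zero vanishes. -/
theorem eq_zero_of_isBigO_pow (N : ℕ) (P : ℂ[X]) (hdeg : ∀ i, N ≤ i → P.coeff i = 0)
    (hO : (fun x : ℝ => P.eval (x : ℂ)) =O[𝓝[>] 0] fun x : ℝ => x ^ N) : P = 0 := by
  induction N generalizing P with
  | zero => exact Polynomial.ext fun i => by simpa using hdeg i (Nat.zero_le i)
  | succ N ih =>
    have hlim0 : Tendsto (fun x : ℝ => P.eval (x : ℂ)) (𝓝[>] 0) (𝓝 0) := by
      refine hO.trans_tendsto ?_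
      have : Tendsto (fun x : ℝ => x ^ (N + 1)) (𝓝 0) (𝓝 (0 ^ (N + 1))) :=
        (continuous_pow (N + 1)).tendsto 0
      rw [zero_pow (Nat.succ_ne_zero N)] at this
      exact this.mono_left nhdsWithin_le_nhds
    have hlim1 : Tendsto (fun x : ℝ => P.eval (x : ℂ)) (𝓝[>] 0) (𝓝 (P.eval ((0 : ℝ) : ℂ))) :=
      ((P.continuous.comp Complex.continuous_ofReal).tendsto 0).mono_left nhdsWithin_le_nhds
    have h0 : P.coeff 0 = 0 := by
      rw [coeff_zero_eq_eval_zero]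
      simpa using (tendsto_nhds_unique hlim0 hlim1).symm
    have hP : P = P.divX * X := by
      conv_lhs => rw [← divX_mul_X_add P, h0, C_0, add_zero]
    have hdiv : P.divX = 0 := by
      refine ih P.divX (fun i hi => by rw [coeff_divX]; exact hdeg _ (by omega)) ?_
      have h1 : (fun x : ℝ => P.eval (x : ℂ) * ((x : ℂ))⁻¹) =O[𝓝[>] 0]
          fun x : ℝ => x ^ (N + 1) * x⁻¹ := by
        refine hO.mul ?_
        refine IsBigO.of_bound 1 (Eventually.of_forall fun x => ?_)
        simp
      refine h1.congr' ?_ ?_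
      · filter_upwards [self_mem_nhdsWithin] with x hx
        have hx0 : (x : ℂ) ≠ 0 := by exact_mod_cast (ne_of_gt hx)
        conv_lhs => rw [hP]
        rw [eval_mul, eval_X, mul_assoc, mul_inv_cancel₀ hx0, mul_one]
      · filter_upwards [self_mem_nhdsWithin] with x hx
        have hx0 : x ≠ 0 := ne_of_gt hx
        rw [pow_succ, mul_assoc, mul_inv_cancel₀ hx0, mul_one]
    rw [hP, hdiv, zero_mul]

end Polynomials

/-! ### The regularized Laplace representation of the Hankel form -/

section Regularization

theorem continuousOn_quasiCarlemanKernel (v₀ β : ℝ) {ρ k : ℝ} (hρ : 0 ≤ ρ) :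
    ContinuousOn (quasiCarlemanKernel v₀ β ρ k) (Ioi 0) := by
  unfold quasiCarlemanKernel
  refine ContinuousOn.mul (ContinuousOn.mul continuousOn_const ?_) (by fun_prop)
  refine ContinuousOn.rpow_const (by fun_prop) fun x hx => Or.inl ?_
  have : 0 < x := hx
  positivity

theorem exists_abs_quasiCarlemanKernel_le (v₀ : ℝ) {β ρ k : ℝ} (hβ : 0 < β) (hρ : 0 ≤ ρ)
    (hk : 0 ≤ k) : ∃ C : ℝ, ∀ x, 0 < x →
      |quasiCarlemanKernel v₀ β ρ k x| ≤ C * Real.exp (-(β / 2 * x)) := by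
  obtain ⟨N, hN⟩ := exists_nat_ge k
  obtain ⟨C, hC0, hC⟩ := exists_add_pow_le_exp (a := 1 + ρ) (γ := β / 2) (by positivity)
    (by positivity) N
  refine ⟨|v₀| * C, fun x hx => ?_⟩
  have h1 : (x + ρ) ^ k ≤ C * Real.exp (β / 2 * x) :=
    calc (x + ρ) ^ k ≤ (1 + ρ + x) ^ k := by
          apply Real.rpow_le_rpow (by positivity) (by linarith) hk
      _ ≤ (1 + ρ + x) ^ (N : ℝ) := Real.rpow_le_rpow_of_exponent_le (by linarith) hN
      _ = (1 + ρ + x) ^ N := Real.rpow_natCast _ _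
      _ ≤ _ := hC x hx.le
  rw [quasiCarlemanKernel, abs_mul, abs_mul, Real.abs_exp,
    abs_of_nonneg (by positivity : (0 : ℝ) ≤ (x + ρ) ^ k)]
  calc |v₀| * (x + ρ) ^ k * Real.exp (-(β * x))
      ≤ |v₀| * (C * Real.exp (β / 2 * x)) * Real.exp (-(β * x)) := by gcongr
    _ = |v₀| * C * (Real.exp (β / 2 * x) * Real.exp (-(β * x))) := by ring
    _ = _ := by
      rw [← Real.exp_add]
      ring_nf

/-- The measure on the quadrant `(0, ∞)²`. -/
noncomputable abbrev quadrantMeasure : Measure (ℝ × ℝ) :=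
  (volume.restrict (Ioi (0 : ℝ))).prod (volume.restrict (Ioi (0 : ℝ)))

theorem ae_quadrantMeasure_pos : ∀ᵐ p ∂quadrantMeasure, 0 < p.1 ∧ 0 < p.2 := by
  rw [quadrantMeasure, Measure.prod_restrict]
  exact ae_restrict_mem (measurableSet_Ioi.prod measurableSet_Ioi)

/-- The density `e^{-βs} f(s) conj (e^{-βt} f(t))`, against which functions of `t + s` are
integrated to give values of Hankel forms. -/
noncomputable def hankelWeight (β : ℝ) (f : ℝ → ℂ) (p : ℝ × ℝ) : ℂ :=
  ((Real.exp (-(β * p.2)) : ℝ) : ℂ) * f p.2 *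
    (starRingEnd ℂ) (((Real.exp (-(β * p.1)) : ℝ) : ℂ) * f p.1)

theorem hankelWeight_eq (β : ℝ) (f : ℝ → ℂ) (u : ℝ → ℝ) (p : ℝ × ℝ) :
    ((u (p.1 + p.2) * Real.exp (-(β * (p.1 + p.2))) : ℝ) : ℂ) * f p.2 *
      (starRingEnd ℂ) (f p.1) = (u (p.1 + p.2) : ℂ) * hankelWeight β f p := by
  rw [hankelWeight, mul_add, neg_add, Real.exp_add]
  simp only [map_mul, Complex.conj_ofReal]
  push_cast
  ring

theorem integrable_mul_hankelWeight {β : ℝ} (hβ : 0 < β) (f : L2Pos) {u : ℝ → ℝ}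
    (hu : ContinuousOn u (Ioi 0)) {C : ℝ} {N : ℕ} (hC : ∀ x, 0 < x → |u x| ≤ C * (1 + x) ^ N) :
    Integrable (fun p : ℝ × ℝ => (u (p.1 + p.2) : ℂ) * hankelWeight β f p) quadrantMeasure := by
  obtain ⟨B, hB0, hB⟩ := exists_add_pow_le_exp one_pos (half_pos hβ) N
  have hC0 : 0 ≤ C := by
    have := (abs_nonneg _).trans (hC 1 one_pos)
    exact nonneg_of_mul_nonneg_left this (by positivity)
  have h := integrable_hankel_prod (v := fun x => u x * Real.exp (-(β * x))) (C := C * B)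
    (γ := β / 2) (hu.mul (by fun_prop)) (half_pos hβ) (fun x hx => ?_) f f
  · exact h.congr (Eventually.of_forall fun p => hankelWeight_eq β f u p)
  · rw [abs_mul, Real.abs_exp]
    calc |u x| * Real.exp (-(β * x))
        ≤ (C * (B * Real.exp (β / 2 * x))) * Real.exp (-(β * x)) := by
          gcongr
          exact (hC x hx).trans (by gcongr; exact hB x hx.le)
      _ = C * B * (Real.exp (β / 2 * x) * Real.exp (-(β * x))) := by ring
      _ = _ := by
        rw [← Real.exp_add]
        ring_nf

theorem integrable_pow_mul_hankelWeight {β ρ : ℝ} (hβ : 0 < β) (hρ : 0 ≤ ρ) (f : L2Pos) (j : ℕ) :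
    Integrable (fun p : ℝ × ℝ => (((p.1 + p.2 + ρ) ^ j : ℝ) : ℂ) * hankelWeight β f p)
      quadrantMeasure := by
  refine integrable_mul_hankelWeight (u := fun x => (x + ρ) ^ j) (C := (1 + ρ) ^ j) (N := j) hβ f
    (by fun_prop) fun x hx => ?_
  rw [abs_of_nonneg (by positivity), ← mul_pow]
  gcongr
  nlinarith

/-- The moments in the Taylor expansion of the Laplace side of a Hankel form. -/
noncomputable def hankelMoment (β ρ : ℝ) (f : ℝ → ℂ) (j : ℕ) : ℂ :=
  ∫ p, (((p.1 + p.2 + ρ) ^ j : ℝ) : ℂ) * hankelWeight β f p ∂quadrantMeasure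

/-- The function `e^{-ρμ} |(Lf)(β + μ)|²`. -/
noncomputable def laplaceDensity (β ρ : ℝ) (f : ℝ → ℂ) (μ : ℝ) : ℝ :=
  Real.exp (-(ρ * μ)) * ‖laplace f (β + μ)‖ ^ 2

theorem laplaceDensity_eq_integral (β ρ : ℝ) (f : ℝ → ℂ) (μ : ℝ) :
    (laplaceDensity β ρ f μ : ℂ) = ∫ p, ((Real.exp (-((p.1 + p.2 + ρ) * μ)) : ℝ) : ℂ) *
      hankelWeight β f p ∂quadrantMeasure := by
  have h1 : ∀ p : ℝ × ℝ, ((Real.exp (-((p.1 + p.2 + ρ) * μ)) : ℝ) : ℂ) * hankelWeight β f p =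
      ((Real.exp (-(ρ * μ)) : ℝ) : ℂ) *
        ((starRingEnd ℂ) (((Real.exp (-(p.1 * (β + μ))) : ℝ) : ℂ) * f p.1) *
        (((Real.exp (-(p.2 * (β + μ))) : ℝ) : ℂ) * f p.2)) := by
    intro p
    have e1 : Real.exp (-((p.1 + p.2 + ρ) * μ)) = Real.exp (-(p.1 * μ)) * Real.exp (-(p.2 * μ)) *
        Real.exp (-(ρ * μ)) := by
      rw [← Real.exp_add, ← Real.exp_add]; ring_nf
    have e2 : ∀ t : ℝ, Real.exp (-(t * (β + μ))) = Real.exp (-(t * μ)) * Real.exp (-(β * t)) := by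
      intro t
      rw [← Real.exp_add]; ring_nf
    rw [e1, e2, e2, hankelWeight]
    simp only [map_mul, Complex.conj_ofReal]
    push_cast
    ring
  simp only [h1]
  rw [integral_const_mul, integral_prod_mul
    (fun t => (starRingEnd ℂ) (((Real.exp (-(t * (β + μ))) : ℝ) : ℂ) * f t))
    (fun t => ((Real.exp (-(t * (β + μ))) : ℝ) : ℂ) * f t), integral_conj, ← laplace,
    ← Complex.normSq_eq_conj_mul_self, Complex.normSq_eq_norm_sq, laplaceDensity]
  push_cast
  rfl

variable {n : ℕ} {k β ρ : ℝ}

/-- The Taylor polynomial at zero of `laplaceDensity`. -/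
noncomputable def momentPoly (n : ℕ) (β ρ : ℝ) (f : ℝ → ℂ) : Polynomial ℂ :=
  ∑ j ∈ Finset.range (n + 1),
    Polynomial.monomial j ((-1) ^ j / (j.factorial : ℂ) * hankelMoment β ρ f j)

theorem integral_expRem_mul_hankelWeight (hβ : 0 < β) (hρ : 0 ≤ ρ) (f : L2Pos) {μ : ℝ}
    (hμ : 0 ≤ μ) :
    ∫ p, (expRem n ((p.1 + p.2 + ρ) * μ) : ℂ) * hankelWeight β f p ∂quadrantMeasure =
      (-1) ^ (n + 1) * ((laplaceDensity β ρ f μ : ℂ) - (momentPoly n β ρ f).eval (μ : ℂ)) := by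
  have hexp : Integrable (fun p : ℝ × ℝ => ((Real.exp (-((p.1 + p.2 + ρ) * μ)) : ℝ) : ℂ) *
      hankelWeight β f p) quadrantMeasure := by
    refine integrable_mul_hankelWeight (u := fun x => Real.exp (-((x + ρ) * μ))) (C := 1) (N := 0)
      hβ f (by fun_prop) fun x hx => ?_
    rw [Real.abs_exp, pow_zero, mul_one, Real.exp_le_one_iff, neg_nonpos]
    positivity
  have hj : ∀ j : ℕ, ∀ p : ℝ × ℝ, (((-((p.1 + p.2 + ρ) * μ)) ^ j / j.factorial : ℝ) : ℂ) *
      hankelWeight β f p = ((-1) ^ j / (j.factorial : ℂ) * (μ : ℂ) ^ j) *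
        ((((p.1 + p.2 + ρ) ^ j : ℝ) : ℂ) * hankelWeight β f p) := by
    intro j p
    rw [neg_pow, mul_pow]
    push_cast
    ring
  have hint : ∀ j : ℕ, Integrable (fun p : ℝ × ℝ =>
      (((-((p.1 + p.2 + ρ) * μ)) ^ j / j.factorial : ℝ) : ℂ) * hankelWeight β f p)
        quadrantMeasure := by
    intro j
    simp only [hj]
    exact (integrable_pow_mul_hankelWeight hβ hρ f j).const_mul _
  have hpt : ∀ p : ℝ × ℝ, (expRem n ((p.1 + p.2 + ρ) * μ) : ℂ) * hankelWeight β f p =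
      (-1) ^ (n + 1) * (((Real.exp (-((p.1 + p.2 + ρ) * μ)) : ℝ) : ℂ) * hankelWeight β f p -
        ∑ j ∈ Finset.range (n + 1), (((-((p.1 + p.2 + ρ) * μ)) ^ j / j.factorial : ℝ) : ℂ) *
          hankelWeight β f p) := by
    intro p
    rw [expRem, ← Finset.sum_mul]
    push_cast
    ring
  simp only [hpt]
  rw [integral_const_mul, integral_sub hexp (integrable_finsetSum _ fun j _ => hint j),
    integral_finsetSum _ fun j _ => hint j, laplaceDensity_eq_integral, momentPoly,
    Polynomial.eval_finsetSum]
  congr 2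
  refine Finset.sum_congr rfl fun j _ => ?_
  simp only [hj]
  rw [integral_const_mul, Polynomial.eval_monomial, hankelMoment]
  ring

/-- The Taylor remainder of `laplaceDensity` is of the expected order. -/
theorem laplaceDensity_sub_momentPoly_isBigO (n : ℕ) (hβ : 0 < β) (hρ : 0 ≤ ρ) (f : L2Pos) :
    (fun μ : ℝ => (laplaceDensity β ρ f μ : ℂ) - (momentPoly n β ρ f).eval (μ : ℂ))
      =O[𝓝[>] 0] fun μ : ℝ => μ ^ (n + 1) := by
  refine IsBigO.of_bound (∫ p, ‖(((p.1 + p.2 + ρ) ^ (n + 1) : ℝ) : ℂ) * hankelWeight β f p‖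
    ∂quadrantMeasure) ?_
  filter_upwards [self_mem_nhdsWithin] with μ hμ
  have hμ0 : 0 < μ := hμ
  have h1 : ‖(laplaceDensity β ρ f μ : ℂ) - (momentPoly n β ρ f).eval (μ : ℂ)‖ =
      ‖∫ p, (expRem n ((p.1 + p.2 + ρ) * μ) : ℂ) * hankelWeight β f p ∂quadrantMeasure‖ := by
    rw [integral_expRem_mul_hankelWeight hβ hρ f hμ0.le]
    simp
  rw [h1, ← integral_mul_const]
  refine norm_integral_le_of_norm_le
    ((integrable_pow_mul_hankelWeight hβ hρ f (n + 1)).norm.mul_const _) ?_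
  filter_upwards [ae_quadrantMeasure_pos] with p hp
  obtain ⟨hp1, hp2⟩ := hp
  have h0 : 0 ≤ (p.1 + p.2 + ρ) * μ := by positivity
  rw [norm_mul, norm_mul, Complex.norm_real, Complex.norm_real,
    Real.norm_of_nonneg (expRem_nonneg n h0), Real.norm_of_nonneg (by positivity),
    Real.norm_of_nonneg (by positivity)]
  calc expRem n ((p.1 + p.2 + ρ) * μ) * ‖hankelWeight β f p‖
      ≤ ((p.1 + p.2 + ρ) * μ) ^ (n + 1) * ‖hankelWeight β f p‖ := by
        gcongr
        exact (expRem_le_pow_succ n h0).trans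
          (div_le_self (by positivity) (by exact_mod_cast Nat.factorial_pos _))
    _ = _ := by rw [mul_pow]; ring

theorem hankel_form_eq_integral (v₀ : ℝ) (hβ : 0 < β) (hρ : 0 ≤ ρ) (hk : 0 ≤ k) (f : L2Pos) :
    ∫ t in Ioi (0 : ℝ), hankel (quasiCarlemanKernel v₀ β ρ k) f t * (starRingEnd ℂ) (f t) =
      ∫ p, ((v₀ * (p.1 + p.2 + ρ) ^ k : ℝ) : ℂ) * hankelWeight β f p ∂quadrantMeasure := by
  obtain ⟨C, hC⟩ := exists_abs_quasiCarlemanKernel_le v₀ hβ hρ hk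
  have hint := integrable_hankel_prod (continuousOn_quasiCarlemanKernel v₀ β (k := k) hρ)
    (half_pos hβ) hC f f
  have h1 : ∀ p : ℝ × ℝ, ((v₀ * (p.1 + p.2 + ρ) ^ k : ℝ) : ℂ) * hankelWeight β f p =
      (quasiCarlemanKernel v₀ β ρ k (p.1 + p.2) : ℂ) * f p.2 * (starRingEnd ℂ) (f p.1) :=
    fun p => (hankelWeight_eq β f (fun x => v₀ * (x + ρ) ^ k) p).symm
  simp only [h1]
  rw [integral_prod _ hint]
  simp only [integral_mul_const]
  rfl

/-- The regularized Laplace representation of the Hankel form, with the regularizing polynomial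
given by moments. -/
theorem hankel_form_eq_momentPoly (v₀ : ℝ) (hβ : 0 < β) (hρ : 0 ≤ ρ) (h1 : (n : ℝ) < k)
    (h2 : k < n + 1) (f : L2Pos) :
    IntegrableOn (fun μ : ℝ => ((μ ^ (-k - 1) : ℝ) : ℂ) *
      ((laplaceDensity β ρ f μ : ℂ) - (momentPoly n β ρ f).eval (μ : ℂ))) (Ioi 0) ∧
    ∫ t in Ioi (0 : ℝ), hankel (quasiCarlemanKernel v₀ β ρ k) f t * (starRingEnd ℂ) (f t) =
      ((v₀ * (-1) ^ (n + 1) / remConst n k : ℝ) : ℂ) * ∫ μ in Ioi (0 : ℝ),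
        ((μ ^ (-k - 1) : ℝ) : ℂ) *
          ((laplaceDensity β ρ f μ : ℂ) - (momentPoly n β ρ f).eval (μ : ℂ)) := by
  have hc := remConst_pos h1 h2
  have hk : 0 ≤ k := (Nat.cast_nonneg n).trans h1.le
  -- integration of `Ψ p μ` in `μ` gives the `k`-th power of `t + s + ρ`, by scaling; integration in
  -- `p` gives the Taylor remainder of `laplaceDensity`
  set Ψ : (ℝ × ℝ) → ℝ → ℂ := fun p μ => ((μ ^ (-k - 1) * expRem n ((p.1 + p.2 + ρ) * μ) : ℝ) : ℂ) *
    hankelWeight β f p with hΨ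
  have hinner : ∀ᵐ p ∂quadrantMeasure, ∫ μ in Ioi (0 : ℝ), Ψ p μ =
      ((((p.1 + p.2 + ρ) ^ k : ℝ) : ℂ) * hankelWeight β f p) * (remConst n k : ℂ) := by
    filter_upwards [ae_quadrantMeasure_pos] with p hp
    obtain ⟨hp1, hp2⟩ := hp
    simp only [hΨ]
    rw [integral_mul_const, integral_complex_ofReal,
      integral_rpow_mul_expRem_scale (by positivity)]
    push_cast
    ring
  have hkint : Integrable (fun p : ℝ × ℝ => (((p.1 + p.2 + ρ) ^ k : ℝ) : ℂ) * hankelWeight β f p)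
      quadrantMeasure := by
    refine integrable_mul_hankelWeight (u := fun x => (x + ρ) ^ k) (C := (1 + ρ) ^ (n + 1))
      (N := n + 1) hβ f ?_ fun x hx => ?_
    · refine ContinuousOn.rpow_const (by fun_prop) fun x hx => Or.inl ?_
      have : 0 < x := hx
      positivity
    · rw [abs_of_nonneg (by positivity), ← mul_pow, ← Real.rpow_natCast]
      have hge : x + ρ ≤ (1 + ρ) * (1 + x) := by nlinarith
      calc (x + ρ) ^ k ≤ ((1 + ρ) * (1 + x)) ^ k := Real.rpow_le_rpow (by positivity) hge hk
        _ ≤ _ := Real.rpow_le_rpow_of_exponent_le (by nlinarith) (by push_cast; linarith)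
  have hmeas : AEStronglyMeasurable (Function.uncurry Ψ)
      (quadrantMeasure.prod (volume.restrict (Ioi (0 : ℝ)))) := by
    have hw : AEStronglyMeasurable (fun q : (ℝ × ℝ) × ℝ => hankelWeight β f q.1)
        (quadrantMeasure.prod (volume.restrict (Ioi (0 : ℝ)))) := by
      refine AEStronglyMeasurable.comp_fst (f := hankelWeight β f) ?_
      have h3 := (integrable_mul_hankelWeight (u := fun _ => 1) (C := 1) (N := 0) hβ f
        (by fun_prop) (by simp)).aestronglyMeasurable
      simpa using h3
    refine AEStronglyMeasurable.mul ?_ hw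
    refine Measurable.aestronglyMeasurable ?_
    refine Complex.measurable_ofReal.comp (Measurable.mul ?_ ?_)
    · exact measurable_snd.pow_const _
    · exact (continuous_expRem n).measurable.comp (by fun_prop)
  have hΨint : Integrable (Function.uncurry Ψ)
      (quadrantMeasure.prod (volume.restrict (Ioi (0 : ℝ)))) := by
    rw [integrable_prod_iff hmeas]
    constructor
    · filter_upwards [ae_quadrantMeasure_pos] with p hp
      obtain ⟨hp1, hp2⟩ := hp
      have h3 := integrableOn_rpow_mul_expRem_scale h1 h2 (x := p.1 + p.2 + ρ) (by positivity)
      exact (Integrable.ofReal (𝕜 := ℂ) h3).mul_const (hankelWeight β f p)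
    · refine (hkint.norm.mul_const (remConst n k)).congr ?_
      filter_upwards [ae_quadrantMeasure_pos] with p hp
      obtain ⟨hp1, hp2⟩ := hp
      have h3 : ∫ μ in Ioi (0 : ℝ), ‖Function.uncurry Ψ (p, μ)‖ = ∫ μ in Ioi (0 : ℝ),
          (μ ^ (-k - 1) * expRem n ((p.1 + p.2 + ρ) * μ)) * ‖hankelWeight β f p‖ := by
        refine setIntegral_congr_fun measurableSet_Ioi fun μ hμ => ?_
        have hμ0 : 0 < μ := hμ
        simp only [Function.uncurry, hΨ, norm_mul, Complex.norm_real]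
        rw [Real.norm_of_nonneg (Real.rpow_nonneg hμ0.le _),
          Real.norm_of_nonneg (expRem_nonneg n (by positivity))]
      rw [h3, integral_mul_const, integral_rpow_mul_expRem_scale (by positivity), norm_mul,
        Complex.norm_real, Real.norm_of_nonneg (by positivity)]
      ring
  have houter : ∀ μ ∈ Ioi (0 : ℝ), ∫ p, Ψ p μ ∂quadrantMeasure =
      (-1) ^ (n + 1) * (((μ ^ (-k - 1) : ℝ) : ℂ) *
        ((laplaceDensity β ρ f μ : ℂ) - (momentPoly n β ρ f).eval (μ : ℂ))) := by
    intro μ hμ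
    have h3 : ∀ p : ℝ × ℝ, Ψ p μ = ((μ ^ (-k - 1) : ℝ) : ℂ) *
        ((expRem n ((p.1 + p.2 + ρ) * μ) : ℂ) * hankelWeight β f p) := fun p => by
      simp only [hΨ]
      push_cast
      ring
    simp only [h3]
    rw [integral_const_mul, integral_expRem_mul_hankelWeight hβ hρ f (le_of_lt hμ)]
    ring
  have hsign : ((-1 : ℂ) ^ (n + 1)) * (-1) ^ (n + 1) = 1 := by
    rw [← mul_pow]; norm_num
  constructor
  · have h3 := (hΨint.integral_prod_right).const_mul ((-1 : ℂ) ^ (n + 1))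
    refine h3.congr ?_
    filter_upwards [ae_restrict_mem measurableSet_Ioi] with μ hμ
    have h4 := houter μ hμ
    simp only [Function.uncurry] at h4 ⊢
    rw [h4, ← mul_assoc, hsign, one_mul]
  · have h3 : ∫ p, ((v₀ * (p.1 + p.2 + ρ) ^ k : ℝ) : ℂ) * hankelWeight β f p ∂quadrantMeasure =
        ((v₀ / remConst n k : ℝ) : ℂ) * ∫ p, (∫ μ in Ioi (0 : ℝ), Ψ p μ) ∂quadrantMeasure := by
      rw [integral_congr_ae hinner, integral_mul_const, ← mul_assoc, mul_right_comm,
        ← Complex.ofReal_mul, div_mul_cancel₀ _ hc.ne', ← integral_const_mul]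
      refine integral_congr_ae (Eventually.of_forall fun p => ?_)
      simp only
      push_cast
      ring
    rw [hankel_form_eq_integral v₀ hβ hρ hk, h3, integral_integral_swap hΨint,
      setIntegral_congr_fun measurableSet_Ioi houter, integral_const_mul]
    push_cast
    ring

/-- The regularized Laplace representation of the Hankel form. The regularizing polynomial `Q` can
be any polynomial of degree at most `n` with the right behaviour at zero, because there is only one
such polynomial. -/
theorem hankel_form_eq (v₀ : ℝ) (hβ : 0 < β) (hρ : 0 ≤ ρ) (h1 : (n : ℝ) < k)
    (h2 : k < n + 1) (f : L2Pos) (Q : Polynomial ℂ) (hQ : Q.natDegree ≤ n)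
    (hO : (fun μ : ℝ => (laplaceDensity β ρ f μ : ℂ) - Q.eval (μ : ℂ))
      =O[𝓝[>] 0] fun μ : ℝ => μ ^ (n + 1)) :
    IntegrableOn (fun μ : ℝ => ((μ ^ (-k - 1) : ℝ) : ℂ) *
      ((laplaceDensity β ρ f μ : ℂ) - Q.eval (μ : ℂ))) (Ioi 0) ∧
    ∫ t in Ioi (0 : ℝ), hankel (quasiCarlemanKernel v₀ β ρ k) f t * (starRingEnd ℂ) (f t) =
      ((v₀ * (-1) ^ (n + 1) / remConst n k : ℝ) : ℂ) * ∫ μ in Ioi (0 : ℝ),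
        ((μ ^ (-k - 1) : ℝ) : ℂ) * ((laplaceDensity β ρ f μ : ℂ) - Q.eval (μ : ℂ)) := by
  have hQeq : Q = momentPoly n β ρ f := by
    rw [← sub_eq_zero]
    refine eq_zero_of_isBigO_pow (n + 1) _ (fun i hi => ?_) ?_
    · have h3 : (momentPoly n β ρ f).coeff i = 0 := by
        rw [momentPoly, Polynomial.finsetSum_coeff]
        refine Finset.sum_eq_zero fun j hj => ?_
        rw [Polynomial.coeff_monomial, if_neg]
        have := Finset.mem_range.1 hj
        omega
      rw [Polynomial.coeff_sub, h3, Polynomial.coeff_eq_zero_of_natDegree_lt (by omega), sub_zero]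
    · refine ((laplaceDensity_sub_momentPoly_isBigO n hβ hρ f).sub hO).congr_left fun μ => ?_
      rw [Polynomial.eval_sub]
      ring
  rw [hQeq]
  exact hankel_form_eq_momentPoly v₀ hβ hρ h1 h2 f

end Regularization

/-! ### Laplace transforms of rational functions -/

section TestFunctions

open Polynomial

theorem memLp_pow_mul_exp {α : ℝ} (hα : 0 < α) (j : ℕ) :
    MemLp (fun t : ℝ => ((t ^ j / j.factorial * Real.exp (-(α * t)) : ℝ) : ℂ)) 2
      (volume.restrict (Ioi (0 : ℝ))) := by
  obtain ⟨C, hC0, hC⟩ := exists_add_pow_le_exp one_pos (half_pos hα) j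
  refine ((memLp_exp_neg (half_pos hα)).const_mul C).mono ?_ ?_
  · apply Continuous.aestronglyMeasurable
    fun_prop
  · filter_upwards [ae_restrict_mem measurableSet_Ioi] with t ht
    have ht0 : 0 < t := ht
    rw [Complex.norm_real, Real.norm_of_nonneg (by positivity), Real.norm_of_nonneg (by positivity)]
    calc t ^ j / j.factorial * Real.exp (-(α * t))
        ≤ (C * Real.exp (α / 2 * t)) * Real.exp (-(α * t)) := by
          gcongr
          refine (div_le_self (by positivity) (by exact_mod_cast Nat.factorial_pos _)).trans ?_
          refine le_trans ?_ (hC t ht0.le)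
          gcongr
          linarith
      _ = C * (Real.exp (α / 2 * t) * Real.exp (-(α * t))) := by ring
      _ = _ := by
        rw [← Real.exp_add]
        ring_nf

/-- The function `t ^ j / j! * e^{-αt}` in `L²(ℝ₊)`; its Laplace transform is
`(x + α) ^ (-j - 1)`. -/
noncomputable def powExpLp {α : ℝ} (hα : 0 < α) (j : ℕ) : L2Pos := (memLp_pow_mul_exp hα j).toLp _

theorem laplace_powExpLp {α : ℝ} (hα : 0 < α) (j : ℕ) {x : ℝ} (hx : 0 < x) :
    laplace (powExpLp hα j) x = ((((x + α) ^ (j + 1))⁻¹ : ℝ) : ℂ) := by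
  rw [powExpLp, laplace_congr (memLp_pow_mul_exp hα j).coeFn_toLp, laplace]
  have h1 : ∀ t : ℝ, ((Real.exp (-(t * x)) : ℝ) : ℂ) *
      ((t ^ j / j.factorial * Real.exp (-(α * t)) : ℝ) : ℂ) =
      (((j.factorial : ℝ)⁻¹ * (t ^ j * Real.exp (-((x + α) * t))) : ℝ) : ℂ) := by
    intro t
    rw [← Complex.ofReal_mul, add_mul, neg_add, Real.exp_add, mul_comm x t]
    congr 1
    ring
  simp only [h1]
  rw [integral_complex_ofReal, integral_const_mul]
  have h2 := Real.integral_rpow_mul_exp_neg_mul_Ioi (a := (j : ℝ) + 1) (r := x + α)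
    (by positivity) (by positivity)
  rw [add_sub_cancel_right, Real.Gamma_nat_eq_factorial, one_div, ← Nat.cast_succ] at h2
  simp only [Real.rpow_natCast] at h2
  rw [h2, inv_pow]
  have : (j.factorial : ℝ) ≠ 0 := by positivity
  congr 1
  field_simp

theorem laplace_sum {ι : Type*} (s : Finset ι) (f : ι → L2Pos) {x : ℝ} (hx : 0 < x) :
    laplace (∑ i ∈ s, f i : L2Pos) x = ∑ i ∈ s, laplace (f i) x := by
  simp only [laplace_eq_inner hx, inner_sum]

/-- Proper rational functions with a pole at `-α` are Laplace transforms of functions in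
`L²(ℝ₊)`. -/
theorem exists_laplace_eq_rational {α : ℝ} (hα : 0 < α) (b : ℕ) :
    ∃ Θ : ℂ[X] →ₗ[ℂ] L2Pos, ∀ P : ℂ[X], P.natDegree < b → ∀ x : ℝ, 0 < x →
      laplace (Θ P) x = P.eval (x : ℂ) / ((x + α : ℝ) : ℂ) ^ b := by
  refine ⟨∑ i ∈ Finset.range b, (LinearMap.toSpanSingleton ℂ L2Pos (powExpLp hα (b - 1 - i))) ∘ₗ
    (lcoeff ℂ i) ∘ₗ (taylor (-(α : ℂ))), fun P hP x hx => ?_⟩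
  have hxα : ((x + α : ℝ) : ℂ) ≠ 0 := by
    have : x + α ≠ 0 := by positivity
    exact_mod_cast this
  have h1 : P.eval (x : ℂ) = (taylor (-(α : ℂ)) P).eval ((x + α : ℝ) : ℂ) := by
    rw [taylor_eval]
    congr 1
    push_cast
    ring
  rw [h1, eval_eq_sum_range' (n := b) (by rwa [natDegree_taylor]), Finset.sum_div,
    LinearMap.sum_apply, laplace_sum _ _ hx]
  refine Finset.sum_congr rfl fun i hi => ?_
  have hi' := Finset.mem_range.1 hi
  simp only [LinearMap.comp_apply, LinearMap.toSpanSingleton_apply, lcoeff_apply]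
  rw [laplace_smul hx, laplace_powExpLp hα _ hx, mul_div_assoc]
  congr 1
  have h2 : b = i + (b - 1 - i + 1) := by omega
  conv_rhs => rw [h2, pow_add]
  push_cast
  push_cast at hxα
  field_simp

/-- A function with a maximum, equal to `1`, at `α`, flat there to order `2 q`. It vanishes at zero
and at infinity, and its powers become more and more concentrated at `α`. -/
noncomputable def bump (α : ℝ) (q : ℕ) (x : ℝ) : ℝ := 1 - ((x - α) / (x + α)) ^ (2 * q)

theorem sq_moebius_lt_one {α x : ℝ} (hα : 0 < α) (hx : 0 < x) : ((x - α) / (x + α)) ^ 2 < 1 := by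
  rw [div_pow, div_lt_one (by positivity)]
  nlinarith [mul_pos hα hx]

theorem bump_nonneg {α x : ℝ} (hα : 0 < α) (q : ℕ) (hx : 0 < x) : 0 ≤ bump α q x := by
  rw [bump, pow_mul, sub_nonneg]
  exact pow_le_one₀ (sq_nonneg _) (sq_moebius_lt_one hα hx).le

theorem bump_le_one (α : ℝ) (q : ℕ) (x : ℝ) : bump α q x ≤ 1 := by
  rw [bump, pow_mul]
  have : 0 ≤ (((x - α) / (x + α)) ^ 2) ^ q := by positivity
  linarith

theorem bump_lt_one {α x : ℝ} (hα : 0 < α) (q : ℕ) (hx : 0 < x) (hne : x ≠ α) :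
    bump α q x < 1 := by
  rw [bump, pow_mul]
  have h1 : x - α ≠ 0 := sub_ne_zero.2 hne
  have h2 : 0 < (((x - α) / (x + α)) ^ 2) ^ q := by positivity
  linarith

theorem bump_le_div {α x : ℝ} (hα : 0 < α) (q : ℕ) (hx : 0 < x) :
    bump α q x ≤ 4 * q * (1 + α) / (1 + x) := by
  -- Bernoulli's inequality reduces the estimate to `q = 1`
  have h1 := one_add_mul_le_pow (a := ((x - α) / (x + α)) ^ 2 - 1)
    (by nlinarith [sq_nonneg ((x - α) / (x + α))]) q
  rw [add_sub_cancel] at h1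
  have h2 : bump α q x ≤ q * (1 - ((x - α) / (x + α)) ^ 2) := by
    rw [bump, pow_mul]
    linarith
  have h3 : 1 - ((x - α) / (x + α)) ^ 2 = 4 * α * x / (x + α) ^ 2 := by
    field_simp
    ring
  have h4 : 4 * α * x / (x + α) ^ 2 ≤ 4 * (1 + α) / (1 + x) := by
    rw [div_le_div_iff₀ (by positivity) (by positivity)]
    have : 0 < α * x := by positivity
    nlinarith [mul_pos hα hx, mul_pos (mul_pos hα hx) hx, mul_pos (mul_pos hα hx) hα,
      mul_pos hα hα, mul_pos hx hx, mul_pos (mul_pos hα hα) hα]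
  calc bump α q x ≤ q * (4 * (1 + α) / (1 + x)) := by
        refine h2.trans ?_
        rw [h3]
        gcongr
    _ = _ := by ring

theorem measurable_bump (α : ℝ) (q : ℕ) : Measurable (bump α q) := by
  unfold bump
  fun_prop

/-- The functions `P * bump ^ N`, with `P` a polynomial of degree less than `N`, are Laplace
transforms of functions in `L²(ℝ₊)`. -/
theorem exists_laplace_eq_mul_bump {α : ℝ} (hα : 0 < α) {q : ℕ} (hq : 1 ≤ q) (N : ℕ) :
    ∃ Θ : ℂ[X] →ₗ[ℂ] L2Pos, ∀ P : ℂ[X], P.natDegree < N → ∀ x : ℝ, 0 < x →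
      laplace (Θ P) x = P.eval (x : ℂ) * (bump α q x : ℂ) ^ N := by
  obtain ⟨Θ, hΘ⟩ := exists_laplace_eq_rational hα (2 * q * N)
  -- `bump` is the quotient of `U` by `(x + α) ^ (2 q)`; the leading coefficients in `U` cancel,
  -- which makes `P U ^ N / (x + α) ^ (2 q N)` a proper rational function
  set U : ℂ[X] := (X + C (α : ℂ)) ^ (2 * q) - (X - C (α : ℂ)) ^ (2 * q) with hU
  have hm1 : ((X + C (α : ℂ)) ^ (2 * q)).Monic := (monic_X_add_C _).pow _
  have hm2 : ((X - C (α : ℂ)) ^ (2 * q)).Monic := (monic_X_sub_C _).pow _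
  have hd1 : ((X + C (α : ℂ)) ^ (2 * q)).natDegree = 2 * q := by
    rw [natDegree_pow, natDegree_X_add_C, mul_one]
  have hd2 : ((X - C (α : ℂ)) ^ (2 * q)).natDegree = 2 * q := by
    rw [natDegree_pow, natDegree_X_sub_C, mul_one]
  have hUdeg : U.natDegree ≤ 2 * q - 1 := by
    refine natDegree_le_iff_coeff_eq_zero.2 fun i hi => ?_
    rw [hU, coeff_sub]
    rcases (show 2 * q ≤ i by omega).eq_or_lt with rfl | h
    · have e1 := hm1.coeff_natDegree
      have e2 := hm2.coeff_natDegree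
      rw [hd1] at e1
      rw [hd2] at e2
      rw [e1, e2, sub_self]
    · rw [coeff_eq_zero_of_natDegree_lt (by omega), coeff_eq_zero_of_natDegree_lt (by omega),
        sub_self]
  refine ⟨Θ ∘ₗ LinearMap.mulRight ℂ (U ^ N), fun P hP x hx => ?_⟩
  have hdeg : (P * U ^ N).natDegree < 2 * q * N := by
    have h1 : (P * U ^ N).natDegree ≤ P.natDegree + N * (2 * q - 1) :=
      natDegree_mul_le.trans (Nat.add_le_add_left
        (natDegree_pow_le.trans (Nat.mul_le_mul_left _ hUdeg)) _)
    obtain ⟨c, hc⟩ : ∃ c, 2 * q = c + 1 := ⟨2 * q - 1, by omega⟩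
    rw [hc] at h1 ⊢
    rw [Nat.add_sub_cancel] at h1
    nlinarith
  rw [LinearMap.comp_apply, LinearMap.mulRight_apply, hΘ _ hdeg x hx, eval_mul, eval_pow,
    mul_div_assoc, pow_mul, ← div_pow]
  congr 2
  have hxα : ((x : ℂ) + (α : ℂ)) ≠ 0 := by
    have : x + α ≠ 0 := by positivity
    exact_mod_cast this
  rw [hU, eval_sub, eval_pow, eval_pow, eval_add, eval_sub, eval_X, eval_C, bump]
  push_cast
  rw [sub_div, div_self (pow_ne_zero _ hxα), div_pow]

/-- The polynomial with given coefficients. -/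
noncomputable def polyOfCoeffs (M : ℕ) : (Fin M → ℂ) →ₗ[ℂ] ℂ[X] :=
  ∑ i : Fin M, (monomial (i : ℕ)) ∘ₗ LinearMap.proj i

theorem polyOfCoeffs_apply {M : ℕ} (c : Fin M → ℂ) :
    polyOfCoeffs M c = ∑ i : Fin M, monomial (i : ℕ) (c i) := by
  simp [polyOfCoeffs]

theorem eval_polyOfCoeffs {M : ℕ} (c : Fin M → ℂ) (x : ℂ) :
    (polyOfCoeffs M c).eval x = ∑ i : Fin M, c i * x ^ (i : ℕ) := by
  simp [polyOfCoeffs_apply, eval_finsetSum]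

theorem polyOfCoeffs_ne_zero {M : ℕ} {c : Fin M → ℂ} (hc : c ≠ 0) : polyOfCoeffs M c ≠ 0 := by
  intro h
  apply hc
  funext i
  have h1 := congrArg (fun P : ℂ[X] => P.coeff i) h
  simpa [polyOfCoeffs_apply, finsetSum_coeff, coeff_monomial, Fin.val_inj] using h1

theorem natDegree_polyOfCoeffs_le {M : ℕ} (c : Fin M → ℂ) :
    (polyOfCoeffs M c).natDegree ≤ M - 1 := by
  rw [polyOfCoeffs_apply]
  refine natDegree_sum_le_of_forall_le _ _ fun i _ => (natDegree_monomial_le _).trans ?_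
  have := i.2
  omega

theorem integral_norm_sq_poly_pos {P : ℂ[X]} (hP : P ≠ 0) {a b : ℝ} (hab : a < b) :
    0 < ∫ x in a..b, ‖P.eval (x : ℂ)‖ ^ 2 := by
  have hcont : Continuous fun x : ℝ => ‖P.eval (x : ℂ)‖ ^ 2 :=
    (P.continuous.comp Complex.continuous_ofReal).norm.pow 2
  refine intervalIntegral.integral_pos hab hcont.continuousOn (fun x _ => by positivity) ?_
  by_contra hno
  push Not at hno
  refine hP (eq_zero_of_infinite_isRoot P (((Icc_infinite hab).image
    Complex.ofReal_injective.injOn).mono ?_))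
  rintro _ ⟨x, hx, rfl⟩
  have h1 := hno x hx
  have h2 : ‖P.eval (x : ℂ)‖ = 0 := by
    have := sq_nonneg ‖P.eval (x : ℂ)‖
    exact pow_eq_zero_iff two_ne_zero |>.1 (le_antisymm h1 this)
  exact norm_eq_zero.1 h2

/-- All norms on the space of polynomials of bounded degree are equivalent: the `L²` norm on any
interval controls the values everywhere. -/
theorem exists_norm_sq_poly_le (M : ℕ) {a b : ℝ} (hab : a < b) :
    ∃ B : ℝ, 0 ≤ B ∧ ∀ (c : Fin M → ℂ) (x : ℝ), ‖(polyOfCoeffs M c).eval (x : ℂ)‖ ^ 2 ≤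
      B * (1 + |x|) ^ (2 * M) * ∫ y in a..b, ‖(polyOfCoeffs M c).eval (y : ℂ)‖ ^ 2 := by
  set J : (Fin M → ℂ) → ℝ := fun c => ∫ y in a..b, ‖(polyOfCoeffs M c).eval (y : ℂ)‖ ^ 2 with hJ
  have hJcont : Continuous J := by
    refine intervalIntegral.continuous_parametric_intervalIntegral_of_continuous' ?_ a b
    simp only [eval_polyOfCoeffs]
    fun_prop
  have hval : ∀ (c : Fin M → ℂ) (x : ℝ),
      ‖(polyOfCoeffs M c).eval (x : ℂ)‖ ≤ M * ‖c‖ * (1 + |x|) ^ M := by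
    intro c x
    rw [eval_polyOfCoeffs]
    refine (norm_sum_le _ _).trans ?_
    calc ∑ i : Fin M, ‖c i * (x : ℂ) ^ (i : ℕ)‖ ≤ ∑ _i : Fin M, ‖c‖ * (1 + |x|) ^ M := by
          refine Finset.sum_le_sum fun i _ => ?_
          rw [norm_mul, norm_pow, Complex.norm_real, Real.norm_eq_abs]
          have hx := abs_nonneg x
          have h1 : |x| ^ (i : ℕ) ≤ (1 + |x|) ^ M :=
            (pow_le_pow_left₀ hx (by linarith) _).trans
              (pow_le_pow_right₀ (by linarith) i.2.le)
          gcongr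
          exact norm_le_pi_norm c i
      _ = _ := by
          rw [Finset.sum_const, Finset.card_univ, Fintype.card_fin, nsmul_eq_mul]
          ring
  -- the minimum of `J` on the unit sphere is positive, and `J` is homogeneous of degree two
  obtain ⟨δ, hδ, hδJ⟩ : ∃ δ : ℝ, 0 < δ ∧ ∀ c : Fin M → ℂ, δ * ‖c‖ ^ 2 ≤ J c := by
    have hscale : ∀ (r : ℝ) (c : Fin M → ℂ), J ((r : ℂ) • c) = r ^ 2 * J c := by
      intro r c
      simp only [hJ, map_smul, eval_smul, smul_eq_mul, norm_mul, Complex.norm_real, mul_pow,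
        Real.norm_eq_abs, sq_abs]
      rw [intervalIntegral.integral_const_mul]
    rcases (Metric.sphere (0 : Fin M → ℂ) 1).eq_empty_or_nonempty with hempty | hne
    · refine ⟨1, one_pos, fun c => ?_⟩
      by_cases hc : c = 0
      · simp [hc, hJ]
      · exfalso
        have hc' : ‖c‖ ≠ 0 := norm_ne_zero_iff.2 hc
        have : ((‖c‖⁻¹ : ℝ) : ℂ) • c ∈ Metric.sphere (0 : Fin M → ℂ) 1 := by
          rw [mem_sphere_zero_iff_norm, norm_smul, Complex.norm_real, norm_inv, norm_norm,
            inv_mul_cancel₀ hc']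
        rw [hempty] at this
        exact this
    · obtain ⟨c₀, hc₀, hmin⟩ := (isCompact_sphere (0 : Fin M → ℂ) 1).exists_isMinOn hne
        hJcont.continuousOn
      have hc₀' : c₀ ≠ 0 := by
        rintro rfl
        simp at hc₀
      refine ⟨J c₀, integral_norm_sq_poly_pos (polyOfCoeffs_ne_zero hc₀') hab, fun c => ?_⟩
      by_cases hc : c = 0
      · simp [hc, hJ]
      · have hc' : ‖c‖ ≠ 0 := norm_ne_zero_iff.2 hc
        have hmem : ((‖c‖⁻¹ : ℝ) : ℂ) • c ∈ Metric.sphere (0 : Fin M → ℂ) 1 := by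
          rw [mem_sphere_zero_iff_norm, norm_smul, Complex.norm_real, norm_inv, norm_norm,
            inv_mul_cancel₀ hc']
        have h1 := isMinOn_iff.1 hmin _ hmem
        rw [hscale] at h1
        have h2 : 0 < ‖c‖ ^ 2 := by positivity
        calc J c₀ * ‖c‖ ^ 2 ≤ ‖c‖⁻¹ ^ 2 * J c * ‖c‖ ^ 2 := by gcongr
          _ = J c := by field_simp
  refine ⟨M ^ 2 / δ, by positivity, fun c x => ?_⟩
  calc ‖(polyOfCoeffs M c).eval (x : ℂ)‖ ^ 2 ≤ (M * ‖c‖ * (1 + |x|) ^ M) ^ 2 := by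
        gcongr
        exact hval c x
    _ = M ^ 2 / δ * (1 + |x|) ^ (2 * M) * (δ * ‖c‖ ^ 2) := by
        rw [pow_mul']
        field_simp
    _ ≤ _ := by
        gcongr
        exact hδJ c

/-- Concentration: the part of a polynomially weighted integral of `bump ^ (2 N)` over a set where
`bump < r` is `o(r ^ (2 N))`. -/
theorem tendsto_integral_bump {ν : Measure ℝ} (hν : ∀ᵐ x ∂ν, 0 < x) {L : ℕ}
    (hL : Integrable (fun x : ℝ => ((1 + x) ^ L)⁻¹) ν) {α : ℝ} (hα : 0 < α) (q : ℕ) {r : ℝ}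
    (hr : 0 < r) (hlt : ∀ᵐ x ∂ν, bump α q x < r) (j : ℕ) :
    (∀ᶠ N : ℕ in atTop, Integrable (fun x : ℝ => (1 + x) ^ j * (bump α q x / r) ^ (2 * N)) ν) ∧
      Tendsto (fun N : ℕ => ∫ x, (1 + x) ^ j * (bump α q x / r) ^ (2 * N) ∂ν) atTop (𝓝 0) := by
  set B : ℝ := 4 * q * (1 + α) with hB
  set N₀ := j + L with hN₀
  have hbound : ∀ N, N₀ ≤ N → ∀ᵐ x ∂ν, ‖(1 + x) ^ j * (bump α q x / r) ^ (2 * N)‖ ≤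
      (B / r) ^ (2 * N₀) * ((1 + x) ^ L)⁻¹ := by
    intro N hN
    filter_upwards [hν, hlt] with x hx hxr
    have hb0 := bump_nonneg hα q hx
    have hbr0 : 0 ≤ bump α q x / r := by positivity
    rw [Real.norm_of_nonneg (by positivity)]
    calc (1 + x) ^ j * (bump α q x / r) ^ (2 * N)
        ≤ (1 + x) ^ j * (bump α q x / r) ^ (2 * N₀) := by
          gcongr ?_ * ?_
          exact pow_le_pow_of_le_one hbr0 (by rw [div_le_one hr]; exact hxr.le) (by omega)
      _ ≤ (1 + x) ^ j * (B / (1 + x) / r) ^ (2 * N₀) := by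
          gcongr
          exact bump_le_div hα q hx
      _ = (B / r) ^ (2 * N₀) * ((1 + x) ^ j / (1 + x) ^ (2 * N₀)) := by
          rw [div_right_comm, div_pow _ (1 + x)]
          ring
      _ ≤ (B / r) ^ (2 * N₀) * ((1 + x) ^ L)⁻¹ := by
          have hBr : 0 ≤ (B / r) ^ (2 * N₀) := by rw [pow_mul']; positivity
          gcongr
          rw [div_le_iff₀ (by positivity), inv_mul_eq_div, le_div_iff₀ (by positivity), ← pow_add]
          exact pow_le_pow_right₀ (by linarith) (by omega)
  have hmeas : ∀ N : ℕ, AEStronglyMeasurable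
      (fun x : ℝ => (1 + x) ^ j * (bump α q x / r) ^ (2 * N)) ν := fun N =>
    (((measurable_id.const_add 1).pow_const j).mul
      (((measurable_bump α q).div_const r).pow_const _)).aestronglyMeasurable
  refine ⟨?_, ?_⟩
  · filter_upwards [eventually_ge_atTop N₀] with N hN
    exact (hL.const_mul _).mono' (hmeas N) (hbound N hN)
  · rw [← integral_zero ℝ ℝ (μ := ν)]
    refine tendsto_integral_filter_of_dominated_convergence
      (fun x => (B / r) ^ (2 * N₀) * ((1 + x) ^ L)⁻¹) (Eventually.of_forall hmeas) ?_
      (hL.const_mul _) ?_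
    · filter_upwards [eventually_ge_atTop N₀] with N hN
      exact hbound N hN
    · filter_upwards [hν, hlt] with x hx hxr
      have hb0 := bump_nonneg hα q hx
      have h1 : Tendsto (fun N : ℕ => ((bump α q x / r) ^ 2) ^ N) atTop (𝓝 0) := by
        refine tendsto_pow_atTop_nhds_zero_of_lt_one (by positivity) ?_
        have : bump α q x / r < 1 := by rwa [div_lt_one hr]
        exact pow_lt_one₀ (by positivity) this two_ne_zero
      simpa [pow_mul] using h1.const_mul ((1 + x) ^ j)

end TestFunctions

/-! ### The quadratic form of the perturbed operator -/

section QuadraticForm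

open Polynomial

theorem freeForm_self (σ₀ : ℝ → ℝ) (f : L2Pos) :
    freeForm σ₀ f f = ((∫ x, ‖laplace f x‖ ^ 2 ∂(sigmaMeasure σ₀) : ℝ) : ℂ) := by
  rw [freeForm, ← integral_complex_ofReal]
  refine integral_congr_ae (Eventually.of_forall fun x => ?_)
  simp only
  rw [Complex.mul_conj, Complex.normSq_eq_norm_sq]

theorem perturbedForm_zero_re (σ₀ v : ℝ → ℝ) :
    (perturbedForm σ₀ v (0 : L2Pos) (0 : L2Pos)).re = 0 := by
  have h1 : laplace (0 : L2Pos) = fun _ => 0 := by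
    funext x
    rw [laplace_congr (Lp.coeFn_zero ℂ 2 _) x]
    simp [laplace]
  have h2 : ∫ t in Ioi (0 : ℝ), hankel v (0 : L2Pos) t * (starRingEnd ℂ) ((0 : L2Pos) t) = 0 := by
    refine integral_eq_zero_of_ae ?_
    filter_upwards [Lp.coeFn_zero ℂ 2 (volume.restrict (Ioi (0 : ℝ)))] with t ht
    rw [ht]
    simp
  rw [perturbedForm, h2, freeForm_self, h1]
  simp

theorem integrable_norm_sq_laplace {σ₀ : ℝ → ℝ} {f : L2Pos} (hf : f ∈ formDomain σ₀) :
    Integrable (fun x => ‖laplace f x‖ ^ 2) (sigmaMeasure σ₀) :=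
  (memLp_two_iff_integrable_sq_norm (stronglyMeasurable_laplace f).aestronglyMeasurable).1
    (mem_formDomain.1 hf)

variable {n : ℕ} {k β ρ : ℝ}

/-- The coefficient in front of the regularized integral. Its sign, the sign of `v₀ Γ(-k)`, decides
between finitely and infinitely many negative eigenvalues. -/
noncomputable def sigmaCoeff (v₀ : ℝ) (n : ℕ) (k : ℝ) : ℝ := v₀ * (-1) ^ (n + 1) / remConst n k

/-- If the Laplace transform vanishes at `β` to a sufficiently high order, no regularization is
needed. -/
theorem hankel_form_eq_of_isBigO (v₀ : ℝ) (hβ : 0 < β) (hρ : 0 ≤ ρ) (h1 : (n : ℝ) < k)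
    (h2 : k < n + 1) {m : ℕ} (hm : n + 1 ≤ 2 * m) (f : L2Pos)
    (hO : (fun μ : ℝ => laplace f (β + μ)) =O[𝓝[>] 0] fun μ : ℝ => μ ^ m) :
    IntegrableOn (fun μ : ℝ => μ ^ (-k - 1) * laplaceDensity β ρ f μ) (Ioi 0) ∧
    ∫ t in Ioi (0 : ℝ), hankel (quasiCarlemanKernel v₀ β ρ k) f t * (starRingEnd ℂ) (f t) =
      ((sigmaCoeff v₀ n k * ∫ μ in Ioi (0 : ℝ), μ ^ (-k - 1) * laplaceDensity β ρ f μ : ℝ) : ℂ)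
    := by
  have hO' : (fun μ : ℝ => (laplaceDensity β ρ f μ : ℂ) - (0 : ℂ[X]).eval (μ : ℂ))
      =O[𝓝[>] 0] fun μ : ℝ => μ ^ (n + 1) := by
    have h3 : (fun μ : ℝ => (laplaceDensity β ρ f μ : ℂ) - (0 : ℂ[X]).eval (μ : ℂ))
        =O[𝓝[>] 0] fun μ : ℝ => ‖laplace f (β + μ)‖ ^ 2 := by
      refine IsBigO.of_bound 1 ?_
      filter_upwards [self_mem_nhdsWithin] with μ hμ
      have hμ0 : 0 < μ := hμ
      rw [eval_zero, sub_zero, Complex.norm_real, laplaceDensity, norm_mul, Real.norm_eq_abs,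
        Real.abs_exp]
      gcongr
      rw [Real.exp_le_one_iff, neg_nonpos]
      positivity
    refine (h3.trans (hO.norm_left.pow 2)).trans ?_
    refine IsBigO.of_bound 1 ?_
    filter_upwards [Ioo_mem_nhdsGT one_pos] with μ hμ
    have hμ0 : 0 ≤ μ := hμ.1.le
    rw [← pow_mul, norm_pow, norm_pow, Real.norm_of_nonneg hμ0, one_mul]
    exact pow_le_pow_of_le_one hμ0 hμ.2.le (by omega)
  obtain ⟨h4, h5⟩ := hankel_form_eq v₀ hβ hρ h1 h2 f 0 (by simp) hO'
  have h6 : ∀ μ : ℝ, ((μ ^ (-k - 1) : ℝ) : ℂ) *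
      ((laplaceDensity β ρ f μ : ℂ) - (0 : ℂ[X]).eval (μ : ℂ)) =
      ((μ ^ (-k - 1) * laplaceDensity β ρ f μ : ℝ) : ℂ) := fun μ => by
    rw [eval_zero, sub_zero]
    push_cast
    rfl
  simp only [h6] at h4 h5
  refine ⟨h4.re.congr (Eventually.of_forall fun μ => Complex.ofReal_re _), ?_⟩
  rw [h5, integral_complex_ofReal, sigmaCoeff]
  push_cast
  rfl

theorem integrable_pow_mul_exp_mul (hβ : 0 < β) (f : L2Pos) (j : ℕ) :
    Integrable (fun t : ℝ => ((t ^ j / j.factorial * Real.exp (-(β * t)) : ℝ) : ℂ) * f t)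
      (volume.restrict (Ioi (0 : ℝ))) :=
  (memLp_pow_mul_exp hβ j).integrable_mul (Lp.memLp f)

theorem inner_powExpLp (hβ : 0 < β) (f : L2Pos) (j : ℕ) :
    inner ℂ (powExpLp hβ j) f =
      ∫ t in Ioi (0 : ℝ), ((t ^ j / j.factorial * Real.exp (-(β * t)) : ℝ) : ℂ) * f t := by
  rw [L2.inner_def]
  refine integral_congr_ae ?_
  filter_upwards [(memLp_pow_mul_exp hβ j).coeFn_toLp] with t ht
  rw [powExpLp, ht, RCLike.inner_apply, Complex.conj_ofReal, mul_comm]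

/-- If the moments of `e^{-βt} f(t)` of order at most `l` vanish, the Laplace transform of `f` has a
zero of order `l + 1` at `β`. -/
theorem laplace_isBigO_of_moments (hβ : 0 < β) (f : L2Pos) {l : ℕ}
    (hf : ∀ j ≤ l, inner ℂ (powExpLp hβ j) f = 0) :
    (fun μ : ℝ => laplace f (β + μ)) =O[𝓝[>] 0] fun μ : ℝ => μ ^ (l + 1) := by
  have hint := integrable_pow_mul_exp_mul hβ f (l + 1)
  refine IsBigO.of_bound
    (∫ t in Ioi (0 : ℝ), ‖((t ^ (l + 1) / (l + 1).factorial * Real.exp (-(β * t)) : ℝ) : ℂ) * f t‖)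
    ?_
  filter_upwards [self_mem_nhdsWithin] with μ hμ
  have hμ0 : 0 < μ := hμ
  have h1 : laplace f (β + μ) = (-1) ^ (l + 1) * ∫ t in Ioi (0 : ℝ),
      ((expRem l (t * μ) * Real.exp (-(β * t)) : ℝ) : ℂ) * f t := by
    have hsign : ((-1 : ℂ) ^ (l + 1)) * (-1) ^ (l + 1) = 1 := by
      rw [← mul_pow]; norm_num
    have hpt : ∀ t : ℝ, ((-1 : ℂ) ^ (l + 1)) *
        (((expRem l (t * μ) * Real.exp (-(β * t)) : ℝ) : ℂ) * f t) =
        ((Real.exp (-(t * (β + μ))) : ℝ) : ℂ) * f t - ∑ j ∈ Finset.range (l + 1),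
          (-(μ : ℂ)) ^ j * (((t ^ j / j.factorial * Real.exp (-(β * t)) : ℝ) : ℂ) * f t) := by
      intro t
      have e1 : Real.exp (-(t * (β + μ))) = Real.exp (-(t * μ)) * Real.exp (-(β * t)) := by
        rw [← Real.exp_add]; ring_nf
      have e2 : ∑ j ∈ Finset.range (l + 1),
          (-(μ : ℂ)) ^ j * (((t ^ j / j.factorial * Real.exp (-(β * t)) : ℝ) : ℂ) * f t) =
          ((∑ j ∈ Finset.range (l + 1), (-(t * μ)) ^ j / j.factorial : ℝ) : ℂ) *
            ((Real.exp (-(β * t)) : ℝ) : ℂ) * f t := by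
        rw [Complex.ofReal_sum, Finset.sum_mul, Finset.sum_mul]
        refine Finset.sum_congr rfl fun j _ => ?_
        rw [neg_pow (t * μ), neg_pow (μ : ℂ), mul_pow]
        push_cast
        ring
      rw [e1, e2, expRem]
      simp only [Complex.ofReal_mul, Complex.ofReal_sub, Complex.ofReal_pow, Complex.ofReal_neg,
        Complex.ofReal_one]
      linear_combination (((Real.exp (-(t * μ)) : ℝ) : ℂ) - ((∑ j ∈ Finset.range (l + 1),
        (-(t * μ)) ^ j / j.factorial : ℝ) : ℂ)) * ((Real.exp (-(β * t)) : ℝ) : ℂ) * f t * hsign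
    rw [← integral_const_mul]
    simp only [hpt]
    rw [integral_sub (laplace_integrable f (by positivity))
      (integrable_finsetSum _ fun j _ => (integrable_pow_mul_exp_mul hβ f j).const_mul _),
      integral_finsetSum _ fun j _ => (integrable_pow_mul_exp_mul hβ f j).const_mul _,
      Finset.sum_eq_zero, sub_zero, laplace]
    intro j hj
    rw [integral_const_mul, ← inner_powExpLp hβ f j, hf j (by have := Finset.mem_range.1 hj; omega),
      mul_zero]
  have hsn : ‖((-1 : ℂ)) ^ (l + 1)‖ = 1 := by simp
  rw [h1, norm_mul, hsn, one_mul, ← integral_mul_const]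
  refine norm_integral_le_of_norm_le (hint.norm.mul_const _) ?_
  filter_upwards [ae_restrict_mem measurableSet_Ioi] with t ht
  have ht0 : 0 < t := ht
  have h0 : 0 ≤ t * μ := by positivity
  rw [norm_mul, norm_mul, Complex.norm_real, Complex.norm_real,
    Real.norm_of_nonneg (mul_nonneg (expRem_nonneg l h0) (Real.exp_pos _).le),
    Real.norm_of_nonneg (by positivity), Real.norm_of_nonneg (by positivity)]
  calc expRem l (t * μ) * Real.exp (-(β * t)) * ‖f t‖
      ≤ ((t * μ) ^ (l + 1) / (l + 1).factorial) * Real.exp (-(β * t)) * ‖f t‖ := by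
        gcongr
        exact expRem_le_pow_succ l h0
    _ = _ := by rw [mul_pow]; ring

/-- For a positive coefficient the form is nonnegative on the functions with `n / 2 + 1`
vanishing moments, where `n = [k]`. -/
theorem negIndex_le_of_sigmaCoeff_pos (σ₀ : ℝ → ℝ) (v₀ : ℝ) (hβ : 0 < β) (hρ : 0 ≤ ρ)
    (h1 : (n : ℝ) < k) (h2 : k < n + 1) (hτ : 0 < sigmaCoeff v₀ n k) :
    negIndex (formDomain σ₀) (perturbedForm σ₀ (quasiCarlemanKernel v₀ β ρ k)) ≤
      ((n / 2 + 1 : ℕ) : ℕ∞) := by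
  refine negIndex_le_of_linearMap (LinearMap.pi fun j : Fin (n / 2 + 1) =>
    (innerSL ℂ (powExpLp hβ j)).toLinearMap) fun f _ hf => ?_
  have hmom : ∀ j ≤ n / 2, inner ℂ (powExpLp hβ j) f = 0 := fun j hj => by
    have := congrFun hf ⟨j, by omega⟩
    simpa using this
  obtain ⟨-, h3⟩ := hankel_form_eq_of_isBigO v₀ hβ hρ h1 h2 (m := n / 2 + 1) (by omega) f
    (laplace_isBigO_of_moments hβ f hmom)
  rw [perturbedForm, h3, freeForm_self, ← Complex.ofReal_add, Complex.ofReal_re]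
  refine add_nonneg (integral_nonneg fun x => by positivity) (mul_nonneg hτ.le ?_)
  refine setIntegral_nonneg measurableSet_Ioi fun μ hμ => ?_
  have hμ0 : 0 < μ := hμ
  unfold laplaceDensity
  positivity

/-- The test functions: their Laplace transforms are `p (x - β) E (x - β) bump ^ N`, where `p` runs
through the polynomials of degree less than `M` and `E` is a fixed polynomial. -/
theorem exists_test_family {α : ℝ} (hα : 0 < α) {q : ℕ} (hq : 1 ≤ q) (β : ℝ) (M : ℕ) (E : ℂ[X])
    {N : ℕ} (hN : M + E.natDegree < N) :
    ∃ φ : (Fin M → ℂ) →ₗ[ℂ] L2Pos, ∀ c, ∀ x : ℝ, 0 < x → laplace (φ c) x =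
      (polyOfCoeffs M c).eval ((x - β : ℝ) : ℂ) * E.eval ((x - β : ℝ) : ℂ) *
        (bump α q x : ℂ) ^ N := by
  obtain ⟨Θ, hΘ⟩ := exists_laplace_eq_mul_bump hα hq N
  refine ⟨Θ ∘ₗ (taylor (-(β : ℂ))) ∘ₗ (LinearMap.mulRight ℂ E) ∘ₗ polyOfCoeffs M,
    fun c x hx => ?_⟩
  simp only [LinearMap.comp_apply, LinearMap.mulRight_apply]
  rw [hΘ _ _ x hx, taylor_eval, eval_mul]
  · push_cast
    rw [← sub_eq_add_neg]
  · rw [natDegree_taylor]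
    refine natDegree_mul_le.trans_lt ?_
    have := natDegree_polyOfCoeffs_le c
    omega

theorem exists_norm_sq_mul_poly_le {β : ℝ} (hβ : 0 < β) (M : ℕ) (E : ℂ[X]) {a b : ℝ}
    (hab : a < b) : ∃ (B : ℝ) (j : ℕ), 0 ≤ B ∧ ∀ (c : Fin M → ℂ) (x : ℝ), 0 < x →
      ‖(polyOfCoeffs M c).eval ((x - β : ℝ) : ℂ) * E.eval ((x - β : ℝ) : ℂ)‖ ^ 2 ≤
        B * (1 + x) ^ j * ∫ y in a..b, ‖(polyOfCoeffs M c).eval (y : ℂ)‖ ^ 2 := by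
  obtain ⟨B, hB0, hB⟩ := exists_norm_sq_poly_le M hab
  set d := E.natDegree with hd
  set A : ℝ := ∑ i ∈ Finset.range (d + 1), ‖E.coeff i‖ with hA
  have hE : ∀ y : ℝ, ‖E.eval (y : ℂ)‖ ≤ A * (1 + |y|) ^ d := by
    intro y
    rw [eval_eq_sum_range, hA, Finset.sum_mul]
    refine (norm_sum_le _ _).trans (Finset.sum_le_sum fun i hi => ?_)
    rw [norm_mul, norm_pow, Complex.norm_real, Real.norm_eq_abs]
    have hy := abs_nonneg y
    gcongr
    exact (pow_le_pow_left₀ hy (by linarith) _).trans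
      (pow_le_pow_right₀ (by linarith) (by have := Finset.mem_range.1 hi; omega))
  refine ⟨B * A ^ 2 * (1 + β) ^ (2 * M + 2 * d), 2 * M + 2 * d, by positivity, fun c x hx => ?_⟩
  set I : ℝ := ∫ y in a..b, ‖(polyOfCoeffs M c).eval (y : ℂ)‖ ^ 2 with hI
  have hI0 : 0 ≤ I := intervalIntegral.integral_nonneg hab.le fun y _ => by positivity
  have hle : 1 + |x - β| ≤ (1 + β) * (1 + x) := by
    have : |x - β| ≤ x + β := abs_le.2 ⟨by linarith, by linarith⟩
    nlinarith [mul_pos hβ hx]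
  rw [norm_mul, mul_pow]
  calc ‖(polyOfCoeffs M c).eval ((x - β : ℝ) : ℂ)‖ ^ 2 * ‖E.eval ((x - β : ℝ) : ℂ)‖ ^ 2
      ≤ (B * (1 + |x - β|) ^ (2 * M) * I) * (A * (1 + |x - β|) ^ d) ^ 2 := by
        gcongr
        · exact hB c (x - β)
        · exact hE (x - β)
    _ = B * A ^ 2 * (1 + |x - β|) ^ (2 * M + 2 * d) * I := by
        rw [pow_add]
        ring
    _ ≤ B * A ^ 2 * ((1 + β) * (1 + x)) ^ (2 * M + 2 * d) * I := by gcongr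
    _ = _ := by rw [mul_pow]; ring

end QuadraticForm

/-! ### Negative subspaces for a positive coefficient -/

section PositiveCoefficient

open Polynomial

/-- The Taylor polynomial of `exp (ρ x / 2)` at zero. -/
noncomputable def expPoly (n : ℕ) (ρ : ℝ) : ℂ[X] :=
  ∑ i ∈ Finset.range (n + 1), monomial i (((ρ / 2) ^ i / i.factorial : ℝ) : ℂ)

theorem eval_expPoly (n : ℕ) (ρ x : ℝ) : (expPoly n ρ).eval (x : ℂ) =
    ((∑ i ∈ Finset.range (n + 1), (ρ / 2 * x) ^ i / i.factorial : ℝ) : ℂ) := by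
  rw [expPoly, eval_finsetSum, Complex.ofReal_sum]
  refine Finset.sum_congr rfl fun i _ => ?_
  rw [eval_monomial, mul_pow]
  push_cast
  ring

/-- The square of this function is `1` up to `O(μ ^ (n + 1))` at zero: the factor `bump` is flat at
its maximum, and the truncated exponential compensates the exponential. -/
noncomputable def profile (n : ℕ) (β ρ : ℝ) (N : ℕ) (μ : ℝ) : ℝ :=
  Real.exp (-(ρ / 2 * μ)) * (∑ i ∈ Finset.range (n + 1), (ρ / 2 * μ) ^ i / i.factorial) *
    bump β (n + 1) (β + μ) ^ N

variable {n : ℕ} {k β ρ : ℝ}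

theorem truncExp_mem_Icc (n : ℕ) {y : ℝ} (hy : 0 ≤ y) :
    Real.exp (-y) * (∑ i ∈ Finset.range (n + 1), y ^ i / i.factorial) ∈ Icc (0 : ℝ) 1 := by
  refine ⟨by positivity, ?_⟩
  rw [Real.exp_neg, inv_mul_le_iff₀ (Real.exp_pos _), mul_one]
  exact Real.sum_le_exp_of_nonneg hy (n + 1)

theorem profile_nonneg (hβ : 0 < β) (hρ : 0 ≤ ρ) (N : ℕ) {μ : ℝ} (hμ : 0 < μ) :
    0 ≤ profile n β ρ N μ :=
  mul_nonneg (truncExp_mem_Icc n (by positivity)).1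
    (pow_nonneg (bump_nonneg hβ _ (by positivity)) _)

theorem profile_le (hβ : 0 < β) (hρ : 0 ≤ ρ) (N : ℕ) {μ : ℝ} (hμ : 0 < μ) :
    profile n β ρ N μ ≤ bump β (n + 1) (β + μ) ^ N :=
  mul_le_of_le_one_left (pow_nonneg (bump_nonneg hβ _ (by positivity)) _)
    (truncExp_mem_Icc n (by positivity)).2

theorem profile_le_one (hβ : 0 < β) (hρ : 0 ≤ ρ) (N : ℕ) {μ : ℝ} (hμ : 0 < μ) :
    profile n β ρ N μ ≤ 1 :=
  (profile_le hβ hρ N hμ).trans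
    (pow_le_one₀ (bump_nonneg hβ _ (by positivity)) (bump_le_one _ _ _))

theorem one_sub_profile_sq_isBigO (n : ℕ) (hβ : 0 < β) (hρ : 0 ≤ ρ) (N : ℕ) :
    (fun μ : ℝ => 1 - profile n β ρ N μ ^ 2) =O[𝓝[>] 0] fun μ : ℝ => μ ^ (n + 1) := by
  have hexp : (fun μ : ℝ => Real.exp (ρ / 2 * μ) -
      ∑ i ∈ Finset.range (n + 1), (ρ / 2 * μ) ^ i / i.factorial) =O[𝓝[>] 0]
      fun μ : ℝ => μ ^ (n + 1) := by
    have h1 := Real.exp_sub_sum_range_isBigO_pow (n + 1)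
    have h2 : Tendsto (fun μ : ℝ => ρ / 2 * μ) (𝓝[>] 0) (𝓝 0) := by
      have : Tendsto (fun μ : ℝ => ρ / 2 * μ) (𝓝 0) (𝓝 (ρ / 2 * 0)) :=
        (continuous_const_mul (ρ / 2)).tendsto 0
      rw [mul_zero] at this
      exact this.mono_left nhdsWithin_le_nhds
    refine (h1.comp_tendsto h2).trans ?_
    refine IsBigO.of_bound (|ρ / 2| ^ (n + 1)) (Eventually.of_forall fun μ => ?_)
    rw [Function.comp_apply, norm_pow, norm_pow, Real.norm_eq_abs, Real.norm_eq_abs, abs_mul,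
      mul_pow]
  have hbump : (fun μ : ℝ => 1 - bump β (n + 1) (β + μ)) =O[𝓝[>] 0]
      fun μ : ℝ => μ ^ (n + 1) := by
    refine IsBigO.of_bound ((1 / (2 * β)) ^ (2 * (n + 1))) ?_
    filter_upwards [Ioo_mem_nhdsGT one_pos] with μ hμ
    have hμ0 : 0 < μ := hμ.1
    rw [bump, sub_sub_cancel, Real.norm_of_nonneg (by rw [pow_mul]; positivity),
      Real.norm_of_nonneg (by positivity)]
    calc ((β + μ - β) / (β + μ + β)) ^ (2 * (n + 1)) ≤ (1 / (2 * β) * μ) ^ (2 * (n + 1)) := by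
          have : 0 ≤ (β + μ - β) / (β + μ + β) := by
            rw [add_sub_cancel_left]; positivity
          gcongr
          rw [add_sub_cancel_left, one_div_mul_eq_div]
          gcongr
          linarith
      _ = (1 / (2 * β)) ^ (2 * (n + 1)) * μ ^ (2 * (n + 1)) := mul_pow _ _ _
      _ ≤ _ := by
          gcongr ?_ * ?_
          exact pow_le_pow_of_le_one hμ0.le hμ.2.le (by omega)
  refine IsBigO.trans (g := fun μ : ℝ => 2 * ‖Real.exp (ρ / 2 * μ) -
      ∑ i ∈ Finset.range (n + 1), (ρ / 2 * μ) ^ i / i.factorial‖ +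
      2 * N * ‖1 - bump β (n + 1) (β + μ)‖) ?_
    ((hexp.norm_left.const_mul_left 2).add (hbump.norm_left.const_mul_left (2 * N)))
  refine IsBigO.of_bound 1 ?_
  filter_upwards [self_mem_nhdsWithin] with μ hμ
  have hμ0 : 0 < μ := hμ
  have hy : 0 ≤ ρ / 2 * μ := by positivity
  set y := ρ / 2 * μ with hyd
  set s := ∑ i ∈ Finset.range (n + 1), y ^ i / i.factorial with hs
  set b := bump β (n + 1) (β + μ) with hb
  have hb0 : 0 ≤ b := bump_nonneg hβ _ (by positivity)
  have hb1 : b ≤ 1 := bump_le_one _ _ _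
  obtain ⟨ht0, ht1⟩ := truncExp_mem_Icc n hy
  rw [← hs] at ht0 ht1
  have hP0 : 0 ≤ profile n β ρ N μ := profile_nonneg hβ hρ N hμ0
  have hP1 : profile n β ρ N μ ≤ 1 := profile_le_one hβ hρ N hμ0
  -- Bernoulli's inequality
  have hbN : 1 - N * (1 - b) ≤ b ^ N := by
    have := one_add_mul_le_pow (a := b - 1) (by linarith) N
    rw [add_sub_cancel] at this
    linarith
  have hbN0 : 0 ≤ b ^ N := by positivity
  have hbN1 : b ^ N ≤ 1 := pow_le_one₀ hb0 hb1
  have ht : 1 - Real.exp (-y) * s ≤ Real.exp y - s := by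
    have h1 : Real.exp (-y) ≤ 1 := by
      rw [Real.exp_le_one_iff]
      linarith
    have h2 : 0 ≤ Real.exp y - s := by
      have := Real.sum_le_exp_of_nonneg hy (n + 1)
      linarith
    have h3 : Real.exp (-y) * Real.exp y = 1 := by rw [← Real.exp_add]; simp
    nlinarith
  have hprod : profile n β ρ N μ = Real.exp (-y) * s * b ^ N := rfl
  have hsplit : 1 - profile n β ρ N μ ≤ (Real.exp y - s) + N * (1 - b) := by
    rw [hprod]
    nlinarith
  rw [one_mul, Real.norm_of_nonneg (by nlinarith)]
  have h5 : 1 - profile n β ρ N μ ^ 2 ≤ 2 * (1 - profile n β ρ N μ) := by nlinarith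
  refine le_trans ?_ (le_abs_self _)
  have h6 : (N : ℝ) * (1 - b) ≤ N * ‖1 - b‖ := by
    gcongr
    exact le_abs_self _
  have h7 : Real.exp y - s ≤ ‖Real.exp y - s‖ := le_abs_self _
  linarith

/-- For a positive coefficient the form is negative on a subspace of dimension `n / 2 + 1`,
where `n = [k]`. On the test functions the regularized integral equals
`-∫ μ ^ (-k - 1) |p|² (1 - profile²)`, while the contribution of `σ₀` disappears as `bump ^ N`
concentrates at the point `β`. -/
theorem le_negIndex_of_sigmaCoeff_pos {σ₀ : ℝ → ℝ} (hσ : IsFreeSigma σ₀) (v₀ : ℝ) (hβ : 0 < β)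
    (hρ : 0 ≤ ρ) (h1 : (n : ℝ) < k) (h2 : k < n + 1) (hτ : 0 < sigmaCoeff v₀ n k) :
    ((n / 2 + 1 : ℕ) : ℕ∞) ≤
      negIndex (formDomain σ₀) (perturbedForm σ₀ (quasiCarlemanKernel v₀ β ρ k)) := by
  set m := n / 2 + 1 with hm
  -- this factor of the test functions compensates `e^{-ρμ}` in `laplaceDensity`
  set E := expPoly n ρ with hE
  set τ := sigmaCoeff v₀ n k with hτd
  obtain ⟨B, j, hB0, hB⟩ := exists_norm_sq_mul_poly_le hβ m E one_lt_two
  obtain ⟨L, hL⟩ := hσ.exists_integrable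
  have hlt : ∀ᵐ x ∂(sigmaMeasure σ₀), bump β (n + 1) x < 1 := by
    have hne : ∀ᵐ x ∂(sigmaMeasure σ₀), x ≠ β := by
      have hac : sigmaMeasure σ₀ ≪ volume :=
        (withDensity_absolutelyContinuous _ _).trans Measure.absolutelyContinuous_restrict
      exact hac.ae_le (Measure.ae_ne volume β)
    filter_upwards [hne, sigmaMeasure_pos σ₀] with x hx hx0
    exact bump_lt_one hβ _ hx0 hx
  obtain ⟨hint, hlim⟩ := tendsto_integral_bump (sigmaMeasure_pos σ₀) hL hβ (n + 1) one_pos hlt j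
  -- `κ |p|²` is a lower bound for the integrand of the regularized integral on `(1, 2]`
  set κ : ℝ := 2 ^ (-k - 1) * (1 / (2 * β + 1)) ^ (2 * (n + 1)) with hκ
  have hκ0 : 0 < κ := by positivity
  obtain ⟨N, hNint, hNsmall, hNm⟩ := (hint.and ((hlim.eventually_lt_const
    (show 0 < τ * κ / (B + 1) by positivity)).and
      (eventually_gt_atTop (m + E.natDegree)))).exists
  simp only [div_one] at hNint hNsmall
  obtain ⟨φ, hφ⟩ := exists_test_family hβ (q := n + 1) (by omega) β m E hNm
  have hbound : ∀ c : Fin m → ℂ, ∀ x, 0 < x → ‖laplace (φ c) x‖ ^ 2 ≤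
      B * (∫ y in (1 : ℝ)..2, ‖(polyOfCoeffs m c).eval (y : ℂ)‖ ^ 2) *
        ((1 + x) ^ j * bump β (n + 1) x ^ (2 * N)) := by
    intro c x hx
    have hb0 := bump_nonneg hβ (n + 1) hx
    rw [hφ c x hx, norm_mul, mul_pow, norm_pow, Complex.norm_real, Real.norm_of_nonneg hb0,
      ← pow_mul, mul_comm N]
    calc _ ≤ (B * (1 + x) ^ j * ∫ y in (1 : ℝ)..2, ‖(polyOfCoeffs m c).eval (y : ℂ)‖ ^ 2) *
          bump β (n + 1) x ^ (2 * N) := by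
          gcongr
          exact hB c x hx
      _ = _ := by ring
  have hmem : ∀ c, φ c ∈ formDomain σ₀ := fun c =>
    mem_formDomain_of_integrable (hNint.const_mul _) (hbound c)
  have hrank := le_negIndex_of_linearMap (D := formDomain σ₀)
    (q := perturbedForm σ₀ (quasiCarlemanKernel v₀ β ρ k)) φ hmem ?_ (perturbedForm_zero_re _ _)
  · rwa [Module.finrank_fin_fun] at hrank
  intro c hc
  set p := polyOfCoeffs m c with hp
  set I : ℝ := ∫ y in (1 : ℝ)..2, ‖p.eval (y : ℂ)‖ ^ 2 with hI
  have hI0 : 0 < I := integral_norm_sq_poly_pos (polyOfCoeffs_ne_zero hc) one_lt_two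
  -- the regularizing polynomial is `|p|²`
  set Q : ℂ[X] := p * p.map (starRingEnd ℂ) with hQ
  have hQeval : ∀ x : ℝ, Q.eval (x : ℂ) = ((‖p.eval (x : ℂ)‖ ^ 2 : ℝ) : ℂ) := by
    intro x
    have h3 : (p.map (starRingEnd ℂ)).eval (x : ℂ) = (starRingEnd ℂ) (p.eval (x : ℂ)) := by
      conv_lhs => rw [← Complex.conj_ofReal x]
      rw [eval_map_apply]
    rw [hQ, eval_mul, h3, Complex.mul_conj, Complex.normSq_eq_norm_sq]
  have hQdeg : Q.natDegree ≤ n := by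
    refine natDegree_mul_le.trans ?_
    have h3 : p.natDegree ≤ m - 1 := natDegree_polyOfCoeffs_le c
    have h4 : (p.map (starRingEnd ℂ)).natDegree ≤ p.natDegree := natDegree_map_le
    omega
  have hdens : ∀ μ : ℝ, 0 < μ → laplaceDensity β ρ (φ c) μ =
      ‖p.eval (μ : ℂ)‖ ^ 2 * profile n β ρ N μ ^ 2 := by
    intro μ hμ
    have hs0 : 0 ≤ ∑ i ∈ Finset.range (n + 1), (ρ / 2 * μ) ^ i / i.factorial := by positivity
    have hexp : Real.exp (-(ρ * μ)) = Real.exp (-(ρ / 2 * μ)) ^ 2 := by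
      rw [← Real.exp_nat_mul]
      congr 1
      push_cast
      ring
    rw [laplaceDensity, hφ c _ (by positivity), add_sub_cancel_left, hE, eval_expPoly, norm_mul,
      norm_mul, norm_pow, Complex.norm_real, Complex.norm_real, Real.norm_of_nonneg hs0,
      Real.norm_of_nonneg (bump_nonneg hβ _ (by positivity)), hexp, profile]
    ring
  have hO : (fun μ : ℝ => (laplaceDensity β ρ (φ c) μ : ℂ) - Q.eval (μ : ℂ))
      =O[𝓝[>] 0] fun μ : ℝ => μ ^ (n + 1) := by
    have hpO : (fun μ : ℝ => ‖p.eval (μ : ℂ)‖ ^ 2) =O[𝓝[>] 0] fun _ : ℝ => (1 : ℝ) := by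
      have hcont : Continuous fun μ : ℝ => ‖p.eval (μ : ℂ)‖ ^ 2 :=
        (p.continuous.comp Complex.continuous_ofReal).norm.pow 2
      exact ((hcont.tendsto 0).mono_left nhdsWithin_le_nhds).isBigO_one ℝ
    have h3 := hpO.mul (one_sub_profile_sq_isBigO n hβ hρ N)
    simp only [one_mul] at h3
    refine IsBigO.trans (IsBigO.of_bound 1 ?_) h3
    filter_upwards [self_mem_nhdsWithin] with μ hμ
    rw [hdens μ hμ, hQeval, ← Complex.ofReal_sub, Complex.norm_real, one_mul, ← norm_neg]
    apply le_of_eq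
    congr 1
    ring
  obtain ⟨hGint, hform⟩ := hankel_form_eq v₀ hβ hρ h1 h2 (φ c) Q hQdeg hO
  set G : ℝ → ℝ := fun μ => μ ^ (-k - 1) * (‖p.eval (μ : ℂ)‖ ^ 2 * (1 - profile n β ρ N μ ^ 2))
    with hG
  have hptw : ∀ μ ∈ Ioi (0 : ℝ), ((μ ^ (-k - 1) : ℝ) : ℂ) *
      ((laplaceDensity β ρ (φ c) μ : ℂ) - Q.eval (μ : ℂ)) = ((-G μ : ℝ) : ℂ) := by
    intro μ hμ
    rw [hdens μ hμ, hQeval, hG]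
    push_cast
    ring
  have hGint' : IntegrableOn G (Ioi 0) := by
    refine hGint.re.neg.congr ?_
    filter_upwards [ae_restrict_mem measurableSet_Ioi] with μ hμ
    have h3 := congrArg Complex.re (hptw μ hμ)
    rw [Complex.ofReal_re] at h3
    simp only [Pi.neg_apply]
    exact neg_eq_iff_eq_neg.2 h3
  rw [setIntegral_congr_fun measurableSet_Ioi hptw, integral_complex_ofReal, integral_neg,
    ← sigmaCoeff, ← hτd] at hform
  have hG0 : ∀ μ ∈ Ioi (0 : ℝ), 0 ≤ G μ := by
    intro μ hμ
    have hμ0 : 0 < μ := hμ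
    have h3 : 0 ≤ 1 - profile n β ρ N μ ^ 2 := by
      have := pow_le_one₀ (n := 2) (profile_nonneg (n := n) hβ hρ N hμ0)
        (profile_le_one hβ hρ N hμ0)
      linarith
    simp only [hG]
    positivity
  have hGlow : κ * I ≤ ∫ μ in Ioi (0 : ℝ), G μ := by
    have hsub : Ioc (1 : ℝ) 2 ⊆ Ioi 0 := fun μ hμ => lt_trans one_pos hμ.1
    have hcont : Continuous fun μ : ℝ => ‖p.eval (μ : ℂ)‖ ^ 2 :=
      (p.continuous.comp Complex.continuous_ofReal).norm.pow 2
    calc κ * I = ∫ μ in Ioc (1 : ℝ) 2, κ * ‖p.eval (μ : ℂ)‖ ^ 2 := by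
          rw [integral_const_mul, hI, intervalIntegral.integral_of_le one_le_two]
      _ ≤ ∫ μ in Ioc (1 : ℝ) 2, G μ := by
          refine setIntegral_mono_on ?_ (hGint'.mono_set hsub) measurableSet_Ioc fun μ hμ => ?_
          · exact (continuous_const.mul hcont).integrableOn_Ioc
          have hμ0 : 0 < μ := lt_trans one_pos hμ.1
          have hb0 := bump_nonneg hβ (n + 1) (x := β + μ) (by positivity)
          have h3 : profile n β ρ N μ ^ 2 ≤ bump β (n + 1) (β + μ) := by
            calc profile n β ρ N μ ^ 2 ≤ (bump β (n + 1) (β + μ) ^ N) ^ 2 := by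
                  gcongr
                  · exact profile_nonneg hβ hρ N hμ0
                  · exact profile_le hβ hρ N hμ0
              _ = bump β (n + 1) (β + μ) ^ (N * 2) := (pow_mul _ _ _).symm
              _ ≤ bump β (n + 1) (β + μ) ^ 1 :=
                  pow_le_pow_of_le_one hb0 (bump_le_one _ _ _) (by omega)
              _ = _ := pow_one _
          have h4 : (1 / (2 * β + 1)) ^ (2 * (n + 1)) ≤ 1 - profile n β ρ N μ ^ 2 := by
            refine le_trans ?_ (sub_le_sub_left h3 1)
            rw [bump, sub_sub_cancel, add_sub_cancel_left]
            refine pow_le_pow_left₀ (by positivity) ?_ _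
            rw [div_le_div_iff₀ (by positivity) (by positivity)]
            nlinarith [hμ.1]
          have h5 : (2 : ℝ) ^ (-k - 1) ≤ μ ^ (-k - 1) := by
            refine Real.rpow_le_rpow_of_nonpos hμ0 hμ.2 ?_
            have : (0 : ℝ) ≤ n := Nat.cast_nonneg n
            linarith
          calc κ * ‖p.eval (μ : ℂ)‖ ^ 2
              = 2 ^ (-k - 1) * (‖p.eval (μ : ℂ)‖ ^ 2 * (1 / (2 * β + 1)) ^ (2 * (n + 1))) := by
                rw [hκ]; ring
            _ ≤ G μ := by
                simp only [hG]
                gcongr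
      _ ≤ _ := by
          refine setIntegral_mono_set hGint' ?_ (LE.le.eventuallyLE hsub)
          filter_upwards [ae_restrict_mem measurableSet_Ioi] with μ hμ
          exact hG0 μ hμ
  have hfree : ∫ x, ‖laplace (φ c) x‖ ^ 2 ∂(sigmaMeasure σ₀) ≤
      B * I * ∫ x, (1 + x) ^ j * bump β (n + 1) x ^ (2 * N) ∂(sigmaMeasure σ₀) := by
    rw [← integral_const_mul]
    refine integral_mono_ae (integrable_norm_sq_laplace (hmem c)) (hNint.const_mul _) ?_
    filter_upwards [sigmaMeasure_pos σ₀] with x hx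
    exact hbound c x hx
  rw [perturbedForm, hform, freeForm_self, ← Complex.ofReal_mul, ← Complex.ofReal_add,
    Complex.ofReal_re]
  have h6 : B * I * ∫ x, (1 + x) ^ j * bump β (n + 1) x ^ (2 * N) ∂(sigmaMeasure σ₀) ≤
      B * I * (τ * κ / (B + 1)) := by gcongr
  have h7 : B * I * (τ * κ / (B + 1)) < I * (τ * κ) := by
    have h8 : B / (B + 1) < 1 := by
      rw [div_lt_one (by positivity)]
      linarith
    have h9 : 0 < I * (τ * κ) := by positivity
    calc B * I * (τ * κ / (B + 1)) = B / (B + 1) * (I * (τ * κ)) := by ring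
      _ < 1 * (I * (τ * κ)) := by gcongr
      _ = _ := one_mul _
  have h10 : τ * (κ * I) ≤ τ * ∫ μ in Ioi (0 : ℝ), G μ := by gcongr
  linarith

end PositiveCoefficient

/-! ### Negative subspaces for a negative coefficient -/

section NegativeCoefficient

open Polynomial

theorem IsFreeSigma.exists_bound_Ioc {σ₀ : ℝ → ℝ} (h : IsFreeSigma σ₀) {β : ℝ} (hβ : 0 < β) :
    ∃ C : ℝ, 0 ≤ C ∧
      ∀ᵐ x ∂(volume.restrict (Ioi (0 : ℝ))), x ∈ Ioc β (β + 1) → σ₀ x ≤ C := by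
  obtain ⟨C, p, L, hC, hp0, -, hb⟩ := h.exists_bound
  refine ⟨C * β ^ (-p) * (2 + β) ^ L, by positivity, ?_⟩
  filter_upwards [hb] with x hx hxJ
  have hx0 : 0 < x := hβ.trans hxJ.1
  refine hx.trans ?_
  gcongr C * ?_ * ?_ ^ L
  · exact Real.rpow_le_rpow_of_nonpos hβ hxJ.1.le (by linarith)
  · linarith [hxJ.2]

theorem setIntegral_sigmaMeasure_le {σ₀ : ℝ → ℝ} {C : ℝ} (hC : 0 ≤ C) {s : Set ℝ}
    (hs : MeasurableSet s) (hs0 : s ⊆ Ioi 0)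
    (hb : ∀ᵐ x ∂(volume.restrict (Ioi (0 : ℝ))), x ∈ s → σ₀ x ≤ C) {F : ℝ → ℝ}
    (hF0 : ∀ x, 0 ≤ F x) (hF : IntegrableOn F s) :
    ∫ x in s, F x ∂(sigmaMeasure σ₀) ≤ C * ∫ x in s, F x := by
  have hle : (sigmaMeasure σ₀).restrict s ≤ ENNReal.ofReal C • volume.restrict s := by
    rw [sigmaMeasure, restrict_withDensity hs, Measure.restrict_restrict hs,
      inter_eq_left.2 hs0, ← withDensity_const]
    refine withDensity_mono ?_
    filter_upwards [ae_restrict_of_ae_restrict_of_subset hs0 hb, ae_restrict_mem hs] with x hx hxs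
    exact ENNReal.ofReal_le_ofReal (hx hxs)
  calc ∫ x in s, F x ∂(sigmaMeasure σ₀) ≤ ∫ x, F x ∂(ENNReal.ofReal C • volume.restrict s) :=
        integral_mono_measure hle (Eventually.of_forall hF0)
          (hF.smul_measure ENNReal.ofReal_ne_top)
    _ = C * ∫ x in s, F x := by
        rw [integral_smul_measure, ENNReal.toReal_ofReal hC, smul_eq_mul]

variable {n : ℕ} {k β ρ : ℝ}

/-- Near zero the density of the perturbation exceeds any constant. -/
theorem exists_le_rpow_mul_exp (hk : 0 < k) (hρ : 0 ≤ ρ) {T A : ℝ} (hT : 0 < T) (hA : 0 < A) :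
    ∃ δ : ℝ, 0 < δ ∧ δ ≤ 1 ∧ ∀ μ ∈ Ioc 0 δ, A ≤ T * (μ ^ (-k - 1) * Real.exp (-(ρ * μ))) := by
  refine ⟨min 1 (T * Real.exp (-ρ) / A), by positivity, min_le_left _ _, fun μ hμ => ?_⟩
  have hμ0 : 0 < μ := hμ.1
  have hμ1 : μ ≤ 1 := hμ.2.trans (min_le_left _ _)
  have hμ2 : μ ≤ T * Real.exp (-ρ) / A := hμ.2.trans (min_le_right _ _)
  have h1 : μ⁻¹ ≤ μ ^ (-k - 1) := by
    rw [← Real.rpow_neg_one]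
    exact Real.rpow_le_rpow_of_exponent_ge hμ0 hμ1 (by linarith)
  have h2 : Real.exp (-ρ) ≤ Real.exp (-(ρ * μ)) := by
    gcongr
    exact mul_le_of_le_one_right hρ hμ1
  calc A ≤ T * (μ⁻¹ * Real.exp (-ρ)) := by
        rw [le_div_iff₀ hA] at hμ2
        rw [mul_left_comm, inv_mul_eq_div, le_div_iff₀ hμ0]
        linarith
    _ ≤ _ := by gcongr

/-- The function `bump` centred at the midpoint of an interval is larger on a neighbourhood of the
midpoint than anywhere outside the interval. -/
theorem exists_bump_separation (hβ : 0 < β) {δ : ℝ} (hδ0 : 0 < δ) :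
    ∃ a b r : ℝ, 0 < a ∧ a < b ∧ b ≤ δ ∧ 0 < r ∧
      (∀ μ ∈ Icc a b, r ≤ bump (β + δ / 2) 1 (β + μ)) ∧
      ∀ x : ℝ, 0 < x → x ∉ Ioc β (β + δ) → bump (β + δ / 2) 1 x < r := by
  set α := β + δ / 2 with hα
  have hα0 : 0 < α := by positivity
  -- `w` is a lower bound for `|x - α| / (x + α)` outside `J`, and `w / 2` is an upper bound
  -- for it on the smaller interval `[α - η, α + η]`
  set w := δ / 2 / (2 * β + 3 * δ / 2) with hw
  have hw0 : 0 < w := by positivity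
  have hwβ : w * (2 * β + 3 * δ / 2) = δ / 2 := div_mul_cancel₀ _ (by positivity)
  have hw1 : w < 1 := by
    rw [hw, div_lt_one (by positivity)]
    linarith
  set η := β * w with hη
  have hη0 : 0 < η := by positivity
  have hηδ : η < δ / 4 := by nlinarith [mul_pos hw0 hδ0]
  set r := 1 - w ^ 2 / 4 with hr
  have hr0 : 0 < r := by nlinarith
  set a := δ / 2 - η with ha
  set b := δ / 2 + η with hb
  have ha0 : 0 < a := by linarith
  have hab : a < b := by linarith
  have hbδ : b ≤ δ := by linarith
  have hin : ∀ μ ∈ Icc a b, r ≤ bump α 1 (β + μ) := by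
    intro μ hμ
    have hμ0 : 0 < μ := ha0.trans_le hμ.1
    have hden : 0 < β + μ + α := by positivity
    rw [bump, mul_one, hr]
    refine sub_le_sub_left ?_ 1
    have h3 : |(β + μ - α) / (β + μ + α)| ≤ w / 2 := by
      rw [abs_div, abs_of_pos hden, div_le_iff₀ hden]
      have h4 : |β + μ - α| ≤ η := abs_le.2 ⟨by linarith [hμ.1], by linarith [hμ.2]⟩
      nlinarith
    rw [← sq_abs]
    calc |(β + μ - α) / (β + μ + α)| ^ 2 ≤ (w / 2) ^ 2 := by gcongr
      _ = w ^ 2 / 4 := by ring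
  have hout : ∀ x : ℝ, 0 < x → x ∉ Ioc β (β + δ) → bump α 1 x < r := by
    intro x hx hxJ
    have hden : 0 < x + α := by positivity
    rw [bump, mul_one, hr]
    refine sub_lt_sub_left ?_ 1
    have h3 : w ≤ |(x - α) / (x + α)| := by
      rw [abs_div, abs_of_pos hden, le_div_iff₀ hden]
      rcases le_or_gt x β with hxβ | hxβ
      · rw [abs_of_neg (by linarith)]
        nlinarith
      · have h4 : β + δ < x := by
          by_contra hcon
          exact hxJ ⟨hxβ, not_lt.1 hcon⟩
        rw [abs_of_pos (by linarith)]
        nlinarith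
    have h5 : w ^ 2 ≤ |(x - α) / (x + α)| ^ 2 := by gcongr
    rw [sq_abs] at h5
    have h6 : 0 < w ^ 2 := by positivity
    linarith
  exact ⟨a, b, r, ha0, hab, hbδ, hr0, hin, hout⟩

/-- For a negative coefficient the form is negative on subspaces of every dimension: next to the
point `β` the singular density `μ ^ (-k - 1)` dominates `σ₀`, and the test functions, which vanish
at `β` to a high order, can be concentrated in the interval where it does. -/
theorem negIndex_eq_top_of_sigmaCoeff_neg {σ₀ : ℝ → ℝ} (hσ : IsFreeSigma σ₀) (v₀ : ℝ)
    (hβ : 0 < β) (hρ : 0 ≤ ρ) (hk : 0 < k) (h1 : (n : ℝ) < k) (h2 : k < n + 1)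
    (hτ : sigmaCoeff v₀ n k < 0) :
    negIndex (formDomain σ₀) (perturbedForm σ₀ (quasiCarlemanKernel v₀ β ρ k)) = ⊤ := by
  refine ENat.eq_top_iff_forall_ge.2 fun M => ?_
  obtain ⟨C, hC0, hC⟩ := hσ.exists_bound_Ioc hβ
  set T := -sigmaCoeff v₀ n k with hTd
  have hT0 : 0 < T := neg_pos.2 hτ
  obtain ⟨δ, hδ0, hδ1, hδ⟩ := exists_le_rpow_mul_exp hk hρ hT0 (show 0 < C + 1 by positivity)
  set m := n + 1 with hm
  set α := β + δ / 2 with hα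
  have hα0 : 0 < α := by positivity
  set J : Set ℝ := Ioc β (β + δ) with hJ
  have hJ0 : J ⊆ Ioi 0 := fun x hx => hβ.trans hx.1
  obtain ⟨a, b, r, ha0, hab, hbδ, hr0, hin, hout⟩ := exists_bump_separation hβ hδ0
  obtain ⟨B, j, hB0, hB⟩ := exists_norm_sq_mul_poly_le hβ M (X ^ m : ℂ[X]) hab
  obtain ⟨L, hL⟩ := hσ.exists_integrable
  set σ := sigmaMeasure σ₀ with hσd
  have hpos : ∀ᵐ x ∂σ, 0 < x := sigmaMeasure_pos σ₀
  have hJm : MeasurableSet J := measurableSet_Ioc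
  obtain ⟨hint, -⟩ := tendsto_integral_bump hpos hL hα0 1 two_pos
    (Eventually.of_forall fun x => (bump_le_one α 1 x).trans_lt one_lt_two) j
  obtain ⟨hintJ, hlim⟩ := tendsto_integral_bump (ν := σ.restrict Jᶜ) (ae_restrict_of_ae hpos)
    hL.restrict hα0 1 hr0 (by
      filter_upwards [ae_restrict_of_ae hpos, ae_restrict_mem hJm.compl] with x hx hxJ
      exact hout x hx hxJ) j
  obtain ⟨N, hNint, hNintJ, hNsmall, hNm⟩ := (hint.and (hintJ.and ((hlim.eventually_lt_const
    (show 0 < (a ^ m) ^ 2 / (B + 1) by positivity)).and (eventually_gt_atTop (M + m))))).exists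
  obtain ⟨φ, hφ⟩ := exists_test_family hα0 (q := 1) le_rfl β M (X ^ m : ℂ[X])
    (N := N) (by rwa [natDegree_X_pow])
  have hbound : ∀ s : ℝ, 0 < s → ∀ c : Fin M → ℂ, ∀ x, 0 < x → ‖laplace (φ c) x‖ ^ 2 ≤
      s ^ (2 * N) * B * (∫ y in a..b, ‖(polyOfCoeffs M c).eval (y : ℂ)‖ ^ 2) *
        ((1 + x) ^ j * (bump α 1 x / s) ^ (2 * N)) := by
    intro s hs c x hx
    have hb0 := bump_nonneg hα0 1 hx
    rw [hφ c x hx, norm_mul, mul_pow, norm_pow, Complex.norm_real, Real.norm_of_nonneg hb0,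
      ← pow_mul, mul_comm N, div_pow]
    calc _ ≤ (B * (1 + x) ^ j * ∫ y in a..b, ‖(polyOfCoeffs M c).eval (y : ℂ)‖ ^ 2) *
          bump α 1 x ^ (2 * N) := by
          gcongr
          exact hB c x hx
      _ = _ := by
          field_simp
  have hmem : ∀ c, φ c ∈ formDomain σ₀ := fun c =>
    mem_formDomain_of_integrable (hNint.const_mul _) (hbound 2 two_pos c)
  have hrank := le_negIndex_of_linearMap (D := formDomain σ₀)
    (q := perturbedForm σ₀ (quasiCarlemanKernel v₀ β ρ k)) φ hmem ?_ (perturbedForm_zero_re _ _)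
  · rwa [Module.finrank_fin_fun] at hrank
  intro c hc
  set p := polyOfCoeffs M c with hp
  set I : ℝ := ∫ y in a..b, ‖p.eval (y : ℂ)‖ ^ 2 with hI
  have hI0 : 0 < I := integral_norm_sq_poly_pos (polyOfCoeffs_ne_zero hc) hab
  have hcont : Continuous fun μ : ℝ => ‖p.eval (μ : ℂ)‖ :=
    (p.continuous.comp Complex.continuous_ofReal).norm
  have hlap : ∀ μ : ℝ, 0 < μ → ‖laplace (φ c) (β + μ)‖ =
      ‖p.eval (μ : ℂ)‖ * μ ^ m * bump α 1 (β + μ) ^ N := by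
    intro μ hμ
    rw [hφ c _ (by positivity), add_sub_cancel_left, eval_pow, eval_X, norm_mul, norm_mul,
      norm_pow, norm_pow, Complex.norm_real, Complex.norm_real, Real.norm_of_nonneg hμ.le,
      Real.norm_of_nonneg (bump_nonneg hα0 _ (by positivity))]
  have hO : (fun μ : ℝ => laplace (φ c) (β + μ)) =O[𝓝[>] 0] fun μ : ℝ => μ ^ m := by
    have h3 : (fun μ : ℝ => ‖p.eval (μ : ℂ)‖) =O[𝓝[>] 0] fun _ : ℝ => (1 : ℝ) :=
      ((hcont.tendsto 0).mono_left nhdsWithin_le_nhds).isBigO_one ℝ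
    have h4 := h3.mul (isBigO_refl (fun μ : ℝ => μ ^ m) (𝓝[>] 0))
    simp only [one_mul] at h4
    refine IsBigO.trans (IsBigO.of_bound 1 ?_) h4
    filter_upwards [self_mem_nhdsWithin] with μ hμ
    have hμ0 : 0 < μ := hμ
    rw [hlap μ hμ0, one_mul, Real.norm_of_nonneg (by positivity)]
    exact mul_le_of_le_one_right (by positivity)
      (pow_le_one₀ (bump_nonneg hα0 _ (by positivity)) (bump_le_one _ _ _))
  obtain ⟨hWint, hform⟩ := hankel_form_eq_of_isBigO v₀ hβ hρ h1 h2 (m := m) (by omega) (φ c) hO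
  set W : ℝ → ℝ := fun μ => μ ^ (-k - 1) * laplaceDensity β ρ (φ c) μ with hWd
  set F : ℝ → ℝ := fun x => ‖laplace (φ c) x‖ ^ 2 with hF
  have hW0 : ∀ μ ∈ Ioi (0 : ℝ), 0 ≤ W μ := by
    intro μ hμ
    have hμ0 : 0 < μ := hμ
    simp only [hWd, laplaceDensity]
    positivity
  have hsub : Ioc 0 δ ⊆ Ioi (0 : ℝ) := fun μ hμ => hμ.1
  have hdom : ∀ μ ∈ Ioc 0 δ, (C + 1) * F (β + μ) ≤ T * W μ := by
    intro μ hμ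
    calc (C + 1) * F (β + μ) ≤ T * (μ ^ (-k - 1) * Real.exp (-(ρ * μ))) * F (β + μ) := by
          refine mul_le_mul_of_nonneg_right (hδ μ hμ) (by positivity)
      _ = _ := by
          simp only [hWd, laplaceDensity, hF]
          ring
  have hFint : IntegrableOn (fun μ => F (β + μ)) (Ioc 0 δ) := by
    refine ((hWint.mono_set hsub).const_mul T).mono' ?_ ?_
    · exact (((stronglyMeasurable_laplace (φ c)).norm.pow 2).comp_measurable
        (measurable_const_add β)).aestronglyMeasurable
    filter_upwards [ae_restrict_mem measurableSet_Ioc] with μ hμ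
    rw [Real.norm_of_nonneg (by positivity)]
    have h3 : 0 ≤ C * F (β + μ) := by positivity
    linarith [hdom μ hμ]
  have hFintJ : IntegrableOn F J := by
    have h3 := ((intervalIntegrable_iff_integrableOn_Ioc_of_le hδ0.le).2 hFint).comp_add_left (-β)
    simp only [add_neg_cancel_left, sub_neg_eq_add, zero_add] at h3
    rwa [add_comm δ, intervalIntegrable_iff_integrableOn_Ioc_of_le (by linarith)] at h3
  have hshift : ∫ x in J, F x = ∫ μ in Ioc 0 δ, F (β + μ) := by
    rw [← intervalIntegral.integral_of_le hδ0.le, intervalIntegral.integral_comp_add_left,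
      add_zero, intervalIntegral.integral_of_le (by linarith)]
  set S : ℝ := ∫ μ in Ioc 0 δ, F (β + μ) with hS
  -- on `J` the perturbation beats `σ₀`, with `S` to spare
  have hupper : (C + 1) * S ≤ T * ∫ μ in Ioi (0 : ℝ), W μ := by
    rw [hS, ← integral_const_mul, ← integral_const_mul]
    calc ∫ μ in Ioc 0 δ, (C + 1) * F (β + μ) ≤ ∫ μ in Ioc 0 δ, T * W μ :=
          setIntegral_mono_on (hFint.const_mul _) ((hWint.mono_set hsub).const_mul T)
            measurableSet_Ioc hdom
      _ ≤ _ := by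
          refine setIntegral_mono_set (hWint.const_mul T) ?_ (LE.le.eventuallyLE hsub)
          filter_upwards [ae_restrict_mem measurableSet_Ioi] with μ hμ
          exact mul_nonneg hT0.le (hW0 μ hμ)
  -- `S` is at least of order `r ^ (2 N)`, whereas the integral outside `J` is `o(r ^ (2 N))`
  have hlower : r ^ (2 * N) * (a ^ m) ^ 2 * I ≤ S := by
    have hsub' : Ioc a b ⊆ Ioc 0 δ := Ioc_subset_Ioc ha0.le hbδ
    rw [hI, intervalIntegral.integral_of_le hab.le, ← integral_const_mul]
    calc _ ≤ ∫ μ in Ioc a b, F (β + μ) := by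
          refine setIntegral_mono_on (continuous_const.mul (hcont.pow 2)).integrableOn_Ioc
            (hFint.mono_set hsub') measurableSet_Ioc fun μ hμ => ?_
          have hμ0 : 0 < μ := ha0.trans hμ.1
          have hrb := hin μ ⟨hμ.1.le, hμ.2⟩
          simp only [hF]
          rw [hlap μ hμ0]
          calc r ^ (2 * N) * (a ^ m) ^ 2 * ‖p.eval (μ : ℂ)‖ ^ 2
              = (‖p.eval (μ : ℂ)‖ * a ^ m * r ^ N) ^ 2 := by ring
            _ ≤ _ := by
                have := hμ.1.le
                gcongr
      _ ≤ _ := setIntegral_mono_set hFint (Eventually.of_forall fun μ => by positivity)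
          (LE.le.eventuallyLE hsub')
  have hFσ : Integrable F σ := integrable_norm_sq_laplace (hmem c)
  have hJle : ∫ x in J, F x ∂σ ≤ C * S := by
    rw [← hshift]
    refine setIntegral_sigmaMeasure_le hC0 hJm hJ0 ?_ (fun x => by positivity) hFintJ
    filter_upwards [hC] with x hx hxJ
    exact hx ⟨hxJ.1, hxJ.2.trans (by linarith)⟩
  have hJc : ∫ x in Jᶜ, F x ∂σ ≤ r ^ (2 * N) * B * I * ((a ^ m) ^ 2 / (B + 1)) := by
    calc ∫ x in Jᶜ, F x ∂σ ≤ ∫ x in Jᶜ, r ^ (2 * N) * B * I *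
          ((1 + x) ^ j * (bump α 1 x / r) ^ (2 * N)) ∂σ := by
          refine integral_mono_ae hFσ.restrict (hNintJ.const_mul _) ?_
          filter_upwards [ae_restrict_of_ae hpos] with x hx
          exact hbound r hr0 c x hx
      _ = r ^ (2 * N) * B * I * ∫ x in Jᶜ, (1 + x) ^ j * (bump α 1 x / r) ^ (2 * N) ∂σ :=
          integral_const_mul _ _
      _ ≤ _ := by gcongr
  have hstrict : r ^ (2 * N) * B * I * ((a ^ m) ^ 2 / (B + 1)) < r ^ (2 * N) * (a ^ m) ^ 2 * I := by
    have h8 : B / (B + 1) < 1 := by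
      rw [div_lt_one (by positivity)]
      linarith
    have h9 : 0 < r ^ (2 * N) * (a ^ m) ^ 2 * I := by positivity
    calc _ = B / (B + 1) * (r ^ (2 * N) * (a ^ m) ^ 2 * I) := by ring
      _ < 1 * (r ^ (2 * N) * (a ^ m) ^ 2 * I) := by gcongr
      _ = _ := one_mul _
  rw [perturbedForm, hform, freeForm_self, ← Complex.ofReal_add, Complex.ofReal_re,
    ← integral_add_compl hJm hFσ]
  have hτT : sigmaCoeff v₀ n k = -T := by rw [hTd, neg_neg]
  rw [hτT]
  linarith

end NegativeCoefficient

/-! ### The perturbed operator -/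

section Conclusion

/-- The form is the sum of the square of the closed operator `laplaceLp` and of a compact form. -/
theorem exists_formOperator (σ₀ : ℝ → ℝ) (hσ₀ : IsFreeSigma σ₀) (v₀ : ℝ) {β ρ k : ℝ} (hβ : 0 < β)
    (hρ : 0 ≤ ρ) (hk : 0 ≤ k) : ∃ H : L2Pos →ₗ.[ℂ] L2Pos, IsSelfAdjoint H ∧
      IsOperatorOfForm (formDomain σ₀) (perturbedForm σ₀ (quasiCarlemanKernel v₀ β ρ k)) H ∧
      negEigenvalueCount H =
        negIndex (formDomain σ₀) (perturbedForm σ₀ (quasiCarlemanKernel v₀ β ρ k)) := by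
  obtain ⟨C, hC⟩ := exists_abs_quasiCarlemanKernel_le v₀ hβ hρ hk
  obtain ⟨K, hKc, hK, hKform⟩ := exists_hankel_operator (continuousOn_quasiCarlemanKernel v₀ β hρ)
    (half_pos hβ) hC
  have hq : ∀ f g : formDomain σ₀, perturbedForm σ₀ (quasiCarlemanKernel v₀ β ρ k) f g =
      sumForm (formDomain σ₀) (laplaceLp σ₀) K g f := fun f g => by
    rw [perturbedForm, hKform, sumForm, inner_laplaceLp]
  have hD := dense_formDomain hσ₀
  have hS := hasClosedGraph_laplaceLp σ₀
  exact ⟨formOperator (formDomain σ₀) (laplaceLp σ₀) K, isSelfAdjoint_formOperator hD hS hK,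
    isOperatorOfForm_formOperator hD hq, negEigenvalueCount_formOperator hD hS hK hKc hq⟩

end Conclusion

end HankelPerturbation

theorem mainTheorem3 (σ₀ : ℝ → ℝ) (hσ₀ : HankelPerturbation.IsFreeSigma σ₀)
    (v₀ β ρ k : ℝ) (hβ : 0 < β) (hρ : 0 ≤ ρ) (hk : 0 < k) (hk' : ∀ n : ℕ, k ≠ n) :
    ∃ H : HankelPerturbation.L2Pos →ₗ.[ℂ] HankelPerturbation.L2Pos,
      IsSelfAdjoint H ∧
      HankelPerturbation.IsOperatorOfForm (HankelPerturbation.formDomain σ₀)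
        (HankelPerturbation.perturbedForm σ₀
          (HankelPerturbation.quasiCarlemanKernel v₀ β ρ k)) H ∧
      (0 < v₀ → Odd ⌊k⌋₊ →
        HankelPerturbation.NegNumberEq (HankelPerturbation.formDomain σ₀)
          (HankelPerturbation.perturbedForm σ₀
            (HankelPerturbation.quasiCarlemanKernel v₀ β ρ k)) H
          (((⌊k⌋₊ + 1) / 2 : ℕ) : ℕ∞)) ∧
      (v₀ < 0 → Even ⌊k⌋₊ →
        HankelPerturbation.NegNumberEq (HankelPerturbation.formDomain σ₀)
          (HankelPerturbation.perturbedForm σ₀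
            (HankelPerturbation.quasiCarlemanKernel v₀ β ρ k)) H
          ((⌊k⌋₊ / 2 + 1 : ℕ) : ℕ∞)) ∧
      ((0 < v₀ ∧ Even ⌊k⌋₊) ∨ (v₀ < 0 ∧ Odd ⌊k⌋₊) →
        HankelPerturbation.NegNumberEq (HankelPerturbation.formDomain σ₀)
          (HankelPerturbation.perturbedForm σ₀
            (HankelPerturbation.quasiCarlemanKernel v₀ β ρ k)) H ⊤) := by
  obtain ⟨H, hH, hform, hcount⟩ :=
    HankelPerturbation.exists_formOperator σ₀ hσ₀ v₀ hβ hρ hk.le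
  set n := ⌊k⌋₊ with hn
  have h1 : (n : ℝ) < k := lt_of_le_of_ne (Nat.floor_le hk.le) (hk' n).symm
  have h2 : k < n + 1 := Nat.lt_floor_add_one k
  have hR := HankelPerturbation.remConst_pos h1 h2
  have hfinite : 0 < HankelPerturbation.sigmaCoeff v₀ n k →
      HankelPerturbation.negIndex (HankelPerturbation.formDomain σ₀)
        (HankelPerturbation.perturbedForm σ₀
          (HankelPerturbation.quasiCarlemanKernel v₀ β ρ k)) = ((n / 2 + 1 : ℕ) : ℕ∞) := fun hτ =>
    le_antisymm (HankelPerturbation.negIndex_le_of_sigmaCoeff_pos σ₀ v₀ hβ hρ h1 h2 hτ)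
      (HankelPerturbation.le_negIndex_of_sigmaCoeff_pos hσ₀ v₀ hβ hρ h1 h2 hτ)
  have hinfinite : HankelPerturbation.sigmaCoeff v₀ n k < 0 →
      HankelPerturbation.negIndex (HankelPerturbation.formDomain σ₀)
        (HankelPerturbation.perturbedForm σ₀
          (HankelPerturbation.quasiCarlemanKernel v₀ β ρ k)) = ⊤ := fun hτ =>
    HankelPerturbation.negIndex_eq_top_of_sigmaCoeff_neg hσ₀ v₀ hβ hρ hk h1 h2 hτ
  have hodd : Odd n → HankelPerturbation.sigmaCoeff v₀ n k =
      v₀ / HankelPerturbation.remConst n k := fun h => by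
    rw [HankelPerturbation.sigmaCoeff, h.add_one.neg_one_pow, mul_one]
  have heven : Even n → HankelPerturbation.sigmaCoeff v₀ n k =
      -v₀ / HankelPerturbation.remConst n k := fun h => by
    rw [HankelPerturbation.sigmaCoeff, h.add_one.neg_one_pow, mul_neg_one]
  refine ⟨H, hH, hform, fun hv h => ?_, fun hv h => ?_, fun h => ?_⟩
  · have hτ : 0 < HankelPerturbation.sigmaCoeff v₀ n k := by
      rw [hodd h]
      positivity
    have hhalf : (n + 1) / 2 = n / 2 + 1 := by
      obtain ⟨l, hl⟩ := h
      omega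
    rw [hhalf]
    exact ⟨hcount.trans (hfinite hτ), hfinite hτ⟩
  · have hτ : 0 < HankelPerturbation.sigmaCoeff v₀ n k := by
      rw [heven h]
      exact div_pos (neg_pos.2 hv) hR
    exact ⟨hcount.trans (hfinite hτ), hfinite hτ⟩
  · have hτ : HankelPerturbation.sigmaCoeff v₀ n k < 0 := by
      rcases h with ⟨hv, h⟩ | ⟨hv, h⟩
      · rw [heven h]
        exact div_neg_of_neg_of_pos (neg_neg_of_pos hv) hR
      · rw [hodd h]
        exact div_neg_of_neg_of_pos hv hR
    exact ⟨hcount.trans (hinfinite hτ), hinfinite hτ⟩
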